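/- **Setting.** Let $p$ be a prime, $f\ge 1$, $q=p^f$, $K$ the unramified extension of $\mathbb{Q}_p$ of degree $f$ with ring of integers $W(\mathbb{F}_q)$, and $\mathcal{O}$ the ring of integers of a finite extension of $K$, with residue field $\mathbb{F}$. Let $\pi^{q-1}=-p$, $L=K(\pi)$, $\Delta=\mathrm{Gal}(L/K)$, and let $\omega_f:\Delta\to W(\mathbb{F}_q)^\times\subset\mathcal{O}^\times$ be $g\mapsto g(\pi)/\pi$. Put $E(u)=u^{q-1}+p$ and $v=u^{q-1}$. Write $\sigma_j=\sigma_0\circ\varphi^{-j}$ ($j\in\mathbb{Z}/f$) for the embeddings $W(\mathbb{F}_q)\to\mathcal{O}$, where $\sigma_0$ is the inclusion and $\varphi$ is the Frobenius. Let $a_{k,i}\in\mathbb{Z}$ ($k\in\{1,2\}$, $i\in\mathbb{Z}/f$) satisfy $2\le|a_{1,i}-a_{2,i}|\le p-3$ for all $i$. Put $\mathbf{a}_k^{(j)}=\sum_{i=0}^{f-1}a_{k,-j+i}\,p^i$ and $\eta_k=\omega_f^{-\mathbf{a}_k^{(0)}}$; then $\tau=\eta_1\oplus\eta_2$ is a generic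 tame principal series type. Its orientation is $s=(s_j)_{j\in\mathbb{Z}/f}\in S_2^{\mathbb{Z}/f}$ with $\mathbf{a}^{(j)}_{s_j(1)}>\mathbf{a}^{(j)}_{s_j(2)}$ for all $j$. For an $\mathcal{O}$-algebra $R$, a Kisin module with descent datum over $R$ is a finitely generated projective module $\mathfrak{M}$ over $(W(\mathbb{F}_q)\otimes_{\mathbb{Z}_p}R)[\![u]\!]$ with a $\varphi$-semilinear map $\phi$ (where $\varphi(u)=u^p$ and $\varphi$ is trivial on $R$) and a commuting semilinear action of $\Delta$ (where $g(u)=(g(\pi)/\pi)u$ and $g$ is trivial on coefficients). It decomposes as $\mathfrak{M}=\bigoplus_{j\in\mathbb{Z}/f}\mathfrak{M}^{(j)}$, where $W(\mathbb{F}_q)$ acts on $\mathfrak{M}^{(j)}$ through $\sigma_j$, and $\phi$ maps $\mathfrak{M}^{(j)}$ to $\mathfrak{M}^{(j+1)}$. It lies in $Y^{(0,1),\tau}(R)$ if $\mathfrak{M}^{(j)}/u\cong\tau\otimes_{\mathcal{O}}R$ as a $\Delta$-representation for each $j$, and $E(u)$ annihilates the cokernels of the linearizations $\varphi^*\mathfrak{M}\to\mathfrak{M}$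 and $\varphi^*(\det\mathfrak{M})\to\det\mathfrak{M}$. An eigenbasis $\beta$ consists of ordered $R[\![u]\!]$-bases $(f_1^{(j)},f_2^{(j)})$ of $\mathfrak{M}^{(j)}$ such that $\Delta$ acts on $f_k^{(j)}$ through $\eta_k$. Let $\phi^{(i)}_{\mathfrak{M},s_{i+1}(2)}$ be the $R[\![v]\!]$-linear map induced by $\varphi^*(\mathfrak{M}^{(i)})\to\mathfrak{M}^{(i+1)}$ on $\eta_{s_{i+1}(2)}$-eigenspaces. With $s=s_{i+1}$ and $d=\mathbf{a}^{(i+1)}_{s(1)}-\mathbf{a}^{(i+1)}_{s(2)}$, the matrix $\mathrm{Mat}_\beta(\phi^{(i)}_{\mathfrak{M},s_{i+1}(2)})\in M_2(R[\![v]\!])$ is its matrix with respect to the bases $(u^d\otimes f^{(i)}_{s(1)},\,1\otimes f^{(i)}_{s(2)})$ and $(u^d f^{(i+1)}_{s(1)},\,f^{(i+1)}_{s(2)})$, acting on column vectors. **Theorem.** Let $R$ be a complete local Noetherian $\mathcal{O}$-algebra with maximal ideal $\mathfrak{m}$ and residue field $\mathbb{F}$, and let $\mathfrak{M}_R\in Y^{(0,1),\tau}(R)$.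 Let $a_i\in\mathbb{F}$ ($i\in\mathbb{Z}/f$) and $\alpha,\alpha'\in\mathbb{F}^\times$. For each $i$ choose $j=j(i)\in\{1,2,3\}$, where $j(i)=3$ is allowed only if $a_i\neq0$. Suppose that $\overline\beta$ is an eigenbasis of $\mathfrak{M}_R\otimes_R\mathbb{F}$ such that $\mathrm{Mat}_{\overline\beta}(\phi^{(i)}_{\mathfrak{M}_R\otimes_R\mathbb{F},s_{i+1}(2)})$ is $\overline{A}_{j(i)}$ for $i\ne0$ and $\overline{A}_{j(0)}\begin{pmatrix}\alpha&\\&\alpha'\end{pmatrix}$ for $i=0$, where $$\overline{A}_1=\begin{pmatrix}v&0\\a_iv&1\end{pmatrix},\quad \overline{A}_2=\begin{pmatrix}0&1\\v&0\end{pmatrix},\quad \overline{A}_3=\begin{pmatrix}0&1\\v&a_i\end{pmatrix}.$$ Then there is an eigenbasis $\beta$ of $\mathfrak{M}_R$ lifting $\overline\beta$, and there are $X_i,Y_i,X_\alpha,X_{\alpha'}\in\mathfrak{m}$ with $X_iY_i=p$ whenever $j(i)=2$, such that $\mathrm{Mat}_\beta(\phi^{(i)}_{\mathfrak{M}_R,s_{i+1}(2)})$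 is $A_{j(i)}$ for $i\neq0$ and $A_{j(0)}D(\alpha,\alpha')$ for $i=0$, where $$A_1=\begin{pmatrix}v+p&0\\(X_i+[a_i])v&1\end{pmatrix},\quad A_2=\begin{pmatrix}-Y_i&1\\v&X_i\end{pmatrix},\quad A_3=\begin{pmatrix}-p(X_i+[a_i])^{-1}&1\\v&X_i+[a_i]\end{pmatrix},$$ $$D(\alpha,\alpha')=\begin{pmatrix}[\alpha]+X_\alpha&0\\0&[\alpha']+X_{\alpha'}\end{pmatrix},$$ and $[\cdot]$ is the Teichmüller lift. Moreover $\beta$ is unique up to scaling: if $\beta=(f_k^{(j)})$ and $\beta'=(f_k'^{(j)})$ are two eigenbases of $\mathfrak{M}_R$ lifting $\overline\beta$ with matrices of this form (for possibly different parameters in $\mathfrak{m}$), then for all $j,k$ there is $t_k^{(j)}\in R^\times$ with $f_k'^{(j)}=t_k^{(j)}f_k^{(j)}$. -/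

import Mathlib

open PowerSeries IsLocalRing
open scoped TensorProduct

noncomputable section

namespace KisinGL2

/-! ## Tame principal series types -/

/-- A pair `(𝐚₁, 𝐚₂)` of tuples of integers `a_{κ,i}`, `i ∈ ℤ/f`.  The two labels `1, 2` are
`0, 1 : Fin 2`. -/
abbrev Exponents (f : ℕ) : Type := Fin 2 → ZMod f → ℤ

/-- `𝐚_κ^{(j)} = ∑_{i=0}^{f-1} a_{κ,-j+i} pⁱ`. -/
def Exponents.shifted {f : ℕ} (a : Exponents f) (p : ℕ) (κ : Fin 2) (j : ZMod f) : ℤ :=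
  ∑ i ∈ Finset.range f, a κ (-j + (i : ZMod f)) * (p : ℤ) ^ i

/-- Genericity: `2 ≤ |a_{1,i} - a_{2,i}| ≤ p - 3` for all `i`. -/
def Exponents.IsGeneric {f : ℕ} (a : Exponents f) (p : ℕ) : Prop :=
  ∀ i : ZMod f, 2 ≤ |a 0 i - a 1 i| ∧ |a 0 i - a 1 i| ≤ (p : ℤ) - 3

/-- `s = (s_j)_j` is the orientation of `(𝐚₁, 𝐚₂)`: `𝐚^{(j)}_{s_j(1)} > 𝐚^{(j)}_{s_j(2)}`. -/
def Exponents.IsOrientation {f : ℕ} (a : Exponents f) (p : ℕ)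
    (s : ZMod f → Equiv.Perm (Fin 2)) : Prop :=
  ∀ j : ZMod f, a.shifted p (s j 1) j < a.shifted p (s j 0) j

section Characters

/-- `W(𝔽_q)`, the ring of integers of the unramified extension `K` of `ℚ_p` of degree `f`. -/
abbrev WittFq (p : ℕ) [Fact p.Prime] (f : ℕ) : Type := WittVector p (GaloisField p f)

variable (p : ℕ) [Fact p.Prime] (f : ℕ) (R : Type*) [CommRing R] [Algebra (WittFq p f) R]

/-- The group `Δ = Gal(L/K)`, `L = K((-p)^{1/(q-1)})`, is identified with `𝔽_qˣ` by
`g ↦ (g(π)/π mod p)`, where `π^{q-1} = -p`; then `g(π)/π ∈ W(𝔽_q)` is the Teichmüller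
representative of `g`.  `omega j g` is its image in `R` under the embedding
`σ_j = σ_0 ∘ φ^{-j}`, where `σ_0 : W(𝔽_q) → R` is the structure map; recall that `φ` raises
Teichmüller representatives to the `p`-th power and `φ^f = 1`.  In particular `omega 0` is the
fundamental character `ω_f`. -/
def omega (j : ZMod f) : (GaloisField p f)ˣ →* Rˣ :=
  (Units.map ((algebraMap (WittFq p f) R : WittFq p f →* R).comp
    (WittVector.teichmuller p))).comp (powMonoidHom (p ^ (-j).val))

variable {f}

/-- The characters `η_κ = ω_f^{-𝐚_κ^{(0)}}` of `Δ`, whose sum is the principal series type `τ`. -/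
def Exponents.eta (a : Exponents f) (κ : Fin 2) (g : (GaloisField p f)ˣ) : Rˣ :=
  omega p f R 0 g ^ (-(a.shifted p κ 0))

theorem omega_succ_pow [hf : NeZero f] (j : ZMod f) (g : (GaloisField p f)ˣ) :
    omega p f R (j + 1) g ^ p = omega p f R j g := by
  have hq : ∀ x : (GaloisField p f)ˣ, x ^ p ^ f = x := by
    intro x
    have : Fintype (GaloisField p f) := Fintype.ofFinite _
    have hc : Fintype.card (GaloisField p f) = p ^ f := by
      rw [← Nat.card_eq_fintype_card, GaloisField.card p f hf.out]
    ext
    rw [Units.val_pow_eq_pow_val, ← hc, FiniteField.pow_card]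
  have hmod : ∀ (n m : ℕ) (x : (GaloisField p f)ˣ), x ^ p ^ (m + f * n) = x ^ p ^ m := by
    intro n m x
    induction n with
    | zero => simp
    | succ n ih => rw [mul_add, mul_one, ← add_assoc, pow_add p, pow_mul, ih, ← pow_mul, mul_comm,
        pow_mul, hq]
  have hmod' : ∀ (m : ℕ) (x : (GaloisField p f)ˣ), x ^ p ^ m = x ^ p ^ (m % f) := by
    intro m x
    conv_lhs => rw [← Nat.mod_add_div m f]
    exact hmod _ _ x
  have key : (g ^ p ^ (-(j + 1)).val) ^ p = g ^ p ^ (-j).val := by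
    rw [← pow_mul, ← pow_succ, hmod' ((-(j + 1)).val + 1), hmod' (-j).val]
    congr 2
    change Nat.ModEq f _ _
    rw [← ZMod.natCast_eq_natCast_iff]
    simp
  rw [← map_pow]
  simp only [omega, MonoidHom.comp_apply, powMonoidHom_apply]
  rw [← key, ← pow_mul, ← pow_mul, mul_comm]

end Characters

/-! ## Kisin modules with descent datum -/

section Kisin

/-- The endomorphism `φ` of `R⟦u⟧`: it is `R`-linear and `u ↦ u^p`. -/
def frob (p : ℕ) [hp : Fact p.Prime] (R : Type*) [CommRing R] : R⟦X⟧ →+* R⟦X⟧ :=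
  (PowerSeries.expand p hp.out.ne_zero : R⟦X⟧ →ₐ[R] R⟦X⟧).toRingHom

/-- Kisin modules over `R` with descent datum.  Since `R` is a `W(𝔽_q)`-algebra, the
ring `𝔖_R = (W(𝔽_q) ⊗_{ℤ_p} R)⟦u⟧` is the product over `j ∈ ℤ/f` of copies of `R⟦u⟧`, the `j`-th one
being that on which `W(𝔽_q)` acts through `σ_j = σ_0 ∘ φ^{-j}`.  So an `𝔖_R`-module is a family of
`R⟦u⟧`-modules `M j = 𝔐^{(j)}`; a `φ`-semilinear map is a family of maps `𝔐^{(j)} → 𝔐^{(j+1)}`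
which are semilinear for `u ↦ u^p`; a semilinear action of `Δ ≃ 𝔽_qˣ` is an action on each
`𝔐^{(j)}`, where `g` is semilinear for `u ↦ σ_j(g(π)/π) u`. -/
structure KisinModule (p : ℕ) [Fact p.Prime] (f : ℕ)
    (R : Type*) [CommRing R] [Algebra (WittFq p f) R]
    (M : ZMod f → Type*) [∀ j, AddCommGroup (M j)] [∀ j, Module R⟦X⟧ (M j)] where
  finite : ∀ j, Module.Finite R⟦X⟧ (M j)
  projective : ∀ j, Module.Projective R⟦X⟧ (M j)
  phi : ∀ j, M j →ₛₗ[frob p R] M (j + 1)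
  act : ∀ j (g : (GaloisField p f)ˣ), M j →ₛₗ[PowerSeries.rescale (omega p f R j g : R)] M j
  act_one : ∀ j m, act j 1 m = m
  act_mul : ∀ j g h m, act j (g * h) m = act j g (act j h m)
  phi_act : ∀ j g m, phi j (act j g m) = act (j + 1) g (phi j m)

variable {p : ℕ} [Fact p.Prime] {f : ℕ}
  {R : Type*} [CommRing R] [Algebra (WittFq p f) R]
  {M : ZMod f → Type*} [∀ j, AddCommGroup (M j)] [∀ j, Module R⟦X⟧ (M j)]

/-- `𝔐` has type `τ = η₁ ⊕ η₂`: for all `j`, the `R`-module `𝔐^{(j)} / u` has a basis of two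
vectors on which `Δ` acts through `η₁` and `η₂`. -/
def KisinModule.HasType (𝔐 : KisinModule p f R M) (a : Exponents f) : Prop :=
  ∀ j, ∃ b : Module.Basis (Fin 2) (R⟦X⟧ ⧸ Ideal.span {(X : R⟦X⟧)})
      (M j ⧸ Ideal.span {(X : R⟦X⟧)} • (⊤ : Submodule R⟦X⟧ (M j))),
    ∀ (κ : Fin 2) (g : (GaloisField p f)ˣ) (m : M j), Submodule.Quotient.mk m = b κ →
      Submodule.Quotient.mk (𝔐.act j g m) = C (a.eta p R κ g : R) • b κ

/-- `E(u) = u^{q-1} + p`, where `q = p^f`. -/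
def eisenstein (p f : ℕ) (R : Type*) [CommRing R] : R⟦X⟧ :=
  X ^ (p ^ f - 1) + C (p : R)

/-- `𝔐 ∈ Y^{(0,1),τ}(R)`: `𝔐` has type `τ`, and `E(u)` annihilates the cokernels of
`φ^*(𝔐^{(j)}) → 𝔐^{(j+1)}` and of `φ^*(⋀² 𝔐^{(j)}) → ⋀² 𝔐^{(j+1)}` for all `j`.  The images of these
two maps are the `R⟦u⟧`-spans of the `φ(x)` and of the `φ(x) ∧ φ(y)`. -/
structure KisinModule.MemY (𝔐 : KisinModule p f R M) (a : Exponents f) : Prop where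
  hasType : 𝔐.HasType a
  coker : ∀ j (m : M (j + 1)),
    eisenstein p f R • m ∈ Submodule.span R⟦X⟧ (Set.range (𝔐.phi j))
  coker_det : ∀ j (w : ⋀[R⟦X⟧]^2 (M (j + 1))),
    eisenstein p f R • w ∈ Submodule.span R⟦X⟧ (Set.range fun xy : M j × M j =>
      exteriorPower.ιMulti R⟦X⟧ 2 ![𝔐.phi j xy.1, 𝔐.phi j xy.2])

/-- An eigenbasis of `𝔐`: for each `j` an ordered basis `(f₁, f₂)` of `𝔐^{(j)}` over `R⟦u⟧` such that
`Δ` acts on `f_κ` through `η_κ`. -/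
structure Eigenbasis (𝔐 : KisinModule p f R M) (a : Exponents f) where
  basis : ∀ j, Module.Basis (Fin 2) R⟦X⟧ (M j)
  eigen : ∀ j κ g, 𝔐.act j g (basis j κ) = C (a.eta p R κ g : R) • basis j κ

/-- The exponent `d = 𝐚^{(j)}_{s_j(l)} - 𝐚^{(j)}_{s_j(2)}`, for which `u^d f_{s_j(l)}` is an eigenvector
for `η_{s_j(2)}`.  It is `0` for `l = 2`, and positive for `l = 1` if `s` is the orientation. -/
def Exponents.gap {f : ℕ} (a : Exponents f) (p : ℕ) (s : ZMod f → Equiv.Perm (Fin 2))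
    (j : ZMod f) (l : Fin 2) : ℕ :=
  (a.shifted p (s j l) j - a.shifted p (s j 1) j).toNat

/-- Substitution of `v = u^{q-1}` in a power series in `v`. -/
def vToU (p f : ℕ) [hp : Fact p.Prime] [hf : NeZero f] (R : Type*) [CommRing R] :
    R⟦X⟧ →+* R⟦X⟧ :=
  (PowerSeries.expand (p ^ f - 1)
    (Nat.sub_ne_zero_of_lt (Nat.one_lt_pow hf.out hp.out.one_lt)) : R⟦X⟧ →ₐ[R] R⟦X⟧).toRingHom

/-- `Mat_β(φ^{(i)}_{𝔐, s_{i+1}(2)}) = A`.  Put `s = s_{i+1}` and `d = 𝐚^{(i+1)}_{s(1)} - 𝐚^{(i+1)}_{s(2)}`.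
`φ^{(i)}_{𝔐, s(2)}` is the `R⟦v⟧`-linear map induced by `φ^*(𝔐^{(i)}) → 𝔐^{(i+1)}` on the
`η_{s(2)}`-eigenspaces of `Δ`; these have the bases
`(u^d ⊗ f^{(i)}_{s(1)}, 1 ⊗ f^{(i)}_{s(2)})` and `(u^d f^{(i+1)}_{s(1)}, f^{(i+1)}_{s(2)})`, and the columns of
`A` are the coordinates of the images of the first in the second. -/
def Eigenbasis.HasMatrix [NeZero f] {𝔐 : KisinModule p f R M} {a : Exponents f}
    (β : Eigenbasis 𝔐 a) (s : ZMod f → Equiv.Perm (Fin 2)) (i : ZMod f)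
    (A : Matrix (Fin 2) (Fin 2) R⟦X⟧) : Prop :=
  ∀ l : Fin 2,
    (X : R⟦X⟧) ^ a.gap p s (i + 1) l • 𝔐.phi i (β.basis i (s (i + 1) l)) =
      ∑ m : Fin 2, vToU p f R (A m l) •
        ((X : R⟦X⟧) ^ a.gap p s (i + 1) m • β.basis (i + 1) (s (i + 1) m))

end Kisin

/-! ## Base change -/

section BaseChange

/-- The base change of a semilinear map: `c ⊗ m ↦ σ'(c) ⊗ g(m)`. -/
def semilinearBaseChange {A B : Type*} [CommRing A] [CommRing B] [Algebra A B]
    (σ : A →+* A) (σ' : B →+* B) (hσ : ∀ x, σ' (algebraMap A B x) = algebraMap A B (σ x))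
    {M N : Type*} [AddCommGroup M] [Module A M] [AddCommGroup N] [Module A N]
    (g : M →ₛₗ[σ] N) : (B ⊗[A] M) →ₛₗ[σ'] (B ⊗[A] N) :=
  let σB : B →ₛₗ[σ] B :=
    { toFun := σ'
      map_add' := map_add σ'
      map_smul' := fun r x => by rw [Algebra.smul_def, Algebra.smul_def, map_mul, hσ] }
  { toFun := TensorProduct.map σB g
    map_add' := map_add _
    map_smul' := fun c x => by
      induction x using TensorProduct.induction_on with
      | zero => simp
      | tmul y m =>
        rw [TensorProduct.smul_tmul', TensorProduct.map_tmul, TensorProduct.map_tmul,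
          TensorProduct.smul_tmul']
        congr 1
        exact map_mul σ' c y
      | add x y hx hy => rw [smul_add, map_add, map_add, smul_add, hx, hy] }

theorem semilinearBaseChange_tmul {A B : Type*} [CommRing A] [CommRing B] [Algebra A B]
    (σ : A →+* A) (σ' : B →+* B) (hσ : ∀ x, σ' (algebraMap A B x) = algebraMap A B (σ x))
    {M N : Type*} [AddCommGroup M] [Module A M] [AddCommGroup N] [Module A N]
    (g : M →ₛₗ[σ] N) (c : B) (m : M) :
    semilinearBaseChange σ σ' hσ g (c ⊗ₜ m) = σ' c ⊗ₜ g m := rfl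

variable {p : ℕ} [Fact p.Prime] {f : ℕ}
  {R : Type*} [CommRing R] [Algebra (WittFq p f) R]
  {M : ZMod f → Type*} [∀ j, AddCommGroup (M j)] [∀ j, Module R⟦X⟧ (M j)]

theorem frob_rescale {S : Type*} [CommRing S] {c c' : S} (y : S⟦X⟧) (h : c = c' ^ p) :
    frob p S (PowerSeries.rescale c y) = PowerSeries.rescale c' (frob p S y) := by
  ext n
  change coeff n (PowerSeries.expand p _ _) = _
  rw [PowerSeries.coeff_rescale]
  change _ = _ * coeff n (PowerSeries.expand p _ _)
  rw [PowerSeries.coeff_expand, PowerSeries.coeff_expand]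
  split_ifs with hn
  · obtain ⟨m, rfl⟩ := hn
    rw [Nat.mul_div_cancel_left m (Fact.out : p.Prime).pos, PowerSeries.coeff_rescale, h, pow_mul]
  · simp

theorem algebraMap_omega (R' : Type*) [CommRing R'] [Algebra (WittFq p f) R'] [Algebra R R']
    [IsScalarTower (WittFq p f) R R'] (j : ZMod f) (g : (GaloisField p f)ˣ) :
    algebraMap R R' (omega p f R j g : R) = (omega p f R' j g : R') :=
  (IsScalarTower.algebraMap_apply (WittFq p f) R R' _).symm

/-- The base change `𝔐 ⊗_R R'` of a Kisin module; its components are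
`R'⟦u⟧ ⊗_{R⟦u⟧} 𝔐^{(j)}`. -/
def KisinModule.baseChange [NeZero f] (𝔐 : KisinModule p f R M) (R' : Type*) [CommRing R']
    [Algebra (WittFq p f) R'] [Algebra R R'] [IsScalarTower (WittFq p f) R R'] :
    KisinModule p f R' (fun j => R'⟦X⟧ ⊗[R⟦X⟧] M j) where
  finite j := by
    have := 𝔐.finite j
    infer_instance
  projective j := by
    have := 𝔐.projective j
    infer_instance
  phi j := semilinearBaseChange (frob p R) (frob p R')
    (fun x => by
      change PowerSeries.expand _ _ (PowerSeries.map (algebraMap R R') x) =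
        PowerSeries.map (algebraMap R R') (PowerSeries.expand _ _ x)
      rw [PowerSeries.map_expand]) (𝔐.phi j)
  act j g := semilinearBaseChange (PowerSeries.rescale (omega p f R j g : R))
    (PowerSeries.rescale (omega p f R' j g : R'))
    (fun x => by
      change PowerSeries.rescale _ (PowerSeries.map (algebraMap R R') x) =
        PowerSeries.map (algebraMap R R') (PowerSeries.rescale _ x)
      ext n
      simp [PowerSeries.coeff_rescale, algebraMap_omega]) (𝔐.act j g)
  act_one j x := by
    induction x using TensorProduct.induction_on with
    | zero => simp
    | tmul y m =>
      rw [semilinearBaseChange_tmul, 𝔐.act_one]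
      simp
    | add x y hx hy => rw [map_add, hx, hy]
  act_mul j g h x := by
    induction x using TensorProduct.induction_on with
    | zero => simp
    | tmul y m =>
      simp only [semilinearBaseChange_tmul, 𝔐.act_mul]
      simp [PowerSeries.rescale_rescale, mul_comm]
    | add x y hx hy => simp only [map_add, hx, hy]
  phi_act j g x := by
    induction x using TensorProduct.induction_on with
    | zero => simp
    | tmul y m =>
      simp only [semilinearBaseChange_tmul, 𝔐.phi_act]
      rw [frob_rescale (c' := (omega p f R' (j + 1) g : R')) _ (by
        rw [← omega_succ_pow p R' j g, Units.val_pow_eq_pow_val])]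
    | add x y hx hy => simp only [map_add, hx, hy]

/-- The eigenbasis `β` of `𝔐` lifts the eigenbasis `β'` of `𝔐 ⊗_R R'`. -/
def Eigenbasis.Lifts [NeZero f] {𝔐 : KisinModule p f R M} {a : Exponents f} (β : Eigenbasis 𝔐 a)
    {R' : Type*} [CommRing R'] [Algebra (WittFq p f) R'] [Algebra R R']
    [IsScalarTower (WittFq p f) R R'] (β' : Eigenbasis (𝔐.baseChange R') a) : Prop :=
  ∀ j κ, (1 : R'⟦X⟧) ⊗ₜ[R⟦X⟧] β.basis j κ = β'.basis j κ

end BaseChange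

/-! ## The matrices -/

section Matrices

/-- The Teichmüller lift `[x]` of an element `x` of the finite residue field of a complete local
ring `R`: the unique lift of `x` to `R` which satisfies `[x]^Q = [x]`, where `Q` is the order of the
residue field. -/
def teich {R : Type*} [CommRing R] [IsLocalRing R] (x : ResidueField R) : R :=
  Classical.epsilon fun y : R => residue R y = x ∧ y ^ Nat.card (ResidueField R) = y

/-- Over a complete local ring with finite residue field, `teich x` is a lift of `x` with the defining
property, and the only one. -/
theorem teich_spec {R : Type*} [CommRing R] [IsLocalRing R] [IsAdicComplete (maximalIdeal R) R]
    [Finite (ResidueField R)] (x : ResidueField R) :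
    (residue R (teich x) = x ∧ teich x ^ Nat.card (ResidueField R) = teich x) ∧
    ∀ y : R, residue R y = x → y ^ Nat.card (ResidueField R) = y → y = teich x := by
  have := Fintype.ofFinite (ResidueField R)
  set Q := Nat.card (ResidueField R) with hQ
  have hQF : Q = Fintype.card (ResidueField R) := Nat.card_eq_fintype_card
  have hQ1 : 1 < Q := by rw [hQF]; exact Fintype.one_lt_card
  have hpow : ∀ z : ResidueField R, z ^ Q = z := fun z => by rw [hQF]; exact FiniteField.pow_card z
  have hQ0 : ((Q : ℕ) : ResidueField R) = 0 := by rw [hQF]; exact Nat.cast_card_eq_zero _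
  have hex : ∃ y : R, residue R y = x ∧ y ^ Q = y := by
    obtain ⟨x₀, rfl⟩ := residue_surjective x
    obtain ⟨y, hy, hyx⟩ := HenselianRing.is_henselian (R := R) (I := maximalIdeal R)
      (Polynomial.X ^ Q - Polynomial.X) (Polynomial.monic_X_pow_sub (by simpa using hQ1)) x₀
      (by
        rw [← residue_eq_zero_iff]
        simp [hpow])
      (by
        change IsUnit (residue R _)
        have h1 : Q - 1 ≠ 0 := by omega
        simp [Polynomial.derivative_X_pow, hQ0])
    refine ⟨y, ?_, ?_⟩
    · rw [← sub_eq_zero, ← map_sub, residue_eq_zero_iff]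
      exact hyx
    · simpa [Polynomial.IsRoot, sub_eq_zero] using hy
  have hs : residue R (teich x) = x ∧ teich x ^ Q = teich x := Classical.epsilon_spec hex
  refine ⟨hs, fun y hy hyQ => ?_⟩
  have hfac := (Commute.all y (teich x)).mul_geom_sum₂ Q
  have hu : IsUnit (∑ i ∈ Finset.range Q, y ^ i * teich x ^ (Q - 1 - i) - 1) := by
    rw [← residue_ne_zero_iff_isUnit]
    have : ∀ i ∈ Finset.range Q, x ^ i * x ^ (Q - 1 - i) = x ^ (Q - 1) := fun i hi => by
      rw [← pow_add]; congr 1; have := Finset.mem_range.mp hi; omega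
    simp only [map_sub, map_sum, map_mul, map_pow, hy, hs.1, map_one]
    rw [Finset.sum_congr rfl this]
    simp [hQ0]
  rw [hyQ, hs.2] at hfac
  have h0 : (y - teich x) * (∑ i ∈ Finset.range Q, y ^ i * teich x ^ (Q - 1 - i) - 1) = 0 := by
    rw [mul_sub, hfac]; ring
  exact sub_eq_zero.mp ((hu.mul_left_eq_zero).mp h0)

/-- The three shapes of mod `𝔪` Frobenius matrices. -/
inductive Shape
  | one
  | two
  | three

/-- The matrices `Ā_1`, `Ā_2`, `Ā_3` in the variable `v`. -/
def Shape.residual {F : Type*} [CommRing F] (σ : Shape) (a : F) : Matrix (Fin 2) (Fin 2) F⟦X⟧ :=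
  match σ with
  | .one => !![X, 0; C a * X, 1]
  | .two => !![0, 1; X, 0]
  | .three => !![0, 1; X, C a]

/-- The matrices `A_1`, `A_2`, `A_3` in the variable `v`, where `b` stands for `[a]`. -/
def Shape.lifted (p : ℕ) {R : Type*} [CommRing R] (σ : Shape) (b x y : R) :
    Matrix (Fin 2) (Fin 2) R⟦X⟧ :=
  match σ with
  | .one => !![X + C (p : R), 0; C (x + b) * X, 1]
  | .two => !![C (-y), 1; X, C x]
  | .three => !![C (-(p : R) * Ring.inverse (x + b)), 1; X, C (x + b)]

/-- The matrix `A` for `i ≠ 0` and `A · diag(d, d')` for `i = 0`. -/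
def twist {S : Type*} [CommRing S] {f : ℕ} (i : ZMod f) (A : Matrix (Fin 2) (Fin 2) S⟦X⟧)
    (d d' : S) : Matrix (Fin 2) (Fin 2) S⟦X⟧ :=
  if i = 0 then A * !![C d, 0; 0, C d'] else A

variable {p : ℕ} [Fact p.Prime] {f : ℕ} [NeZero f]
  {R : Type*} [CommRing R] [IsLocalRing R] [Algebra (WittFq p f) R]
  {M : ZMod f → Type*} [∀ j, AddCommGroup (M j)] [∀ j, Module R⟦X⟧ (M j)]

/-- The matrices of `β` are `A_1`, `A_2`, `A_3`, according to the shape `σ i`, for some parameters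
`X_i`, `Y_i`, `X_α`, `X_{α'}` in the maximal ideal. -/
def Eigenbasis.HasNormalForm {𝔐 : KisinModule p f R M} {a : Exponents f}
    (β : Eigenbasis 𝔐 a) (s : ZMod f → Equiv.Perm (Fin 2)) (σ : ZMod f → Shape)
    (c : ZMod f → ResidueField R) (α α' : ResidueField R) : Prop :=
  ∃ (x y : ZMod f → R) (xα xα' : R),
    (∀ i, x i ∈ maximalIdeal R) ∧ (∀ i, y i ∈ maximalIdeal R) ∧
    xα ∈ maximalIdeal R ∧ xα' ∈ maximalIdeal R ∧
    (∀ i, σ i = Shape.two → x i * y i = (p : R)) ∧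
    ∀ i, β.HasMatrix s i
      (twist i ((σ i).lifted p (teich (c i)) (x i) (y i)) (teich α + xα) (teich α' + xα'))

end Matrices

end KisinGL2
end

/-! ## A filtration on power series rings -/

namespace PowerSeries

/-! Written in `v`, two eigenbases of `𝔐^{(j)}` differ by a matrix over `R⟦v⟧` that is upper
triangular modulo `v`, namely `iwahori K`. By `Eigenbasis.hasMatrix_iff` the Frobenius matrices then
change from `B` to `N` according to `iwahori (K (i + 1)) * N i = B i * Φ_i (K i)`. Here `Φ_i`
(`twistedFrob`) substitutes `v ↦ v^p`, permutes the entries by `s_i⁻¹ s_{i+1}` and, by genericity,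
multiplies off-diagonal entries by at least `v²`. The theorem becomes a statement about normal forms
for this twisted conjugacy.

For a single matrix: if `B` has reduction `Ā_j` up to a diagonal factor and `det B` is a unit times
`v + p`, then `B = iwahori K * N` with `N` of the form `A_j` up to a diagonal factor
(`exists_iwahori_mul_eq`). The values of `B` at `v = -p` dictate the parameters of `N`, and `det
B(-p) = 0` makes the needed divisions by `v + p` possible. The diagonal constant terms of `K` can be
made `1`.

Since `Φ_i` involves the unknown `K i`, this factorization is iterated. In the filtration by powers
of `(𝔪, v)`, `Φ_i` gains two steps on differences and dividing by `N` loses only one, so the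
iteration contracts (`IsNormal.sub_mem_filt`, `IsNormal.iwahori_sub_mem_filt`). Completeness yields
a fixed point (`exists_isNormal_twisted_conj`); the same estimate, applied to a solution and the
identity, yields uniqueness up to diagonal matrices (`eq_diagonal_of_twisted_conj`). Diagonal
changes of basis finally push all diagonal factors around `ℤ/f` to the index `0`, where they form
`D(α, α')` (`exists_normalForm_twisted_conj`).

Two inputs start the argument: eigenbases lift because `|Δ| = q - 1` is invertible in `R`
(`exists_eigenbasis_lift`), and the condition on `det 𝔐` makes `det B` divide `v + p`
(`Eigenbasis.HasMatrix.det_dvd`). -/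

theorem constantCoeff_map {R S : Type*} [CommRing R] [CommRing S] (g : R →+* S) (h : R⟦X⟧) :
    constantCoeff (map g h) = g (constantCoeff h) := by
  rw [← coeff_zero_eq_constantCoeff_apply, coeff_map, coeff_zero_eq_constantCoeff_apply]

section Filtration

variable {R : Type*} [CommRing R] (I : Ideal R)

/-- The ideal of the power series whose `k`-th coefficient lies in `I ^ (n - k)`, that is, the
`n`-th power of `I + (X)` if `I` is finitely generated. -/
def filt (n : ℕ) : Ideal R⟦X⟧ where
  carrier := {g | ∀ k, coeff k g ∈ I ^ (n - k)}
  zero_mem' k := by simp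
  add_mem' hg hh k := by
    rw [map_add]
    exact add_mem (hg k) (hh k)
  smul_mem' c g hg k := by
    rw [smul_eq_mul, coeff_mul]
    refine sum_mem fun x hx => ?_
    have := Finset.HasAntidiagonal.mem_antidiagonal.mp hx
    exact Ideal.mul_mem_left _ _ (Ideal.pow_le_pow_right (by omega) (hg x.2))

variable {I}

theorem mem_filt_zero (g : R⟦X⟧) : g ∈ filt I 0 := fun k => by simp

theorem filt_anti {m n : ℕ} (h : m ≤ n) : filt I n ≤ filt I m :=
  fun _ hg k => Ideal.pow_le_pow_right (by omega) (hg k)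

theorem mul_mem_filt {m n : ℕ} {g h : R⟦X⟧} (hg : g ∈ filt I m) (hh : h ∈ filt I n) :
    g * h ∈ filt I (m + n) := by
  intro k
  rw [coeff_mul]
  refine sum_mem fun x hx => ?_
  have := Finset.HasAntidiagonal.mem_antidiagonal.mp hx
  refine Ideal.pow_le_pow_right (n := (m - x.1) + (n - x.2)) (by omega) ?_
  rw [pow_add]
  exact Ideal.mul_mem_mul (hg x.1) (hh x.2)

theorem X_mem_filt : (X : R⟦X⟧) ∈ filt I 1 := by
  intro k
  rw [coeff_X]
  split_ifs with h
  · simp [h]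
  · simp

theorem C_mem_filt {n : ℕ} {r : R} (hr : r ∈ I ^ n) : C r ∈ filt I n := by
  intro k
  rw [coeff_C]
  split_ifs with h
  · simpa [h] using hr
  · simp

theorem constantCoeff_mem_of_mem_filt {n : ℕ} {g : R⟦X⟧} (hg : g ∈ filt I n) :
    constantCoeff g ∈ I ^ n := by
  simpa using hg 0

theorem expand_mem_filt {n q : ℕ} (hq : q ≠ 0) {g : R⟦X⟧} (hg : g ∈ filt I n) :
    expand q hq g ∈ filt I n := by
  intro k
  rw [coeff_expand]
  split_ifs with h
  · obtain ⟨m, rfl⟩ := h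
    rw [Nat.mul_div_cancel_left _ (Nat.pos_of_ne_zero hq)]
    exact Ideal.pow_le_pow_right (Nat.sub_le_sub_left (Nat.le_mul_of_pos_left _ (by omega)) _) (hg m)
  · simp

/-- If `g` has no constant term, then `g(X^q)` is more divisible by `X` than `g`. -/
theorem exists_expand_eq_X_sq_mul {n q : ℕ} (hq : q ≠ 0) (hq3 : 3 ≤ q) {g : R⟦X⟧}
    (hg : g ∈ filt I n) (h0 : constantCoeff g = 0) :
    ∃ h ∈ filt I n, expand q hq g = X ^ 2 * h := by
  refine ⟨mk fun k => coeff (k + 2) (expand q hq g), fun k => ?_, ?_⟩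
  · rw [coeff_mk, coeff_expand]
    split_ifs with h
    · obtain ⟨m, hm⟩ := h
      rw [hm, Nat.mul_div_cancel_left _ (Nat.pos_of_ne_zero hq)]
      -- Here `k + 2 = q m` with `m ≥ 1`, so `q ≥ 3` gives `m ≤ k`: the required power of `I` is at
      -- most the known one.
      have : 3 * m ≤ q * m := Nat.mul_le_mul_right _ hq3
      refine Ideal.pow_le_pow_right ?_ (hg m)
      have : m ≠ 0 := by rintro rfl; omega
      omega
    · simp
  · ext k
    rw [coeff_X_pow_mul']
    split_ifs with h
    · rw [coeff_mk, Nat.sub_add_cancel h]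
    · rw [coeff_expand]
      split_ifs with h'
      · obtain ⟨m, rfl⟩ := h'
        have hm : m = 0 := by
          by_contra hm
          have : q * 1 ≤ q * m := Nat.mul_le_mul_left _ (by omega)
          omega
        simpa [hm] using h0
      · rfl

theorem mem_filt_of_X_mul_mem {n : ℕ} {g : R⟦X⟧} (hg : X * g ∈ filt I (n + 1)) :
    g ∈ filt I n := by
  intro k
  have := hg (k + 1)
  rwa [coeff_succ_X_mul, Nat.add_sub_add_right] at this

/-- In degree `k + 1` the hypothesis says `h_k ≡ -w h_{k+1}` modulo `I ^ (n - k)`, and `r` plays no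
role. As `w ∈ I`, each use of this relation gains a power of `I`; `N` below counts the uses. -/
theorem mem_filt_of_X_add_C_mul_sub_mem {n : ℕ} {w r : R} (hw : w ∈ I) {h : R⟦X⟧}
    (hh : (X + C w) * h - C r ∈ filt I (n + 1)) : h ∈ filt I n := by
  have key : ∀ N k, coeff k h ∈ I ^ min N (n - k) := by
    intro N
    induction N with
    | zero => simp
    | succ N ih =>
      intro k
      have h1 := hh (k + 1)
      rw [map_sub, add_mul, map_add, coeff_succ_X_mul, coeff_C_mul, coeff_C, if_neg (by omega),
        sub_zero, Nat.add_sub_add_right] at h1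
      have h2 : w * coeff (k + 1) h ∈ I ^ (1 + min N (n - (k + 1))) := by
        rw [pow_add, pow_one]
        exact Ideal.mul_mem_mul hw (ih (k + 1))
      have h3 := sub_mem (Ideal.pow_le_pow_right (m := min (N + 1) (n - k)) (by omega) h1)
        (Ideal.pow_le_pow_right (m := min (N + 1) (n - k)) (by omega) h2)
      simpa using h3
  intro k
  simpa using key n k

/-! ### Separatedness and completeness for the filtration. -/

section Complete

theorem eq_zero_of_mem_pow [IsHausdorff I R] {r : R} (h : ∀ n, r ∈ I ^ n) : r = 0 :=
  IsHausdorff.haus ‹_› r fun n => by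
    rw [SModEq.zero]
    simpa using h n

theorem eq_zero_of_mem_filt [IsHausdorff I R] {g : R⟦X⟧} (h : ∀ n, g ∈ filt I n) : g = 0 := by
  ext k
  exact eq_zero_of_mem_pow (I := I) fun n => by simpa using h (n + k) k

theorem exists_sub_mem_filt [IsPrecomplete I R] {g : ℕ → R⟦X⟧}
    (hg : ∀ n, g (n + 1) - g n ∈ filt I n) : ∃ l, ∀ n, l - g n ∈ filt I n := by
  have hg' : ∀ m n, m ≤ n → g n - g m ∈ filt I m := by
    intro m n h
    induction n, h using Nat.le_induction with
    | base => simp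
    | succ n hmn ih =>
      have := add_mem (filt_anti hmn (hg n)) ih
      simpa using this
  -- Membership in `filt I n` controls the coefficient of degree `k` only modulo `I ^ (n - k)`,
  -- hence the shift of the sequence by `k`.
  have hex : ∀ k, ∃ l : R, ∀ n, l - coeff k (g (n + k)) ∈ I ^ n := by
    intro k
    obtain ⟨l, hl⟩ := IsPrecomplete.prec' (I := I) (fun n => coeff k (g (n + k))) (by
      intro m n hmn
      rw [SModEq.sub_mem, smul_eq_mul, Ideal.mul_top, ← neg_mem_iff, neg_sub]
      simpa using hg' (m + k) (n + k) (by omega) k)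
    refine ⟨l, fun n => ?_⟩
    have := hl n
    rwa [SModEq.sub_mem, smul_eq_mul, Ideal.mul_top, ← neg_mem_iff, neg_sub] at this
  choose l hl using hex
  refine ⟨mk l, fun n k => ?_⟩
  rw [map_sub, coeff_mk]
  by_cases hk : k ≤ n
  · simpa [Nat.sub_add_cancel hk] using hl k (n - k)
  · simp [Nat.sub_eq_zero_of_le (Nat.le_of_not_le hk)]

theorem X_add_C_mul_right_cancel [IsHausdorff I R] {w : R} (hw : w ∈ I) {g h : R⟦X⟧}
    (e : (X + C w) * g = (X + C w) * h) : g = h := by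
  rw [← sub_eq_zero]
  refine eq_zero_of_mem_filt (I := I) fun n =>
    mem_filt_of_X_add_C_mul_sub_mem (n := n) (r := 0) hw ?_
  rw [mul_sub, e]
  simp

end Complete

end Filtration

/-! ### Weierstrass division by `X + w` and evaluation at `-w`. -/

section Local

variable {R : Type*} [CommRing R] [IsLocalRing R]

/-- Modulo the maximal ideal the divisor becomes `X`, of order `1`, so the Weierstrass remainder is
a constant. -/
theorem exists_X_add_C_dvd_sub [IsAdicComplete (maximalIdeal R) R] {w : R}
    (hw : w ∈ maximalIdeal R) (g : R⟦X⟧) : ∃ r : R, X + C w ∣ g - C r := by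
  have hmap : (X + C w : R⟦X⟧).map (residue R) = X := by
    simp [(residue_eq_zero_iff w).mpr hw]
  obtain ⟨q, r, h⟩ := exists_isWeierstrassDivision (f := g) (g := X + C w) (by
    rw [hmap]; exact X_ne_zero)
  refine ⟨r.coeff 0, q, ?_⟩
  have hr := h.degree_lt
  change r.degree < ((X + C w : R⟦X⟧).map (residue R)).order.toNat at hr
  rw [hmap, order_X] at hr
  have hr0 : r = Polynomial.C (r.coeff 0) := by
    ext n
    cases n with
    | zero => simp
    | succ n =>
      rw [Polynomial.coeff_C_succ]
      exact Polynomial.coeff_eq_zero_of_degree_lt (hr.trans_le (by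
        rw [ENat.toNat_one]
        exact_mod_cast Nat.succ_le_succ n.zero_le))
  have he := h.eq_mul_add
  rw [hr0] at he
  simpa [sub_eq_iff_eq_add] using he

/-- Evaluation of power series at an element `-w` of the maximal ideal. -/
theorem exists_eval_hom [IsAdicComplete (maximalIdeal R) R] {w : R} (hw : w ∈ maximalIdeal R) :
    ∃ ev : R⟦X⟧ →+* R, (∀ r, ev (C r) = r) ∧ ev X = -w ∧ ∀ g, ev g = 0 → X + C w ∣ g := by
  let J : Ideal R⟦X⟧ := Ideal.span {X + C w}
  -- The evaluation is the inverse of `ι`. Separatedness of the filtration makes `ι` injective,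
  -- Weierstrass division makes it surjective.
  let ι : R →+* R⟦X⟧ ⧸ J := (Ideal.Quotient.mk J).comp C
  have hι : Function.Bijective ι := by
    constructor
    · rw [injective_iff_map_eq_zero]
      intro r hr
      obtain ⟨h, hh⟩ := Ideal.mem_span_singleton.mp (Ideal.Quotient.eq_zero_iff_mem.mp hr)
      have : h = 0 := eq_zero_of_mem_filt (I := maximalIdeal R) fun n =>
        mem_filt_of_X_add_C_mul_sub_mem (r := r) hw (by rw [← hh]; simp)
      rw [this, mul_zero] at hh
      simpa using congrArg constantCoeff hh
    · intro y
      obtain ⟨g, rfl⟩ := Ideal.Quotient.mk_surjective y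
      obtain ⟨r, hr⟩ := exists_X_add_C_dvd_sub hw g
      exact ⟨r, ((Ideal.Quotient.mk_eq_mk_iff_sub_mem _ _).mpr
        (Ideal.mem_span_singleton.mpr hr)).symm⟩
  let e := RingEquiv.ofBijective ι hι
  refine ⟨(e.symm : _ →+* R).comp (Ideal.Quotient.mk J), fun r => ?_, ?_, fun g hg => ?_⟩
  · exact e.symm_apply_apply r
  · change e.symm (Ideal.Quotient.mk J X) = -w
    rw [RingEquiv.symm_apply_eq]
    refine (Ideal.Quotient.mk_eq_mk_iff_sub_mem _ _).mpr (Ideal.mem_span_singleton.mpr ?_)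
    simp
  · have : Ideal.Quotient.mk J g = 0 := e.symm.injective (by rw [map_zero]; exact hg)
    exact Ideal.mem_span_singleton.mp (Ideal.Quotient.eq_zero_iff_mem.mp this)

end Local

end PowerSeries

noncomputable section

/-! ## Matrices in normal form up to diagonal matrices -/

namespace KisinGL2

section Normal

variable {R : Type*} [CommRing R]

/-- The matrix `!![K₀₀, K₀₁; X K₁₀, K₁₁]`, which is upper triangular modulo `X`. -/
def iwahori (K : Matrix (Fin 2) (Fin 2) R⟦X⟧) : Matrix (Fin 2) (Fin 2) R⟦X⟧ :=
  !![K 0 0, K 0 1; X * K 1 0, K 1 1]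

/-- The linear space spanned by the differences of matrices of a given shape. -/
def IsTangent (w : R) (σ : Shape) (N : Matrix (Fin 2) (Fin 2) R⟦X⟧) : Prop :=
  match σ with
  | .one => ∃ d d' x, N = !![C d * (X + C w), 0; C x * X, C d']
  | .two | .three => ∃ d d' x y, N = !![C y, C d'; C d * X, C x]

/-- The matrices `A · diag(d, d')` where `A` is of the form `A_1`, or one of `A_2`, `A_3`. -/
def IsNormal (w : R) (σ : Shape) (N : Matrix (Fin 2) (Fin 2) R⟦X⟧) : Prop :=
  match σ with
  | .one => ∃ d d' x, IsUnit d ∧ IsUnit d' ∧ N = !![C d * (X + C w), 0; C x * X, C d']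
  | .two | .three => ∃ d d' x y, IsUnit d ∧ IsUnit d' ∧ x * y = -(w * (d * d')) ∧
      N = !![C y, C d'; C d * X, C x]

variable {w : R} {σ : Shape} {N N' : Matrix (Fin 2) (Fin 2) R⟦X⟧}

theorem IsNormal.isTangent (h : IsNormal w σ N) : IsTangent w σ N := by
  cases σ
  · obtain ⟨d, d', x, -, -, h⟩ := h
    exact ⟨d, d', x, h⟩
  all_goals
    obtain ⟨d, d', x, y, -, -, -, h⟩ := h
    exact ⟨d, d', x, y, h⟩

theorem IsTangent.sub (h : IsTangent w σ N) (h' : IsTangent w σ N') :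
    IsTangent w σ (N - N') := by
  cases σ
  · obtain ⟨d, d', x, rfl⟩ := h
    obtain ⟨e, e', z, rfl⟩ := h'
    refine ⟨d - e, d' - e', x - z, ?_⟩
    ext i j
    fin_cases i <;> fin_cases j <;> simp [sub_mul]
  all_goals
    obtain ⟨d, d', x, y, rfl⟩ := h
    obtain ⟨e, e', z, t, rfl⟩ := h'
    refine ⟨d - e, d' - e', x - z, y - t, ?_⟩
    ext i j
    fin_cases i <;> fin_cases j <;> simp [sub_mul]

theorem IsNormal.exists_det (h : IsNormal w σ N) :
    ∃ e, IsUnit e ∧ N.det = C e * (X + C w) := by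
  cases σ
  · obtain ⟨d, d', x, hd, hd', rfl⟩ := h
    refine ⟨d * d', hd.mul hd', ?_⟩
    rw [Matrix.det_fin_two_of, map_mul]
    ring
  all_goals
    obtain ⟨d, d', x, y, hd, hd', hxy, rfl⟩ := h
    refine ⟨-(d * d'), (hd.mul hd').neg, ?_⟩
    rw [Matrix.det_fin_two_of]
    have := congrArg (C (R := R)) hxy
    simp only [map_mul, map_neg] at this ⊢
    linear_combination this

theorem IsNormal.diagonal_mul_mul_diagonal (h : IsNormal w σ N) {t t' : Fin 2 → R}
    (ht : ∀ l, IsUnit (t l)) (ht' : ∀ l, IsUnit (t' l)) :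
    IsNormal w σ (Matrix.diagonal (fun l => C (t l)) * N * Matrix.diagonal fun l => C (t' l)) := by
  cases σ
  · obtain ⟨d, d', x, hd, hd', rfl⟩ := h
    refine ⟨t 0 * d * t' 0, t 1 * d' * t' 1, t 1 * x * t' 0, ((ht 0).mul hd).mul (ht' 0),
      ((ht 1).mul hd').mul (ht' 1), ?_⟩
    refine Matrix.ext fun i j => ?_
    rw [Matrix.mul_diagonal, Matrix.diagonal_mul]
    fin_cases i <;> fin_cases j <;> simp <;> ring
  all_goals
    obtain ⟨d, d', x, y, hd, hd', hxy, rfl⟩ := h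
    refine ⟨t 1 * d * t' 0, t 0 * d' * t' 1, t 1 * x * t' 1, t 0 * y * t' 0,
      ((ht 1).mul hd).mul (ht' 0), ((ht 0).mul hd').mul (ht' 1), ?_, ?_⟩
    · linear_combination (t 0 * t 1 * t' 0 * t' 1) * hxy
    · refine Matrix.ext fun i j => ?_
      rw [Matrix.mul_diagonal, Matrix.diagonal_mul]
      fin_cases i <;> fin_cases j <;> simp <;> ring

variable {I₁ I₂ : Ideal R⟦X⟧}

/-- Constant terms separate the two unknowns: that of `k` is known to be in `I₁`, hence so is `δ`,
and then the unit `d` can be cancelled. -/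
theorem C_mem_and_mem_of_C_mul_sub_mem (hC : ∀ g ∈ I₁, C (constantCoeff g) ∈ I₁) {d δ : R}
    {k : R⟦X⟧} (hd : IsUnit d) (hk : C (constantCoeff k) ∈ I₁) (h : C d * k - C δ ∈ I₁) :
    C δ ∈ I₁ ∧ k ∈ I₁ := by
  have h1 := hC _ h
  have h2 : C δ ∈ I₁ := by
    have := sub_mem (I₁.mul_mem_left (C d) hk) h1
    simpa using this
  refine ⟨h2, ?_⟩
  rw [← I₁.unit_mul_mem_iff_mem (hd.map (C (R := R)))]
  simpa using add_mem h h2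

/-- The linearized uniqueness of the normal form. -/
theorem IsNormal.mem_of_mul_sub_mem (hN : IsNormal w σ N) (hle : I₂ ≤ I₁)
    (hX : ∀ g ∈ I₁, X * g ∈ I₂) (hdiv : ∀ h r, (X + C w) * h - C r ∈ I₂ → h ∈ I₁)
    (hC : ∀ g ∈ I₁, C (constantCoeff g) ∈ I₁)
    {K Δ : Matrix (Fin 2) (Fin 2) R⟦X⟧} (hΔ : IsTangent w σ Δ)
    (h00 : C (constantCoeff (K 0 0)) ∈ I₁) (h10 : C (constantCoeff (K 1 0)) ∈ I₁)
    (h11 : C (constantCoeff (K 1 1)) ∈ I₁) (h : ∀ m l, (K * N - Δ) m l ∈ I₂) :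
    ∀ m l, K m l ∈ I₁ := by
  have aux : ∀ {d : R} {k : R⟦X⟧} {J : Ideal R⟦X⟧}, IsUnit d → C d * k ∈ J → k ∈ J :=
    fun hd hk => (Ideal.unit_mul_mem_iff_mem _ (hd.map (C (R := R)))).mp hk
  have e00 := h 0 0
  have e01 := h 0 1
  have e10 := h 1 0
  have e11 := h 1 1
  suffices K 0 0 ∈ I₁ ∧ K 0 1 ∈ I₁ ∧ K 1 0 ∈ I₁ ∧ K 1 1 ∈ I₁ by
    intro m l
    fin_cases m <;> fin_cases l
    exacts [this.1, this.2.1, this.2.2.1, this.2.2.2]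
  cases σ
  · obtain ⟨d, d', x, hd, hd', rfl⟩ := hN
    obtain ⟨δ, δ', ξ, rfl⟩ := hΔ
    simp only [Matrix.sub_apply, Matrix.mul_apply, Fin.sum_univ_two, Matrix.of_apply,
      Matrix.cons_val', Matrix.cons_val_zero, Matrix.cons_val_one, Matrix.cons_val_fin_one,
      mul_zero, zero_add, sub_zero] at e00 e01 e10 e11
    -- The second column of `N` is `(0, d')` with `d'` a unit, so the second column of `K` needs no
    -- division by `X + w`; it is then eliminated from the first column of `K * N`.
    have k01 : K 0 1 ∈ I₂ := aux hd' (by rwa [mul_comm])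
    have k00 : K 0 0 ∈ I₁ := (C_mem_and_mem_of_C_mul_sub_mem (δ := δ) hC hd h00 (hdiv _ 0 (by
      convert sub_mem e00 (I₂.mul_mem_right (C x * X) k01) using 1
      rw [map_zero]
      ring))).2
    have k11 : K 1 1 ∈ I₁ := (C_mem_and_mem_of_C_mul_sub_mem (δ := δ') hC hd' h11 (by
      rw [mul_comm]; exact hle e11)).2
    refine ⟨k00, hle k01, ?_, k11⟩
    -- The constant comes from `ξ X = ξ (X + w) - ξ w`.
    refine (C_mem_and_mem_of_C_mul_sub_mem (δ := ξ) hC hd h10 (hdiv _ (-(ξ * w)) ?_)).2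
    convert sub_mem e10 (I₂.mul_mem_left (C x) (hX _ k11)) using 1
    rw [map_neg, map_mul]
    ring
  all_goals
    obtain ⟨d, d', x, y, hd, hd', hxy, rfl⟩ := hN
    obtain ⟨δ, δ', ξ, η, rfl⟩ := hΔ
    have hxy' := congrArg (C (R := R)) hxy
    simp only [map_mul, map_neg] at hxy'
    simp only [Matrix.sub_apply, Matrix.mul_apply, Fin.sum_univ_two, Matrix.of_apply,
      Matrix.cons_val', Matrix.cons_val_zero, Matrix.cons_val_one, Matrix.cons_val_fin_one]
      at e00 e01 e10 e11
    -- Since `x y = -w d d'`, the combination of `d'` times the first column of `N` minus `y` times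
    -- the second is `(0, d d' (X + w))`. It isolates `K 0 1` in the first row and `K 1 1` in the
    -- second; the first column of `K` follows from the unit entry `d'`.
    have k01 : K 0 1 ∈ I₁ := aux (hd.mul hd') (hdiv _ (d' * η - y * δ') (by
      convert sub_mem (I₂.mul_mem_left (C d') e00) (I₂.mul_mem_left (C y) e01) using 1
      simp only [map_mul, map_sub]
      linear_combination (K 0 1) * hxy'))
    have k00 : K 0 0 ∈ I₁ := (C_mem_and_mem_of_C_mul_sub_mem (δ := δ') hC hd' h00 (by
      convert sub_mem (hle e01) (I₁.mul_mem_right (C x) k01) using 1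
      ring)).2
    have k11 : K 1 1 ∈ I₁ := (C_mem_and_mem_of_C_mul_sub_mem (δ := δ * d') hC (hd.mul hd') h11
      (hdiv _ (-(y * ξ) - w * (δ * d')) (by
        convert sub_mem (I₂.mul_mem_left (C d') e10) (I₂.mul_mem_left (C y) e11) using 1
        simp only [map_mul, map_sub, map_neg]
        linear_combination (K 1 1) * hxy'))).2
    refine ⟨k00, k01, ?_, k11⟩
    refine (C_mem_and_mem_of_C_mul_sub_mem (δ := ξ) hC hd' h10 ?_).2
    convert sub_mem (hle e11) (I₁.mul_mem_right (C x) k11) using 1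
    ring

end Normal

end KisinGL2

end

noncomputable section

namespace KisinGL2

/-! ### The contraction estimate. -/

section Contraction

variable {R : Type*} [CommRing R] {I : Ideal R} {w : R} {σ : Shape}
  {N N' : Matrix (Fin 2) (Fin 2) R⟦X⟧}

theorem matrix_mul_mem_filt {a b : ℕ} {M M' : Matrix (Fin 2) (Fin 2) R⟦X⟧}
    (h : ∀ m l, M m l ∈ filt I a) (h' : ∀ m l, M' m l ∈ filt I b) (m l : Fin 2) :
    (M * M') m l ∈ filt I (a + b) := by
  rw [Matrix.mul_apply]
  exact sum_mem fun k _ => mul_mem_filt (h m k) (h' k l)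

/-- If `J N = A Φ` and `J' N' = A Φ'` with `N`, `N'` in normal form, then `J` and `J'` are closer to
each other than `Φ` and `Φ'`, as soon as the latter agree modulo `X²`. -/
theorem IsNormal.sub_mem_filt (hw : w ∈ I) (hN : IsNormal w σ N) (hN' : IsNormal w σ N')
    {J J' A Φ Φ' Q : Matrix (Fin 2) (Fin 2) R⟦X⟧}
    (h00 : constantCoeff (J 0 0) = 1) (h10 : constantCoeff (J 1 0) = 0)
    (h11 : constantCoeff (J 1 1) = 1)
    (h00' : constantCoeff (J' 0 0) = 1) (h10' : constantCoeff (J' 1 0) = 0)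
    (h11' : constantCoeff (J' 1 1) = 1)
    (h : J * N = A * Φ) (h' : J' * N' = A * Φ') (hΦ : IsUnit Φ.det)
    (hQ : Φ' - Φ = (X ^ 2 : R⟦X⟧) • Q) {n : ℕ} (hQn : ∀ m l, Q m l ∈ filt I n)
    (hNN : ∀ m l, (N - N') m l ∈ filt I 1) (m l : Fin 2) : (J' - J) m l ∈ filt I (n + 1) := by
  have hJ : IsUnit J.det := by
    rw [isUnit_iff_constantCoeff, Matrix.det_fin_two]
    simp [h00, h10, h11]
  obtain ⟨H, hH⟩ : ∃ H, J * H = J' := ⟨J⁻¹ * J', Matrix.mul_nonsing_inv_cancel_left _ _ hJ⟩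
  obtain ⟨P, hP⟩ : ∃ P, Φ * P = Q := ⟨Φ⁻¹ * Q, Matrix.mul_nonsing_inv_cancel_left _ _ hΦ⟩
  have hPn : ∀ m l, P m l ∈ filt I n := by
    have hPQ : P = Φ⁻¹ * Q := by rw [← hP, Matrix.nonsing_inv_mul_cancel_left _ _ hΦ]
    intro m l
    have := matrix_mul_mem_filt (a := 0) (M := Φ⁻¹) (fun _ _ => mem_filt_zero _) hQn m l
    rwa [← hPQ, zero_add] at this
  have hHN : H * N' = N + (X ^ 2 : R⟦X⟧) • (N * P) := by
    have : J * (H * N') = J * (N + (X ^ 2 : R⟦X⟧) • (N * P)) := by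
      rw [← Matrix.mul_assoc, hH, h', sub_eq_iff_eq_add'.mp hQ, ← hP, Matrix.mul_add,
        Matrix.mul_add, ← h, Matrix.mul_smul, Matrix.mul_smul, ← Matrix.mul_assoc A, ← h,
        Matrix.mul_assoc]
    rw [← Matrix.nonsing_inv_mul_cancel_left J (H * N') hJ, this,
      Matrix.nonsing_inv_mul_cancel_left _ _ hJ]
  obtain ⟨e, he, hdet⟩ := hN.exists_det
  obtain ⟨e', hee'⟩ := he.exists_left_inv
  -- This is `(X + w) N P N⁻¹`, written without denominators.
  set Z := C e' • (N * P * N.adjugate) with hZdef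
  have hZn : ∀ m l, Z m l ∈ filt I n := by
    intro m l
    have h1 := matrix_mul_mem_filt (a := 0) (M := N) (fun _ _ => mem_filt_zero _) hPn
    have h2 := matrix_mul_mem_filt (b := 0) (M' := N.adjugate) h1 (fun _ _ => mem_filt_zero _) m l
    rw [zero_add, add_zero] at h2
    exact Ideal.mul_mem_left _ _ h2
  have hZN : Z * N = (X + C w) • (N * P) := by
    rw [hZdef, Matrix.smul_mul, Matrix.mul_assoc (N * P), Matrix.adjugate_mul, hdet,
      Matrix.mul_smul, Matrix.mul_one, smul_smul, ← mul_assoc, ← map_mul, hee', map_one, one_mul]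
  have hcH : constantCoeff (H 0 0) = 1 ∧ constantCoeff (H 1 0) = 0 ∧
      constantCoeff (H 1 1) = 1 := by
    have e1 := congrArg constantCoeff (congrFun (congrFun hH 0) 0)
    have e2 := congrArg constantCoeff (congrFun (congrFun hH 1) 0)
    have e3 := congrArg constantCoeff (congrFun (congrFun hH 1) 1)
    simp only [Matrix.mul_apply, Fin.sum_univ_two, map_add, map_mul, h00, h10, h11, h00', h10',
      h11', zero_mul, zero_add, one_mul] at e1 e2 e3
    exact ⟨by simpa [e2] using e1, e2, e3⟩
  -- Because `X² = (X - w)(X + w) + w²`, the perturbation `X² N P` is `Y Z N + w² N P`. Subtracting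
  -- `Y Z` from `H - 1` leaves only the errors `w² N P` and `Y Z (N - N')`, both in `filt I (n +
  -- 2)`.
  set Y : R⟦X⟧ := X - C w with hY
  have hYn : Y ∈ filt I 1 := sub_mem X_mem_filt (C_mem_filt (by simpa using hw))
  set K := H - 1 - Y • Z with hK
  have hKn : ∀ m l, K m l ∈ filt I (n + 1) := by
    have hcZ : ∀ m l, C (w * constantCoeff (Z m l)) ∈ filt I (n + 1) := fun m l => by
      refine C_mem_filt ?_
      rw [pow_succ']
      exact Ideal.mul_mem_mul hw (constantCoeff_mem_of_mem_filt (hZn m l))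
    -- Division by `X + w` costs one step of the filtration: `n + 2` for the defect gives `n + 1`
    -- for `K`.
    refine hN'.mem_of_mul_sub_mem (I₂ := filt I (n + 2)) (Δ := N - N') (filt_anti (by omega))
      (fun g hg => ?_) (fun h r hh => mem_filt_of_X_add_C_mul_sub_mem hw hh)
      (fun g hg => C_mem_filt (constantCoeff_mem_of_mem_filt hg))
      (hN.isTangent.sub hN'.isTangent) ?_ ?_ ?_ ?_
    · have := mul_mem_filt (X_mem_filt (I := I)) hg
      rwa [add_comm 1] at this
    · simpa [hK, hY, hcH.1] using hcZ 0 0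
    · simpa [hK, hY, hcH.2.1] using hcZ 1 0
    · simpa [hK, hY, hcH.2.2] using hcZ 1 1
    · have hW : K * N' - (N - N') = C (w ^ 2) • (N * P) + Y • (Z * (N - N')) := by
        have : K * N' - (N - N') = H * N' - N - Y • (Z * N) + Y • (Z * (N - N')) := by
          rw [hK, Matrix.sub_mul, Matrix.sub_mul, Matrix.one_mul, Matrix.smul_mul, Matrix.mul_sub,
            smul_sub]
          abel
        rw [this, hHN, hZN, smul_smul, add_sub_cancel_left, ← sub_smul]
        congr 2
        rw [hY, map_pow]
        ring
      intro m l
      rw [hW]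
      refine add_mem ?_ ?_
      · have h1 := matrix_mul_mem_filt (a := 0) (M := N) (fun _ _ => mem_filt_zero _) hPn m l
        have := mul_mem_filt (C_mem_filt (Ideal.pow_mem_pow hw 2)) h1
        rw [Matrix.smul_apply, smul_eq_mul]
        rwa [zero_add, add_comm 2] at this
      · have := mul_mem_filt hYn (matrix_mul_mem_filt hZn hNN m l)
        rw [Matrix.smul_apply, smul_eq_mul]
        rwa [add_comm 1, add_assoc] at this
  have hfin : J' - J = J * (K + Y • Z) := by
    rw [hK, sub_add_cancel, Matrix.mul_sub, hH, Matrix.mul_one]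
  rw [hfin]
  have := matrix_mul_mem_filt (a := 0) (M := J) (M' := K + Y • Z) (b := n + 1)
    (fun _ _ => mem_filt_zero _) (fun m l => add_mem (hKn m l) (by
      have := mul_mem_filt hYn (hZn m l)
      rwa [add_comm 1] at this)) m l
  rwa [zero_add] at this

end Contraction

/-! ### Factorization of one matrix as Iwahori times normal form. -/

section Existence

theorem map_iwahori {R S : Type*} [CommRing R] [CommRing S] (g : R →+* S)
    (K : Matrix (Fin 2) (Fin 2) R⟦X⟧) :
    (iwahori K).map (PowerSeries.map g) = iwahori (K.map (PowerSeries.map g)) := by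
  refine Matrix.ext fun i j => ?_
  fin_cases i <;> fin_cases j <;> simp [iwahori]

theorem iwahori_one {R : Type*} [CommRing R] :
    iwahori (1 : Matrix (Fin 2) (Fin 2) R⟦X⟧) = 1 := by
  refine Matrix.ext fun i j => ?_
  fin_cases i <;> fin_cases j <;> simp [iwahori]

theorem iwahori_injective {R : Type*} [CommRing R] :
    Function.Injective (iwahori : Matrix (Fin 2) (Fin 2) R⟦X⟧ → _) := by
  intro K K' h
  refine Matrix.ext fun i j => ?_
  have := congrFun (congrFun h i) j
  fin_cases i <;> fin_cases j <;> simpa [iwahori, X_mul_inj] using this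

theorem iwahori_mul_diagonal {R : Type*} [CommRing R] (K : Matrix (Fin 2) (Fin 2) R⟦X⟧)
    (d : Fin 2 → R⟦X⟧) :
    iwahori (K * Matrix.diagonal d) = iwahori K * Matrix.diagonal d := by
  refine Matrix.ext fun i j => ?_
  rw [Matrix.mul_diagonal]
  fin_cases i <;> fin_cases j <;> simp [iwahori, mul_assoc]

variable {R : Type*} [CommRing R] [IsLocalRing R] [IsAdicComplete (maximalIdeal R) R]
  {w : R} {σ : Shape}
  {B : Matrix (Fin 2) (Fin 2) R⟦X⟧}

/-- Solving `iwahori K * N = B` for `K` requires divisions by `X + w`, and their exactness at `X =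
-w` fixes the parameters of `N`. For shape one the lower left parameter is `b(-w) / B₁₁(-w)`; for
the others the diagonal entries of `N` are `B₀₀(-w) / B₀₁(-w)` and `B₁₁(-w) / b(-w)`. The vanishing
of `det B` at `-w` supplies the remaining divisibility for shape one, and the relation `x y = -w`
for the others. -/
theorem exists_iwahori_mul_eq_of_isUnit (hw : w ∈ maximalIdeal R) {b : R⟦X⟧} (hb : B 1 0 = X * b)
    (hdet : X + C w ∣ B.det)
    (hu : match σ with
      | .one => IsUnit (B 1 1)
      | .two | .three => IsUnit (B 0 1) ∧ IsUnit b) :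
    ∃ K N, IsNormal w σ N ∧ iwahori K * N = B := by
  obtain ⟨ev, hC, hX, hdvd⟩ := exists_eval_hom hw
  have hev : ev (B 0 0) * ev (B 1 1) + w * ev (B 0 1) * ev b = 0 := by
    obtain ⟨g, hg⟩ := hdet
    have := congrArg ev hg
    rw [Matrix.det_fin_two, hb] at this
    simp only [map_sub, map_mul, map_add, hX, hC] at this
    linear_combination this
  have hone : C (1 : R) = (1 : R⟦X⟧) := map_one _
  cases σ
  · obtain ⟨z, hz⟩ := (hu.map ev).exists_left_inv
    obtain ⟨g, hg⟩ := hdvd (B 0 0 - B 0 1 * (C (ev b * z) * X)) (by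
      simp only [map_sub, map_mul, hX, hC]
      linear_combination z * hev - ev (B 0 0) * hz)
    obtain ⟨h, hh⟩ := hdvd (b - B 1 1 * C (ev b * z)) (by
      simp only [map_sub, map_mul, hC]
      linear_combination - ev b * hz)
    refine ⟨!![g, B 0 1; h, B 1 1], _, ⟨1, 1, ev b * z, isUnit_one, isUnit_one, rfl⟩, ?_⟩
    refine Matrix.ext fun i j => ?_
    fin_cases i <;> fin_cases j <;>
      simp only [iwahori, Matrix.mul_apply, Fin.sum_univ_two, Matrix.of_apply, Fin.zero_eta,
        Fin.mk_one, Matrix.cons_val', Matrix.cons_val_zero, Matrix.cons_val_one,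
        Matrix.cons_val_fin_one, hone]
    · linear_combination -hg
    · ring
    · linear_combination (-X) * hh - hb
    · ring
  all_goals
    obtain ⟨z, hz⟩ := (hu.1.map ev).exists_left_inv
    obtain ⟨t, ht⟩ := (hu.2.map ev).exists_left_inv
    obtain ⟨g, hg⟩ := hdvd (B 0 0 - C (ev (B 0 0) * z) * B 0 1) (by
      simp only [map_sub, map_mul, hC]
      linear_combination - ev (B 0 0) * hz)
    obtain ⟨h, hh⟩ := hdvd (B 1 1 - C (ev (B 1 1) * t) * b) (by
      simp only [map_sub, map_mul, hC]
      linear_combination - ev (B 1 1) * ht)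
    have hxy : ev (B 1 1) * t * (ev (B 0 0) * z) = -w := by
      linear_combination t * z * hev - w * (z * ev (B 0 1)) * ht - w * hz
    have hxy' : C (ev (B 1 1) * t) * C (ev (B 0 0) * z) = -C w := by
      rw [← map_mul, hxy, map_neg]
    refine ⟨!![B 0 1 - C (ev (B 1 1) * t) * g, g; h, b - C (ev (B 0 0) * z) * h], _,
      ⟨1, 1, ev (B 1 1) * t, ev (B 0 0) * z, isUnit_one, isUnit_one, by rw [hxy]; ring, rfl⟩, ?_⟩
    refine Matrix.ext fun i j => ?_
    generalize C (ev (B 1 1) * t) = x at *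
    generalize C (ev (B 0 0) * z) = y at *
    fin_cases i <;> fin_cases j <;>
      simp only [iwahori, Matrix.mul_apply, Fin.sum_univ_two, Matrix.of_apply, Fin.zero_eta,
        Fin.mk_one, Matrix.cons_val', Matrix.cons_val_zero, Matrix.cons_val_one,
        Matrix.cons_val_fin_one, hone]
    · linear_combination -hg - g * hxy'
    · ring
    · linear_combination -hb
    · linear_combination -hh - h * hxy'

/-- A matrix whose reduction is `Ā · diag(α, α')` and whose determinant is `X + w` up to a unit is
the product of a matrix in the kernel of reduction, which is upper triangular modulo `X`, and a
matrix in normal form. -/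
theorem exists_iwahori_mul_eq (hw : w ∈ maximalIdeal R) {h : R⟦X⟧} (hB : X ∣ B 1 0)
    (hh : IsUnit h) (hdet : B.det * h = X + C w) {c α α' : ResidueField R} (hα : α ≠ 0)
    (hα' : α' ≠ 0)
    (hres : B.map (PowerSeries.map (residue R)) = σ.residual c * !![C α, 0; 0, C α']) :
    ∃ K N, IsNormal w σ N ∧ iwahori K * N = B ∧ constantCoeff (K 0 0) = 1 ∧
      constantCoeff (K 1 1) = 1 ∧ K.map (PowerSeries.map (residue R)) = 1 := by
  obtain ⟨b, hb⟩ := hB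
  have hres' : ∀ m l, PowerSeries.map (residue R) (B m l) =
      (σ.residual c * !![C α, 0; 0, C α']) m l := fun m l => by rw [← hres]; rfl
  have hunit : ∀ {g : R⟦X⟧}, constantCoeff (PowerSeries.map (residue R) g) ≠ 0 → IsUnit g := by
    intro g hg
    rw [isUnit_iff_constantCoeff, ← residue_ne_zero_iff_isUnit]
    rwa [constantCoeff_map] at hg
  have r01 := hres' 0 1
  have r10 := hres' 1 0
  have r11 := hres' 1 1
  obtain ⟨K, N, hN, hKN⟩ := exists_iwahori_mul_eq_of_isUnit (σ := σ) hw hb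
    (by
      obtain ⟨u, rfl⟩ := hh
      exact ⟨↑u⁻¹, by rw [← hdet, mul_assoc, Units.mul_inv, mul_one]⟩)
    (by
      cases σ
      · refine hunit ?_
        rw [r11]
        simpa [Shape.residual, Matrix.mul_apply] using hα'
      all_goals
        refine ⟨hunit ?_, hunit ?_⟩
        · rw [r01]
          simpa [Shape.residual, Matrix.mul_apply] using hα'
        · have : PowerSeries.map (residue R) b = C α := by
            rw [← X_mul_inj, ← map_X (residue R), ← map_mul, ← hb, r10]
            simp [Shape.residual, Matrix.mul_apply]
          simpa [this] using hα)
  obtain ⟨e, he, hdN⟩ := hN.exists_det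
  -- Cancelling `X + w` shows that `det (iwahori K)` is a unit; its constant term is the product of
  -- the diagonal ones, the lower left entry being divisible by `X`.
  have hu : IsUnit (constantCoeff (K 0 0)) ∧ IsUnit (constantCoeff (K 1 1)) := by
    rw [← hKN, Matrix.det_mul, hdN] at hdet
    have h1 : (iwahori K).det * (C e * h) = 1 :=
      X_add_C_mul_right_cancel hw (by linear_combination hdet)
    have h2 := congrArg constantCoeff h1
    rw [Matrix.det_fin_two] at h2
    simp only [iwahori, Matrix.of_apply, Matrix.cons_val', Matrix.cons_val_zero,
      Matrix.cons_val_one, Matrix.cons_val_fin_one, map_mul, map_sub, map_one,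
      constantCoeff_X, zero_mul, mul_zero, sub_zero] at h2
    constructor
    · exact IsUnit.of_mul_eq_one _ ((mul_assoc _ _ _).symm.trans h2)
    · exact IsUnit.of_mul_eq_one (constantCoeff (K 0 0) * constantCoeff (C e) * constantCoeff h) (by
        linear_combination h2)
  obtain ⟨⟨u, hu0⟩, ⟨u', hu1⟩⟩ := hu
  -- The diagonal constant terms of `K` are moved into `N`, which stays normal.
  let t : Fin 2 → Rˣ := ![u, u']
  let D : Matrix (Fin 2) (Fin 2) R⟦X⟧ := Matrix.diagonal fun l => C (t l : R)
  let D' : Matrix (Fin 2) (Fin 2) R⟦X⟧ := Matrix.diagonal fun l => C ((t l)⁻¹ : Rˣ)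
  have hDD : D' * D = 1 := by
    rw [Matrix.diagonal_mul_diagonal, ← Matrix.diagonal_one]
    congr 1
    funext l
    rw [← map_mul, Units.inv_mul, map_one]
  have hN' : IsNormal w σ (D * N) := by
    have := hN.diagonal_mul_mul_diagonal (t := fun l => (t l : R)) (t' := fun _ => 1)
      (fun l => (t l).isUnit) (fun _ => isUnit_one)
    simpa using this
  have hKN' : iwahori (K * D') * (D * N) = B := by
    rw [iwahori_mul_diagonal, Matrix.mul_assoc, ← Matrix.mul_assoc D', hDD, Matrix.one_mul, hKN]
  have c0 : constantCoeff ((K * D') 0 0) = 1 := by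
    simp [D', Matrix.mul_diagonal, t, ← hu0]
  have c1 : constantCoeff ((K * D') 1 1) = 1 := by
    simp [D', Matrix.mul_diagonal, t, ← hu1]
  refine ⟨K * D', D * N, hN', hKN', c0, c1, ?_⟩
  generalize K * D' = K at *
  generalize D * N = N at *
  -- `Δ` is a tangent lift of the residual matrix. The linearized uniqueness, with both ideals equal
  -- to the kernel of reduction, then applies to `iwahori K - 1` and shows that `K` reduces to the
  -- identity.
  obtain ⟨Δ, hΔ, hΔres⟩ : ∃ Δ, IsTangent w σ Δ ∧ Δ.map (PowerSeries.map (residue R)) =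
      σ.residual c * !![C α, 0; 0, C α'] := by
    have hw0 : residue R w = 0 := (residue_eq_zero_iff w).mpr hw
    obtain ⟨a, rfl⟩ := residue_surjective α
    obtain ⟨a', rfl⟩ := residue_surjective α'
    obtain ⟨c, rfl⟩ := residue_surjective c
    cases σ
    · refine ⟨_, ⟨a, a', c * a, rfl⟩, Matrix.ext fun i j => ?_⟩
      fin_cases i <;> fin_cases j <;> simp [Shape.residual, Matrix.mul_apply, hw0] <;> ring
    · refine ⟨_, ⟨a, a', 0, 0, rfl⟩, Matrix.ext fun i j => ?_⟩
      fin_cases i <;> fin_cases j <;> simp [Shape.residual, Matrix.mul_apply] <;> ring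
    · refine ⟨_, ⟨a, a', c * a', 0, rfl⟩, Matrix.ext fun i j => ?_⟩
      fin_cases i <;> fin_cases j <;> simp [Shape.residual, Matrix.mul_apply] <;> ring
  have hmem := hN'.mem_of_mul_sub_mem (K := iwahori K - 1) (Δ := Δ - N)
    (I₁ := RingHom.ker (PowerSeries.map (residue R)))
    (I₂ := RingHom.ker (PowerSeries.map (residue R))) le_rfl
    (fun g hg => Ideal.mul_mem_left _ _ hg)
    (fun g r hg => by
      rw [RingHom.mem_ker] at hg ⊢
      simp only [map_sub, map_mul, map_add, map_X, map_C, (residue_eq_zero_iff w).mpr hw,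
        map_zero, add_zero] at hg
      have h0 := congrArg constantCoeff hg
      simp only [map_sub, map_mul, constantCoeff_X, zero_mul, constantCoeff_C, map_zero,
        zero_sub, neg_eq_zero] at h0
      rw [h0, map_zero, sub_zero, ← mul_zero X, X_mul_inj] at hg
      exact hg)
    (fun g hg => by
      rw [RingHom.mem_ker] at hg ⊢
      have := congrArg constantCoeff hg
      rw [constantCoeff_map, map_zero] at this
      rw [map_C, this, map_zero])
    (hΔ.sub hN'.isTangent) (by simp [iwahori, c0]) (by simp [iwahori]) (by simp [iwahori, c1])
    (fun m l => by
      have : (iwahori K - 1) * N - (Δ - N) = B - Δ := by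
        rw [Matrix.sub_mul, hKN', Matrix.one_mul]
        abel
      rw [this, RingHom.mem_ker, Matrix.sub_apply, map_sub, hres', ← hΔres, Matrix.map_apply,
        sub_self])
  apply iwahori_injective
  rw [← map_iwahori, iwahori_one]
  refine Matrix.ext fun m l => ?_
  have := hmem m l
  rw [RingHom.mem_ker, Matrix.sub_apply, map_sub, sub_eq_zero] at this
  rw [Matrix.map_apply, this]
  fin_cases m <;> fin_cases l <;> simp

end Existence

end KisinGL2

end

noncomputable section

namespace KisinGL2

/-! ## Twisted conjugacy by matrices in the kernel of reduction -/

section Twisted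

variable {p : ℕ} [hp : Fact p.Prime] {R : Type*} [CommRing R] {τ : Equiv.Perm (Fin 2)}
  {e : Fin 2 → Fin 2 → ℕ}

/-- The effect of Frobenius on a change of basis: `φ` is applied to the entries, which are then
permuted by `τ` and multiplied by powers of the variable. -/
def twistedFrob (p : ℕ) [Fact p.Prime] (τ : Equiv.Perm (Fin 2)) (e : Fin 2 → Fin 2 → ℕ)
    (K : Matrix (Fin 2) (Fin 2) R⟦X⟧) : Matrix (Fin 2) (Fin 2) R⟦X⟧ :=
  Matrix.of fun m l => X ^ e m l * frob p R (K (τ m) (τ l))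

/-- The exponents occurring in `twistedFrob` for a generic type. -/
structure IsGenericTwist (τ : Equiv.Perm (Fin 2)) (e : Fin 2 → Fin 2 → ℕ) : Prop where
  diag : ∀ m, e m m = 0
  upper : ∀ m l, τ m = 0 → τ l = 1 → 2 ≤ e m l
  lower : ∀ m l, τ m = 1 → τ l = 0 → 3 ≤ e m l

theorem IsGenericTwist.two_le (h : IsGenericTwist τ e) {m l : Fin 2} (hml : m ≠ l) :
    2 ≤ e m l := by
  have hne : τ m ≠ τ l := fun h => hml (τ.injective h)
  have h1 := h.upper m l
  have h2 := h.lower m l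
  generalize τ m = a at *
  generalize τ l = b at *
  fin_cases a <;> fin_cases b <;> simp at * <;> omega

theorem frob_C (r : R) : frob p R (C r) = C r := expand_C p hp.out.ne_zero r

theorem frob_X : frob p R X = X ^ p := expand_X p hp.out.ne_zero

theorem map_frob {S : Type*} [CommRing S] (g : R →+* S) (h : R⟦X⟧) :
    PowerSeries.map g (frob p R h) = frob p S (PowerSeries.map g h) :=
  map_expand p hp.out.ne_zero g h

theorem twistedFrob_one (h : IsGenericTwist τ e) :
    twistedFrob p τ e (1 : Matrix (Fin 2) (Fin 2) R⟦X⟧) = 1 := by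
  refine Matrix.ext fun m l => ?_
  by_cases hml : m = l
  · subst hml
    simp [twistedFrob, h.diag]
  · simp [twistedFrob, hml]

theorem map_twistedFrob {S : Type*} [CommRing S] (g : R →+* S)
    (K : Matrix (Fin 2) (Fin 2) R⟦X⟧) :
    (twistedFrob p τ e K).map (PowerSeries.map g) =
      twistedFrob p τ e (K.map (PowerSeries.map g)) := by
  refine Matrix.ext fun m l => ?_
  simp [twistedFrob, map_frob]

theorem twistedFrob_mul_diagonal (K : Matrix (Fin 2) (Fin 2) R⟦X⟧) (t : Fin 2 → R) :
    twistedFrob p τ e (K * Matrix.diagonal fun l => C (t l)) =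
      twistedFrob p τ e K * Matrix.diagonal fun l => C (t (τ l)) := by
  refine Matrix.ext fun m l => ?_
  simp [twistedFrob, Matrix.mul_diagonal, frob_C, mul_assoc]

theorem X_dvd_mul_twistedFrob (h : IsGenericTwist τ e) {B : Matrix (Fin 2) (Fin 2) R⟦X⟧}
    (hB : X ∣ B 1 0) (K : Matrix (Fin 2) (Fin 2) R⟦X⟧) :
    X ∣ (B * twistedFrob p τ e K) 1 0 := by
  rw [Matrix.mul_apply, Fin.sum_univ_two]
  refine dvd_add (hB.mul_right _) (Dvd.dvd.mul_left ?_ _)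
  exact (dvd_pow_self _ (by have := h.two_le (m := 1) (l := 0) (by simp); omega)).mul_right _

/-- On the diagonal the differences have no constant term, so `v ↦ v^p` makes them divisible by
`v²`; off the diagonal the exponents `e` provide `v²`. The lower left entry is known only after
multiplication by `X`, hence one step less precisely, and the bound `3` in `IsGenericTwist.lower`
pays for this. -/
theorem exists_twistedFrob_sub (h : IsGenericTwist τ e) (hp3 : 3 ≤ p) {I : Ideal R} {n : ℕ}
    {K K' : Matrix (Fin 2) (Fin 2) R⟦X⟧}
    (h0 : ∀ l, constantCoeff (K' l l) = constantCoeff (K l l))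
    (hK : ∀ m l, (iwahori K' - iwahori K) m l ∈ filt I n) :
    ∃ Q : Matrix (Fin 2) (Fin 2) R⟦X⟧, twistedFrob p τ e K' - twistedFrob p τ e K =
      (X ^ 2 : R⟦X⟧) • Q ∧ ∀ m l, Q m l ∈ filt I n := by
  suffices ∀ m l, ∃ q ∈ filt I n, (twistedFrob p τ e K' - twistedFrob p τ e K) m l =
      X ^ 2 * q by
    choose q hq hq' using this
    exact ⟨Matrix.of q, Matrix.ext hq', hq⟩
  intro m l
  have hent : (twistedFrob p τ e K' - twistedFrob p τ e K) m l =
      X ^ e m l * expand p hp.out.ne_zero (K' (τ m) (τ l) - K (τ m) (τ l)) := by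
    rw [map_sub, mul_sub]
    rfl
  rw [hent]
  by_cases hml : m = l
  · subst hml
    rw [h.diag, pow_zero, one_mul]
    refine exists_expand_eq_X_sq_mul hp.out.ne_zero hp3 ?_ (by rw [map_sub, h0, sub_self])
    have := hK (τ m) (τ m)
    generalize τ m = a at *
    fin_cases a <;> simpa [iwahori] using this
  · have hne : τ m ≠ τ l := fun h => hml (τ.injective h)
    have hKml := hK (τ m) (τ l)
    have h1 := h.upper m l
    have h2 := h.lower m l
    generalize τ m = a at *
    generalize τ l = b at *
    obtain ⟨rfl, rfl⟩ | ⟨rfl, rfl⟩ : a = 0 ∧ b = 1 ∨ a = 1 ∧ b = 0 := by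
      have : ∀ a b : Fin 2, a ≠ b → a = 0 ∧ b = 1 ∨ a = 1 ∧ b = 0 := by decide
      exact this a b hne
    · refine ⟨X ^ (e m l - 2) * expand p hp.out.ne_zero (K' 0 1 - K 0 1),
        Ideal.mul_mem_left _ _ (expand_mem_filt _ (by simpa [iwahori] using hKml)), ?_⟩
      rw [← mul_assoc, ← pow_add, Nat.add_sub_cancel' (h1 rfl rfl)]
    · refine ⟨X ^ (e m l - 3) * (X * expand p hp.out.ne_zero (K' 1 0 - K 1 0)),
        Ideal.mul_mem_left _ _ ?_, ?_⟩
      · cases n with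
        | zero => exact mem_filt_zero _
        | succ n =>
          have : X * (K' 1 0 - K 1 0) ∈ filt I (n + 1) := by
            rw [mul_sub]
            simpa [iwahori] using hKml
          have := mul_mem_filt (X_mem_filt (I := I))
            (expand_mem_filt hp.out.ne_zero (mem_filt_of_X_mul_mem this))
          rwa [add_comm 1] at this
      · generalize expand p hp.out.ne_zero (K' 1 0 - K 1 0) = g
        obtain ⟨k, hk⟩ := Nat.exists_eq_add_of_le (h2 rfl rfl)
        rw [hk, Nat.add_sub_cancel_left]
        ring

end Twisted

/-! ### Fixed points of the contraction: existence and uniqueness of twisted normal forms. -/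

section FixedPoint

variable {p : ℕ} [hp : Fact p.Prime] {f : ℕ} {R : Type*} [CommRing R] [IsLocalRing R]
  {τ : ZMod f → Equiv.Perm (Fin 2)} {e : ZMod f → Fin 2 → Fin 2 → ℕ}

theorem isUnit_det_of_map_eq_one {Φ : Matrix (Fin 2) (Fin 2) R⟦X⟧}
    (h : Φ.map (PowerSeries.map (residue R)) = 1) : IsUnit Φ.det := by
  have h1 : PowerSeries.map (residue R) Φ.det = 1 := by
    rw [RingHom.map_det, RingHom.mapMatrix_apply, h, Matrix.det_one]
  rw [isUnit_iff_constantCoeff, ← residue_ne_zero_iff_isUnit, ← constantCoeff_map, h1]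
  simp

theorem map_eq_of_iwahori_mul_eq {J N A Φ : Matrix (Fin 2) (Fin 2) R⟦X⟧}
    (h : J * N = A * Φ) (hJ : J.map (PowerSeries.map (residue R)) = 1)
    (hΦ : Φ.map (PowerSeries.map (residue R)) = 1) :
    N.map (PowerSeries.map (residue R)) = A.map (PowerSeries.map (residue R)) := by
  have := congrArg (fun M => M.map (PowerSeries.map (residue R))) h
  simpa [Matrix.map_mul, hJ, hΦ] using this

theorem sub_mem_filt_one_of_map_eq {N N' : Matrix (Fin 2) (Fin 2) R⟦X⟧}
    (h : N.map (PowerSeries.map (residue R)) = N'.map (PowerSeries.map (residue R)))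
    (m l : Fin 2) : (N - N') m l ∈ filt (maximalIdeal R) 1 := by
  intro k
  have h1 := congrArg (coeff k) (congrFun (congrFun h m) l)
  rw [Matrix.map_apply, Matrix.map_apply, coeff_map, coeff_map, ← sub_eq_zero, ← map_sub,
    residue_eq_zero_iff] at h1
  refine Ideal.pow_le_pow_right (Nat.sub_le 1 k) ?_
  simpa using h1

theorem map_twistedFrob_eq_one {τ : Equiv.Perm (Fin 2)} {e : Fin 2 → Fin 2 → ℕ}
    (he : IsGenericTwist τ e) {K : Matrix (Fin 2) (Fin 2) R⟦X⟧}
    (h : K.map (PowerSeries.map (residue R)) = 1) :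
    (twistedFrob p τ e K).map (PowerSeries.map (residue R)) = 1 := by
  rw [map_twistedFrob, h, twistedFrob_one he]

theorem map_iwahori_eq_one {K : Matrix (Fin 2) (Fin 2) R⟦X⟧}
    (h : K.map (PowerSeries.map (residue R)) = 1) :
    (iwahori K).map (PowerSeries.map (residue R)) = 1 := by
  rw [map_iwahori, h, iwahori_one]

/-- The changes of basis which reduce to the identity, and whose diagonal entries have constant
term `1`. -/
structure IsUnipotent (K : Matrix (Fin 2) (Fin 2) R⟦X⟧) : Prop where
  diag : ∀ l, constantCoeff (K l l) = 1
  map_eq_one : K.map (PowerSeries.map (residue R)) = 1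

theorem isUnipotent_one : IsUnipotent (1 : Matrix (Fin 2) (Fin 2) R⟦X⟧) where
  diag l := by simp
  map_eq_one := by simp

theorem IsNormal.iwahori_sub_mem_filt {τ : Equiv.Perm (Fin 2)} {e : Fin 2 → Fin 2 → ℕ}
    (he : IsGenericTwist τ e) (hp3 : 3 ≤ p) {w : R} (hw : w ∈ maximalIdeal R) {σ : Shape}
    {N N' A K K' L L' : Matrix (Fin 2) (Fin 2) R⟦X⟧}
    (hN : IsNormal w σ N) (hN' : IsNormal w σ N') (hK : IsUnipotent K) (hK' : IsUnipotent K')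
    (hL : IsUnipotent L) (hL' : IsUnipotent L') (h : iwahori L * N = A * twistedFrob p τ e K)
    (h' : iwahori L' * N' = A * twistedFrob p τ e K') {n : ℕ}
    (hn : ∀ m l, (iwahori K' - iwahori K) m l ∈ filt (maximalIdeal R) n) (m l : Fin 2) :
    (iwahori L' - iwahori L) m l ∈ filt (maximalIdeal R) (n + 1) := by
  obtain ⟨Q, hQ, hQn⟩ := exists_twistedFrob_sub (p := p) he hp3
    (fun l => by rw [hK.diag, hK'.diag]) hn
  refine hN.sub_mem_filt hw hN' ?_ ?_ ?_ ?_ ?_ ?_ h h'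
    (isUnit_det_of_map_eq_one (map_twistedFrob_eq_one he hK.map_eq_one)) hQ hQn
    (sub_mem_filt_one_of_map_eq ?_) m l
  · simpa [iwahori] using hL.diag 0
  · simp [iwahori]
  · simpa [iwahori] using hL.diag 1
  · simpa [iwahori] using hL'.diag 0
  · simp [iwahori]
  · simpa [iwahori] using hL'.diag 1
  · rw [map_eq_of_iwahori_mul_eq h (map_iwahori_eq_one hL.map_eq_one)
      (map_twistedFrob_eq_one he hK.map_eq_one),
      map_eq_of_iwahori_mul_eq h' (map_iwahori_eq_one hL'.map_eq_one)
      (map_twistedFrob_eq_one he hK'.map_eq_one)]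

variable [IsAdicComplete (maximalIdeal R) R]

theorem exists_isUnipotent_limit {K : ℕ → Matrix (Fin 2) (Fin 2) R⟦X⟧}
    (hK : ∀ n, IsUnipotent (K n))
    (h : ∀ n m l, (iwahori (K (n + 1)) - iwahori (K n)) m l ∈ filt (maximalIdeal R) n) :
    ∃ K' : Matrix (Fin 2) (Fin 2) R⟦X⟧, IsUnipotent K' ∧
      ∀ n m l, (iwahori K' - iwahori (K n)) m l ∈ filt (maximalIdeal R) n := by
  have hex : ∀ m l, ∃ g, ∀ n, g - iwahori (K n) m l ∈ filt (maximalIdeal R) n :=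
    fun m l => exists_sub_mem_filt fun n => h n m l
  choose g hg using hex
  have hconst : ∀ {m l r}, (∀ n, constantCoeff (iwahori (K n) m l) = r) →
      constantCoeff (g m l) = r := fun {m l r} hr => by
    rw [← sub_eq_zero]
    refine eq_zero_of_mem_pow (I := maximalIdeal R) fun n => ?_
    have := constantCoeff_mem_of_mem_filt (hg m l n)
    rwa [map_sub, hr] at this
  obtain ⟨b, hb⟩ : X ∣ g 1 0 := X_dvd_iff.mpr (hconst fun n => by simp [iwahori])
  have hiw : iwahori !![g 0 0, g 0 1; b, g 1 1] = Matrix.of g := by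
    refine Matrix.ext fun i j => ?_
    fin_cases i <;> fin_cases j <;> simp [iwahori, hb]
  refine ⟨!![g 0 0, g 0 1; b, g 1 1], ⟨fun l => ?_, ?_⟩, fun n m l => ?_⟩
  · fin_cases l
    · exact hconst fun n => by simpa [iwahori] using (hK n).diag 0
    · exact hconst fun n => by simpa [iwahori] using (hK n).diag 1
  · apply iwahori_injective
    rw [← map_iwahori, hiw, iwahori_one]
    refine Matrix.ext fun m l => PowerSeries.ext fun k => ?_
    -- Stage `k + 1` is the first to determine the coefficient of degree `k` modulo the maximal
    -- ideal.
    have h1 := hg m l (k + 1) k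
    rw [Nat.add_sub_cancel_left, pow_one, ← residue_eq_zero_iff, map_sub, map_sub, sub_eq_zero,
      ← coeff_map, ← coeff_map] at h1
    have h2 := congrFun (congrFun (map_iwahori_eq_one (hK (k + 1)).map_eq_one) m) l
    rw [Matrix.map_apply] at h2
    rw [Matrix.map_apply, Matrix.of_apply, h1, h2]
  · rw [hiw]
    exact hg m l n

theorem IsUnipotent.eq_of_iwahori_sub_mem {K K' : Matrix (Fin 2) (Fin 2) R⟦X⟧}
    (h : ∀ n m l, (iwahori K' - iwahori K) m l ∈ filt (maximalIdeal R) n) : K' = K :=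
  iwahori_injective (Matrix.ext fun m l => by
    rw [← sub_eq_zero]
    exact eq_zero_of_mem_filt (I := maximalIdeal R) fun n => h n m l)

/-- The solution is the fixed point of the map sending `K` to the Iwahori factors of `B i *
twistedFrob (K i)`, obtained as the limit of its iterates from the identity. -/
theorem exists_isNormal_twisted_conj (hT : ∀ i, IsGenericTwist (τ i) (e i)) (hp3 : 3 ≤ p)
    {w : R} (hw : w ∈ maximalIdeal R)
    {σ : ZMod f → Shape}
    {B : ZMod f → Matrix (Fin 2) (Fin 2) R⟦X⟧} {h : ZMod f → R⟦X⟧}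
    (hB : ∀ i, X ∣ B i 1 0) (hh : ∀ i, IsUnit (h i)) (hdet : ∀ i, (B i).det * h i = X + C w)
    {c α α' : ZMod f → ResidueField R} (hα : ∀ i, α i ≠ 0) (hα' : ∀ i, α' i ≠ 0)
    (hres : ∀ i, (B i).map (PowerSeries.map (residue R)) =
      (σ i).residual (c i) * !![C (α i), 0; 0, C (α' i)]) :
    ∃ K N : ZMod f → Matrix (Fin 2) (Fin 2) R⟦X⟧, ∀ i, IsUnipotent (K i) ∧ IsNormal w (σ i) (N i) ∧
      iwahori (K (i + 1)) * N i = B i * twistedFrob p (τ i) (e i) (K i) := by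
  have step : ∀ K : ZMod f → Matrix (Fin 2) (Fin 2) R⟦X⟧, (∀ i, IsUnipotent (K i)) →
      ∃ K' N : ZMod f → Matrix (Fin 2) (Fin 2) R⟦X⟧, ∀ i, IsUnipotent (K' i) ∧ IsNormal w (σ i) (N i) ∧
        iwahori (K' (i + 1)) * N i = B i * twistedFrob p (τ i) (e i) (K i) := by
    intro K hK
    have : ∀ i, ∃ K' N : Matrix (Fin 2) (Fin 2) R⟦X⟧, IsUnipotent K' ∧ IsNormal w (σ i) N ∧
        iwahori K' * N = B i * twistedFrob p (τ i) (e i) (K i) := by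
      intro i
      have h1 := map_twistedFrob_eq_one (p := p) (hT i) (hK i).map_eq_one
      obtain ⟨u, hu⟩ := isUnit_det_of_map_eq_one h1
      obtain ⟨K', N, hN, hKN, h0, h1, hm⟩ := exists_iwahori_mul_eq (σ := σ i) (h := ↑u⁻¹ * h i)
        (B := B i * twistedFrob p (τ i) (e i) (K i)) hw (X_dvd_mul_twistedFrob (hT i) (hB i) (K i))
        (u⁻¹.isUnit.mul (hh i)) (by
          rw [Matrix.det_mul, ← hu, mul_assoc, Units.mul_inv_cancel_left, hdet i])
        (hα i) (hα' i) (by rw [Matrix.map_mul, h1, Matrix.mul_one, hres i])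
      exact ⟨K', N, ⟨fun l => by fin_cases l <;> assumption, hm⟩, hN, hKN⟩
    choose K' N h1 h2 h3 using this
    -- The factor computed from index `i` is the change of basis at `i + 1`.
    exact ⟨fun j => K' (j - 1), N, fun i => ⟨h1 _, h2 i, by simpa using h3 i⟩⟩
  choose! Φ N hΦ using step
  let S : ℕ → ZMod f → Matrix (Fin 2) (Fin 2) R⟦X⟧ := fun n => Φ^[n] fun _ => 1
  have hS : ∀ n, S (n + 1) = Φ (S n) := fun n => Function.iterate_succ_apply' _ _ _
  have hSu : ∀ n i, IsUnipotent (S n i) := by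
    intro n
    induction n with
    | zero => exact fun i => isUnipotent_one
    | succ n ih => exact fun i => by rw [hS]; exact (hΦ _ ih i).1
  have contr : ∀ {n : ℕ} {K K' : ZMod f → Matrix (Fin 2) (Fin 2) R⟦X⟧},
      (∀ i, IsUnipotent (K i)) → (∀ i, IsUnipotent (K' i)) →
      (∀ i m l, (iwahori (K' i) - iwahori (K i)) m l ∈ filt (maximalIdeal R) n) →
      ∀ i m l, (iwahori (Φ K' i) - iwahori (Φ K i)) m l ∈ filt (maximalIdeal R) (n + 1) := by
    intro n K K' hK hK' hn i
    obtain ⟨i, rfl⟩ : ∃ i', i = i' + 1 := ⟨i - 1, by simp⟩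
    exact (hΦ K hK i).2.1.iwahori_sub_mem_filt (hT i) hp3 hw (hΦ K' hK' i).2.1 (hK i) (hK' i)
      (hΦ K hK _).1 (hΦ K' hK' _).1 (hΦ K hK i).2.2 (hΦ K' hK' i).2.2 (hn i)
  have hcauchy : ∀ n i m l,
      (iwahori (S (n + 1) i) - iwahori (S n i)) m l ∈ filt (maximalIdeal R) n := by
    intro n
    induction n with
    | zero => exact fun i m l => mem_filt_zero _
    | succ n ih =>
      rw [hS (n + 1)]
      nth_rw 2 [hS n]
      exact contr (hSu n) (hSu (n + 1)) ih
  have hlim := fun i => exists_isUnipotent_limit (fun n => hSu n i) (fun n => hcauchy n i)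
  choose K hK hKS using hlim
  have hfix : Φ K = K := by
    funext i
    refine IsUnipotent.eq_of_iwahori_sub_mem fun n m l => ?_
    -- Both `Φ K` and `K` are within step `n + 1` of the iterate `S (n + 1) = Φ (S n)`.
    have h1 := contr (hSu n) hK (fun i => hKS i n) i m l
    have h2 := hKS i (n + 1) m l
    rw [hS] at h2
    have := filt_anti (Nat.le_succ n) (sub_mem h1 h2)
    simpa using this
  refine ⟨K, N K, fun i => ?_⟩
  have := hΦ K hK i
  rwa [hfix] at this

/-- Once its diagonal constant terms are divided out, `K` solves a twisted equation between normal
forms, as does the identity. The contraction estimate brings the two solutions together in every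
step of the filtration. -/
theorem eq_diagonal_of_twisted_conj (hT : ∀ i, IsGenericTwist (τ i) (e i)) (hp3 : 3 ≤ p)
    {w : R} (hw : w ∈ maximalIdeal R)
    {σ : ZMod f → Shape}
    {A N K : ZMod f → Matrix (Fin 2) (Fin 2) R⟦X⟧}
    (hA : ∀ i, IsNormal w (σ i) (A i)) (hN : ∀ i, IsNormal w (σ i) (N i))
    (hK : ∀ i, (K i).map (PowerSeries.map (residue R)) = 1)
    (h : ∀ i, iwahori (K (i + 1)) * N i = A i * twistedFrob p (τ i) (e i) (K i)) :
    ∃ t : ZMod f → Fin 2 → Rˣ, ∀ i, K i = Matrix.diagonal fun l => C (t i l : R) := by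
  have hres : ∀ i l, residue R (constantCoeff (K i l l)) = 1 := fun i l => by
    have := congrArg constantCoeff (congrFun (congrFun (hK i) l) l)
    rw [Matrix.map_apply, constantCoeff_map] at this
    simpa using this
  have hu : ∀ i l, IsUnit (constantCoeff (K i l l)) := fun i l => by
    rw [← residue_ne_zero_iff_isUnit, hres]
    exact one_ne_zero
  choose t ht using hu
  let D : (Fin 2 → Rˣ) → Matrix (Fin 2) (Fin 2) R⟦X⟧ := fun t => Matrix.diagonal fun l => C (t l : R)
  have hD : ∀ t, D t⁻¹ * D t = 1 := fun t => by
    rw [Matrix.diagonal_mul_diagonal, ← Matrix.diagonal_one]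
    congr 1
    funext l
    rw [← map_mul, Pi.inv_apply, Units.inv_mul, map_one]
  have hD' : ∀ i, (D (t i)⁻¹).map (PowerSeries.map (residue R)) = 1 := fun i => by
    rw [Matrix.diagonal_map (map_zero _), ← Matrix.diagonal_one]
    congr 1
    funext l
    have : residue R ((t i l)⁻¹ : Rˣ) = 1 := by
      have h1 := congrArg (residue R) (t i l).inv_mul
      rwa [map_mul, ht, hres, mul_one, map_one] at h1
    simp [this]
  let K₀ := fun i => K i * D (t i)⁻¹
  -- `twistedFrob` permutes a diagonal factor on the right by `τ i`, hence the index `τ i l`.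
  let N₀ := fun i => D (t (i + 1)) * N i * D (fun l => (t i)⁻¹ (τ i l))
  have hK₀ : ∀ i, IsUnipotent (K₀ i) := fun i =>
    ⟨fun l => by simp [K₀, D, Matrix.mul_diagonal, ← ht], by
      simp only [K₀]
      rw [Matrix.map_mul, hK, hD', Matrix.one_mul]⟩
  have hN₀ : ∀ i, IsNormal w (σ i) (N₀ i) := fun i =>
    (hN i).diagonal_mul_mul_diagonal (fun l => (t (i + 1) l).isUnit)
      (fun l => ((t i)⁻¹ (τ i l)).isUnit)
  have h₀ : ∀ i, iwahori (K₀ (i + 1)) * N₀ i = A i * twistedFrob p (τ i) (e i) (K₀ i) := fun i => by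
    simp only [K₀, N₀, D]
    rw [twistedFrob_mul_diagonal, iwahori_mul_diagonal, ← Matrix.mul_assoc (A i), ← h i,
      Matrix.mul_assoc (iwahori _), ← Matrix.mul_assoc _ _ (Matrix.diagonal _),
      ← Matrix.mul_assoc _ _ (N i), hD, Matrix.one_mul, Matrix.mul_assoc]
  have hclose : ∀ n i m l, (iwahori (K₀ i) - iwahori (1 : Matrix (Fin 2) (Fin 2) R⟦X⟧)) m l ∈ filt (maximalIdeal R) n := by
    intro n
    induction n with
    | zero => exact fun i m l => mem_filt_zero _
    | succ n ih =>
      intro i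
      obtain ⟨i, rfl⟩ : ∃ i', i = i' + 1 := ⟨i - 1, by simp⟩
      exact (hA i).iwahori_sub_mem_filt (hT i) hp3 hw (hN₀ i) isUnipotent_one (hK₀ i)
        isUnipotent_one (hK₀ _) (by rw [iwahori_one, twistedFrob_one (hT i), Matrix.one_mul,
          Matrix.mul_one]) (h₀ i) (ih i)
  refine ⟨t, fun i => ?_⟩
  have h1 : K i * D (t i)⁻¹ = 1 := IsUnipotent.eq_of_iwahori_sub_mem fun n => hclose n i
  calc K i = K i * D (t i)⁻¹ * D (t i) := by rw [Matrix.mul_assoc, hD, Matrix.mul_one]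
    _ = D (t i) := by rw [h1, Matrix.one_mul]

end FixedPoint

end KisinGL2

end

noncomputable section

namespace KisinGL2

/-! ## The normal forms `A_1`, `A_2`, `A_3` -/

section NormalForm

section Ring

variable {R : Type*} [CommRing R] {w : R} {σ : Shape}

/-- The matrices `A_1`, respectively `A_2` or `A_3`, in terms of all their entries. -/
def normalMatrix (w : R) (σ : Shape) (x y : R) : Matrix (Fin 2) (Fin 2) R⟦X⟧ :=
  match σ with
  | .one => !![X + C w, 0; C x * X, 1]
  | .two | .three => !![C (-y), 1; X, C x]

/-- The relation between the entries of `normalMatrix w σ x y`. -/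
def Shape.Relation (w : R) (σ : Shape) (x y : R) : Prop :=
  match σ with
  | .one => True
  | .two | .three => x * y = w

theorem IsNormal.exists_eq_normalMatrix_mul {N : Matrix (Fin 2) (Fin 2) R⟦X⟧}
    (hN : IsNormal w σ N) : ∃ (x y : R) (t : Fin 2 → Rˣ), σ.Relation w x y ∧
      N = normalMatrix w σ x y * Matrix.diagonal fun l => C (t l : R) := by
  cases σ
  · obtain ⟨_, _, x, ⟨d, rfl⟩, ⟨d', rfl⟩, rfl⟩ := hN
    refine ⟨x * (d⁻¹ : Rˣ), 0, ![d, d'], trivial, Matrix.ext fun i j => ?_⟩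
    rw [Matrix.mul_diagonal]
    have h : C ((d⁻¹ : Rˣ) : R) * C (d : R) = 1 := by rw [← map_mul, Units.inv_mul, map_one]
    fin_cases i <;> fin_cases j <;> simp [normalMatrix]
    · ring
    · linear_combination (- C x * X) * h
  all_goals
    obtain ⟨_, _, x, y, ⟨d, rfl⟩, ⟨d', rfl⟩, hxy, rfl⟩ := hN
    refine ⟨x * (d'⁻¹ : Rˣ), -y * (d⁻¹ : Rˣ), ![d, d'], ?_, Matrix.ext fun i j => ?_⟩
    · change _ = _
      linear_combination -((d⁻¹ : Rˣ) * (d'⁻¹ : Rˣ) : R) * hxy + w * d' * (d'⁻¹ : Rˣ) * d.inv_mul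
        + w * d'.inv_mul
    · rw [Matrix.mul_diagonal]
      have h : C ((d⁻¹ : Rˣ) : R) * C (d : R) = 1 := by rw [← map_mul, Units.inv_mul, map_one]
      have h' : C ((d'⁻¹ : Rˣ) : R) * C (d' : R) = 1 := by rw [← map_mul, Units.inv_mul, map_one]
      fin_cases i <;> fin_cases j <;> simp [normalMatrix]
      · linear_combination (- C y) * h
      · ring
      · linear_combination (- C x) * h'

theorem isNormal_normalMatrix_mul {x y : R} (h : σ.Relation w x y) (t : Fin 2 → Rˣ) :
    IsNormal w σ (normalMatrix w σ x y * Matrix.diagonal fun l => C (t l : R)) := by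
  have h1 : IsNormal w σ (normalMatrix w σ x y) := by
    cases σ
    · exact ⟨1, 1, x, isUnit_one, isUnit_one, by simp [normalMatrix]⟩
    all_goals
      refine ⟨1, 1, x, -y, isUnit_one, isUnit_one, ?_, by simp [normalMatrix]⟩
      change x * y = w at h
      linear_combination -h
  have := h1.diagonal_mul_mul_diagonal (t := fun _ => 1) (t' := fun l => (t l : R))
    (fun _ => isUnit_one) (fun l => (t l).isUnit)
  simpa using this

/-- Diagonal matrices can be moved to the other side of a matrix in normal form. -/
theorem exists_normalMatrix_mul_eq {x y : R} (h : σ.Relation w x y) (t : Fin 2 → Rˣ) :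
    ∃ (x' y' : R) (t' : Fin 2 → Rˣ), σ.Relation w x' y' ∧
      normalMatrix w σ x y * Matrix.diagonal (fun l => C (t l : R)) =
      Matrix.diagonal (fun l => C (t' l : R)) * normalMatrix w σ x' y' := by
  cases σ
  · refine ⟨x * t 0 * ((t 1)⁻¹ : Rˣ), 0, t, trivial, Matrix.ext fun i j => ?_⟩
    rw [Matrix.mul_diagonal, Matrix.diagonal_mul]
    have h : C (((t 1)⁻¹ : Rˣ) : R) * C (t 1 : R) = 1 := by
      rw [← map_mul, Units.inv_mul, map_one]
    fin_cases i <;> fin_cases j <;> simp [normalMatrix]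
    · ring
    · linear_combination (-C x * C (t 0 : R) * X) * h
  all_goals
    refine ⟨x * t 1 * ((t 0)⁻¹ : Rˣ), y * t 0 * ((t 1)⁻¹ : Rˣ), t ∘ Equiv.swap 0 1, ?_,
      Matrix.ext fun i j => ?_⟩
    · change x * y = w at h
      change _ = w
      linear_combination h + x * y * t 1 * ((t 1)⁻¹ : Rˣ) * (t 0).inv_mul + x * y * (t 1).inv_mul
    · rw [Matrix.mul_diagonal, Matrix.diagonal_mul]
      have h0 : C (((t 0)⁻¹ : Rˣ) : R) * C (t 0 : R) = 1 := by
        rw [← map_mul, Units.inv_mul, map_one]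
      have h1 : C (((t 1)⁻¹ : Rˣ) : R) * C (t 1 : R) = 1 := by
        rw [← map_mul, Units.inv_mul, map_one]
      fin_cases i <;> fin_cases j <;> simp [normalMatrix]
      · linear_combination (-C y * C (t 0 : R)) * h1
      · ring
      · linear_combination (-C x * C (t 1 : R)) * h0

end Ring

variable {R : Type*} [CommRing R] [IsLocalRing R] {w : R} {σ : Shape}

/-- The entries of `normalMatrix w σ x y` have the reductions which are prescribed in the
definition of `HasNormalForm`. -/
def Shape.IsResidue (σ : Shape) (c : ResidueField R) (x y : R) : Prop :=
  match σ with
  | .one => residue R x = c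
  | .two => residue R x = 0 ∧ residue R y = 0
  | .three => residue R x = c ∧ residue R y = 0

theorem isResidue_of_map_eq (hw : w ∈ maximalIdeal R) {c : ResidueField R}
    {d : Fin 2 → ResidueField R} (hd : ∀ l, d l ≠ 0) {x y : R} {t : Fin 2 → Rˣ}
    (h : (normalMatrix w σ x y * Matrix.diagonal fun l => C (t l : R)).map
      (PowerSeries.map (residue R)) = σ.residual c * Matrix.diagonal fun l => C (d l)) :
    σ.IsResidue c x y ∧ ∀ l, residue R (t l) = d l := by
  have hw0 : residue R w = 0 := (residue_eq_zero_iff w).mpr hw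
  have hent := fun m l => congrFun (congrFun h m) l
  simp only [Matrix.map_apply, Matrix.mul_diagonal] at hent
  have h0 := hd 0
  have h1 := hd 1
  have e00 := hent 0 0
  have e01 := hent 0 1
  have e10 := hent 1 0
  have e11 := hent 1 1
  clear hent
  have hne : ∀ a : ResidueField R, a ≠ 0 → (C a : (ResidueField R)⟦X⟧) ≠ 0 := fun a ha => by
    simpa using ha
  cases σ
  · simp [normalMatrix, Shape.residual, hw0] at e00 e10 e11
    rw [e00] at e10
    have := mul_right_cancel₀ X_ne_zero (mul_right_cancel₀ (hne _ h0) e10)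
    exact ⟨C_injective this, Fin.forall_fin_two.mpr ⟨C_injective e00, C_injective e11⟩⟩
  · simp [normalMatrix, Shape.residual] at e00 e01 e10 e11
    exact ⟨⟨(residue_eq_zero_iff x).mpr e11, (residue_eq_zero_iff y).mpr e00⟩,
      Fin.forall_fin_two.mpr ⟨C_injective e10, C_injective e01⟩⟩
  · simp [normalMatrix, Shape.residual] at e00 e01 e10 e11
    rw [e01] at e11
    have := mul_right_cancel₀ (hne _ h1) e11
    exact ⟨⟨C_injective this, (residue_eq_zero_iff y).mpr e00⟩,
      Fin.forall_fin_two.mpr ⟨C_injective e10, C_injective e01⟩⟩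

theorem isResidue_of_map_diagonal_mul_eq (hw : w ∈ maximalIdeal R) {c : ResidueField R}
    {x y : R} {t : Fin 2 → Rˣ}
    (h : ((Matrix.diagonal fun l => C (t l : R)) * normalMatrix w σ x y).map
      (PowerSeries.map (residue R)) = σ.residual c) :
    σ.IsResidue c x y ∧ ∀ l, residue R (t l) = 1 := by
  have hw0 : residue R w = 0 := (residue_eq_zero_iff w).mpr hw
  have hent := fun m l => congrFun (congrFun h m) l
  simp only [Matrix.map_apply, Matrix.diagonal_mul] at hent
  have e00 := hent 0 0
  have e01 := hent 0 1
  have e10 := hent 1 0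
  have e11 := hent 1 1
  clear hent
  have hone : ∀ {a : ResidueField R}, (C a : (ResidueField R)⟦X⟧) = 1 → a = 1 := fun ha =>
    C_injective (ha.trans (map_one _).symm)
  cases σ
  · simp [normalMatrix, Shape.residual, hw0] at e00 e10 e11
    have e00 := hone e00
    have e11 := hone e11
    rw [e11, map_one, one_mul] at e10
    exact ⟨C_injective (mul_right_cancel₀ X_ne_zero e10), Fin.forall_fin_two.mpr ⟨e00, e11⟩⟩
  · simp [normalMatrix, Shape.residual] at e00 e01 e10 e11
    exact ⟨⟨(residue_eq_zero_iff x).mpr e11, (residue_eq_zero_iff y).mpr e00⟩,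
      Fin.forall_fin_two.mpr ⟨hone e01, hone e10⟩⟩
  · simp [normalMatrix, Shape.residual] at e00 e01 e10 e11
    rw [hone e10, map_one, one_mul] at e11
    exact ⟨⟨C_injective e11, (residue_eq_zero_iff y).mpr e00⟩,
      Fin.forall_fin_two.mpr ⟨hone e01, hone e10⟩⟩

/-- For shape three `x` is a unit because `c ≠ 0`, so `x y = p` determines `y`. The value `y' = 0`
for shapes one and three is a dummy. -/
theorem exists_lifted_eq {p : ℕ} {b x y : R} {c : ResidueField R} (hb : residue R b = c)
    (hc : σ = .three → c ≠ 0) (h : σ.Relation (p : R) x y) (hr : σ.IsResidue c x y) :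
    ∃ x' ∈ maximalIdeal R, ∃ y' ∈ maximalIdeal R, (σ = .two → x' * y' = (p : R)) ∧
      σ.lifted p b x' y' = normalMatrix (p : R) σ x y := by
  have hsub : residue R x = c → x - b ∈ maximalIdeal R := fun h => by
    rw [← residue_eq_zero_iff, map_sub, h, hb, sub_self]
  cases σ
  · exact ⟨x - b, hsub hr, 0, zero_mem _, by simp, by simp [Shape.lifted, normalMatrix]⟩
  · exact ⟨x, (residue_eq_zero_iff x).mp hr.1, y, (residue_eq_zero_iff y).mp hr.2, fun _ => h, rfl⟩
  · refine ⟨x - b, hsub hr.1, 0, zero_mem _, by simp, ?_⟩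
    have hx : IsUnit x := by
      rw [← residue_ne_zero_iff_isUnit, hr.1]
      exact hc rfl
    have hy : -(p : R) * Ring.inverse x = -y := by
      change x * y = p at h
      rw [← h]
      linear_combination -y * Ring.mul_inverse_cancel x hx
    simp only [Shape.lifted, normalMatrix, sub_add_cancel, hy]

theorem exists_eq_lifted {p : ℕ} {b x' y' : R} {c : ResidueField R} (hb : residue R b = c)
    (hc : σ = .three → c ≠ 0) (hx' : x' ∈ maximalIdeal R) (h : σ = .two → x' * y' = (p : R)) :
    ∃ x y, σ.Relation (p : R) x y ∧ σ.lifted p b x' y' = normalMatrix (p : R) σ x y := by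
  cases σ
  · exact ⟨x' + b, 0, trivial, rfl⟩
  · exact ⟨x', y', h rfl, rfl⟩
  · have hx : IsUnit (x' + b) := by
      rw [← residue_ne_zero_iff_isUnit, map_add, (residue_eq_zero_iff x').mpr hx', zero_add, hb]
      exact hc rfl
    refine ⟨x' + b, p * Ring.inverse (x' + b), ?_, by simp [Shape.lifted, normalMatrix]⟩
    change _ = _
    linear_combination (p : R) * Ring.mul_inverse_cancel _ hx

end NormalForm

/-! ### Transport of diagonal factors around the cycle `ℤ/f`. -/

section Cycle

variable {p f : ℕ} {R : Type*} [CommRing R] [IsLocalRing R]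
  {τ : ZMod f → Equiv.Perm (Fin 2)} {e : ZMod f → Fin 2 → Fin 2 → ℕ}
  {σ : ZMod f → Shape}

theorem twist_eq {S : Type*} [CommRing S] (i : ZMod f) (A : Matrix (Fin 2) (Fin 2) S⟦X⟧)
    (d : Fin 2 → S) : twist i A (d 0) (d 1) =
      A * Matrix.diagonal fun l => C (if i = 0 then d l else 1) := by
  have : ∀ d : Fin 2 → S⟦X⟧, Matrix.diagonal d = !![d 0, 0; 0, d 1] := fun d => by
    refine Matrix.ext fun i j => ?_
    fin_cases i <;> fin_cases j <;> simp
  rw [twist]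
  split_ifs
  · rw [this]
  · simp

theorem isNormal_twist_lifted {b : ZMod f → R} {c : ZMod f → ResidueField R}
    (hb : ∀ i, residue R (b i) = c i) (hc : ∀ i, σ i = .three → c i ≠ 0) {x y : ZMod f → R}
    (hx : ∀ i, x i ∈ maximalIdeal R) (hxy : ∀ i, σ i = Shape.two → x i * y i = (p : R))
    {d d' : R} (hd : IsUnit d) (hd' : IsUnit d') (i : ZMod f) :
    IsNormal (p : R) (σ i) (twist i ((σ i).lifted p (b i) (x i) (y i)) d d') := by
  obtain ⟨u, rfl⟩ := hd
  obtain ⟨u', rfl⟩ := hd'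
  obtain ⟨z, z', hz, h⟩ := exists_eq_lifted (hb i) (hc i) (hx i) (hxy i)
  rw [h]
  have := twist_eq i (normalMatrix (p : R) (σ i) z z') fun l => ((![u, u'] : Fin 2 → Rˣ) l : R)
  have h2 := isNormal_normalMatrix_mul hz fun l => if i = 0 then (![u, u'] : Fin 2 → Rˣ) l else 1
  convert h2 using 1
  refine this.trans ?_
  congr 2
  funext l
  split_ifs <;> simp

theorem val_sub_one_add_one [NeZero f] {i : ZMod f} (hi : i ≠ 0) : (i - 1).val + 1 = i.val := by
  have h1 : (((i - 1).val + 1 : ℕ) : ZMod f) = i := by simp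
  have h2 := ZMod.val_lt (i - 1)
  have h3 := congrArg ZMod.val h1
  rw [ZMod.val_natCast] at h3
  by_cases h : (i - 1).val + 1 < f
  · rwa [Nat.mod_eq_of_lt h] at h3
  · refine absurd ?_ hi
    rw [← h1, show (i - 1).val + 1 = f by omega, ZMod.natCast_self]

variable [Fact p.Prime] [NeZero f] [IsAdicComplete (maximalIdeal R) R]

/-- The twisted fixed point gives normal forms up to diagonal factors. Away from `0`, such a factor
is moved to the left of the normal form and absorbed into the basis at the next index; after a full
turn everything is collected at `0`. -/
theorem exists_normalForm_twisted_conj (hT : ∀ i, IsGenericTwist (τ i) (e i)) (hp3 : 3 ≤ p)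
    (hw : (p : R) ∈ maximalIdeal R) {B : ZMod f → Matrix (Fin 2) (Fin 2) R⟦X⟧} {h : ZMod f → R⟦X⟧}
    (hB : ∀ i, X ∣ B i 1 0) (hh : ∀ i, IsUnit (h i))
    (hdet : ∀ i, (B i).det * h i = X + C (p : R)) {b : ZMod f → R} {c : ZMod f → ResidueField R}
    (hb : ∀ i, residue R (b i) = c i) (hc : ∀ i, σ i = .three → c i ≠ 0)
    {a : Fin 2 → R} {α : Fin 2 → ResidueField R} (ha : ∀ l, residue R (a l) = α l)
    (hα : ∀ l, α l ≠ 0)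
    (hres : ∀ i, (B i).map (PowerSeries.map (residue R)) =
      twist i ((σ i).residual (c i)) (α 0) (α 1)) :
    ∃ (K : ZMod f → Matrix (Fin 2) (Fin 2) R⟦X⟧) (x y : ZMod f → R) (z : Fin 2 → R),
      (∀ i, (K i).map (PowerSeries.map (residue R)) = 1) ∧
      (∀ i, x i ∈ maximalIdeal R) ∧ (∀ i, y i ∈ maximalIdeal R) ∧ (∀ l, z l ∈ maximalIdeal R) ∧
      (∀ i, σ i = Shape.two → x i * y i = (p : R)) ∧
      ∀ i, iwahori (K (i + 1)) *
        twist i ((σ i).lifted p (b i) (x i) (y i)) (a 0 + z 0) (a 1 + z 1) =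
        B i * twistedFrob p (τ i) (e i) (K i) := by
  obtain ⟨K, N, hKN⟩ := exists_isNormal_twisted_conj (B := B) (c := c) (σ := σ) hT hp3 hw hB hh hdet
    (α := fun i => if i = 0 then α 0 else 1) (α' := fun i => if i = 0 then α 1 else 1)
    (fun i => by split_ifs; exacts [hα 0, one_ne_zero])
    (fun i => by split_ifs; exacts [hα 1, one_ne_zero])
    (fun i => by
      rw [hres i, twist]
      split_ifs
      · rfl
      · rw [map_one, ← Matrix.one_fin_two, Matrix.mul_one])
  have hNres : ∀ i, (N i).map (PowerSeries.map (residue R)) =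
      (B i).map (PowerSeries.map (residue R)) := fun i =>
    map_eq_of_iwahori_mul_eq (hKN i).2.2 (map_iwahori_eq_one (hKN _).1.map_eq_one)
      (map_twistedFrob_eq_one (hT i) (hKN i).1.map_eq_one)
  have hdiag : ∀ {t : Fin 2 → Rˣ} {ρ : Equiv.Perm (Fin 2)}, (∀ l, residue R (t l) = 1) →
      (Matrix.diagonal fun l => C (t (ρ l) : R)).map (PowerSeries.map (residue R)) = 1 := by
    intro t ρ ht
    rw [Matrix.diagonal_map (map_zero _), ← Matrix.diagonal_one]
    congr 1
    funext l
    simp [ht]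
  have hNt : ∀ i (t : Fin 2 → Rˣ),
      IsNormal (p : R) (σ i) (N i * Matrix.diagonal fun l => C (t (τ i l) : R)) := fun i t => by
    have := (hKN i).2.1.diagonal_mul_mul_diagonal (t := fun _ => 1) (t' := fun l => (t (τ i l) : R))
      (fun _ => isUnit_one) (fun l => (t _).isUnit)
    simpa using this
  have hleft : ∀ i (t : Fin 2 → Rˣ), ∃ (x y : R) (t' : Fin 2 → Rˣ), (σ i).Relation (p : R) x y ∧
      N i * Matrix.diagonal (fun l => C (t (τ i l) : R)) =
      Matrix.diagonal (fun l => C (t' l : R)) * normalMatrix (p : R) (σ i) x y := by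
    intro i t
    obtain ⟨x, y, t', h1, h2⟩ := (hNt i t).exists_eq_normalMatrix_mul
    obtain ⟨x', y', t'', h3, h4⟩ := exists_normalMatrix_mul_eq h1 t'
    exact ⟨x', y', t'', h3, h2.trans h4⟩
  choose x y T hrel hT' using hleft
  -- `S n` is the diagonal correction at index `n + 1`: it starts with `1` at index `1` and is
  -- propagated by `T`.
  let S : ℕ → Fin 2 → Rˣ := fun n => Nat.rec 1 (fun n t => T ((n : ZMod f) + 1) t) n
  have hleftres : ∀ i t, i ≠ 0 → (∀ l, residue R (t l : R) = 1) →
      (σ i).IsResidue (c i) (x i t) (y i t) ∧ ∀ l, residue R (T i t l) = 1 := by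
    intro i t hi ht
    refine isResidue_of_map_diagonal_mul_eq hw ?_
    -- Away from `0` the residual matrix carries no diagonal factor, which forces `T i t` to reduce
    -- to `1`.
    rw [← hT', Matrix.map_mul, hdiag ht, Matrix.mul_one, hNres, hres, twist, if_neg hi]
  have hSres : ∀ n, n < f → ∀ l, residue R (Units.val (S n l)) = 1 := by
    intro n
    induction n with
    | zero => exact fun _ l => map_one _
    | succ n ih =>
      intro hn
      refine (hleftres _ _ ?_ (ih (by omega))).2
      rw [← Nat.cast_succ, Ne, ZMod.natCast_eq_zero_iff]
      exact Nat.not_dvd_of_pos_of_lt n.succ_pos hn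
  let t : ZMod f → Fin 2 → Rˣ := fun j => S (j - 1).val
  have ht : ∀ j l, residue R (Units.val (t j l)) = 1 := fun j => hSres _ (ZMod.val_lt _)
  have ht1 : t (0 + 1) = 1 := by
    simp only [t, zero_add, sub_self, ZMod.val_zero]
    rfl
  have htsucc : ∀ i, i ≠ 0 → t (i + 1) = T i (t i) := fun i hi => by
    simp only [t, add_sub_cancel_right]
    rw [← val_sub_one_add_one hi]
    change T (((i - 1).val : ZMod f) + 1) _ = _
    rw [ZMod.natCast_zmod_val, sub_add_cancel]
  -- The cycle closes at `0`: here the diagonal factor `d` stays on the right and reduces to `(α,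
  -- α')`.
  obtain ⟨x₀, y₀, d, hrel₀, hd⟩ := (hNt 0 (t 0)).exists_eq_normalMatrix_mul
  have hres₀ := isResidue_of_map_eq (c := c 0) hw hα (by
    rw [← hd, Matrix.map_mul, hdiag (ht 0), Matrix.mul_one, hNres, hres, twist_eq]
    simp)
  have hnf : ∀ i, ∃ x ∈ maximalIdeal R, ∃ y ∈ maximalIdeal R, (σ i = .two → x * y = (p : R)) ∧
      iwahori (K (i + 1) * Matrix.diagonal fun l => C (Units.val (t (i + 1) l))) *
        twist i ((σ i).lifted p (b i) x y) (d 0) (d 1) =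
      B i * twistedFrob p (τ i) (e i) (K i * Matrix.diagonal fun l => C (Units.val (t i l))) := by
    intro i
    have hright : B i * twistedFrob p (τ i) (e i) (K i * Matrix.diagonal fun l => C (Units.val (t i l))) =
        iwahori (K (i + 1)) * (N i * Matrix.diagonal fun l => C (Units.val (t i (τ i l)))) := by
      rw [twistedFrob_mul_diagonal, ← Matrix.mul_assoc, ← (hKN i).2.2, Matrix.mul_assoc]
    by_cases hi : i = 0
    · subst hi
      obtain ⟨x, hx, y, hy, hxy, hl⟩ := exists_lifted_eq (hb 0) (hc 0) hrel₀ hres₀.1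
      refine ⟨x, hx, y, hy, hxy, ?_⟩
      rw [hright, hd, ht1, twist_eq 0 _ fun l => (d l : R), hl]
      simp
    · obtain ⟨x, hx, y, hy, hxy, hl⟩ := exists_lifted_eq (hb i) (hc i) (hrel i (t i))
        (hleftres i (t i) hi (ht i)).1
      refine ⟨x, hx, y, hy, hxy, ?_⟩
      rw [hright, hT', twist, if_neg hi, hl, iwahori_mul_diagonal, Matrix.mul_assoc, htsucc i hi]
  choose x hx y hy hxy hfin using hnf
  refine ⟨fun i => K i * Matrix.diagonal fun l => C (Units.val (t i l)), x, y, fun l => d l - a l,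
    fun i => ?_, hx, hy, fun l => ?_, hxy, fun i => ?_⟩
  · rw [Matrix.map_mul, (hKN i).1.map_eq_one, Matrix.one_mul]
    exact hdiag (ρ := 1) (ht i)
  · rw [← residue_eq_zero_iff, map_sub, hres₀.2, ha, sub_self]
  · simpa using hfin i

end Cycle

end KisinGL2

end

noncomputable section

namespace KisinGL2

/-! ## Exponents of a generic principal series type -/

section Exponents

variable {p f : ℕ} {a : Exponents f}
  {s : ZMod f → Equiv.Perm (Fin 2)}

theorem one_lt_card [hp : Fact p.Prime] [hf : NeZero f] : 1 < p ^ f := Nat.one_lt_pow hf.out hp.out.one_lt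

/-- Multiplication by `p` rotates the base-`p` digits; the top digit, of index `-(j + 1)`, wraps
around from weight `p ^ f` to weight `1`. -/
theorem Exponents.mul_shifted [hf : NeZero f] (a : Exponents f) (p : ℕ) (κ : Fin 2) (j : ZMod f) :
    (p : ℤ) * a.shifted p κ j = a.shifted p κ (j + 1) + ((p : ℤ) ^ f - 1) * a κ (-(j + 1)) := by
  obtain ⟨n, hn⟩ := Nat.exists_eq_succ_of_ne_zero hf.out
  have hsum : ∀ F : ℕ → ℤ, ∑ i ∈ Finset.range f, F i = ∑ i ∈ Finset.range (n + 1), F i :=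
    fun F => by rw [hn]
  have hpow : (p : ℤ) ^ f = p ^ n * p := by rw [hn, pow_succ]
  have h1 : a.shifted p κ (j + 1) =
      a κ (-(j + 1)) + p * ∑ i ∈ Finset.range n, a κ (-j + (i : ZMod f)) * (p : ℤ) ^ i := by
    rw [Exponents.shifted, hsum, Finset.sum_range_succ', Finset.mul_sum, add_comm]
    congr 1
    · simp
    · refine Finset.sum_congr rfl fun i _ => ?_
      rw [show -(j + 1) + ((i + 1 : ℕ) : ZMod f) = -j + i by push_cast; ring]
      ring
  have h2 : a.shifted p κ j = ∑ i ∈ Finset.range n, a κ (-j + (i : ZMod f)) * (p : ℤ) ^ i +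
      a κ (-(j + 1)) * (p : ℤ) ^ n := by
    rw [Exponents.shifted, hsum, Finset.sum_range_succ]
    have : (n : ZMod f) = -1 := by
      have h3 : ((n.succ : ℕ) : ZMod f) = 0 := by rw [← hn]; simp
      rw [Nat.cast_succ] at h3
      linear_combination h3
    rw [show -j + (n : ZMod f) = -(j + 1) by rw [this]; ring]
  rw [h1, h2, hpow]
  ring

theorem Exponents.IsGeneric.five_le (ha : a.IsGeneric p) : 5 ≤ p := by
  have := ha 0
  omega

/-- Digitwise the difference is at most `(p - 3)(1 + ⋯ + p^{f-1})`, which is less than `(p - 1)(1 +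
⋯ + p^{f-1}) = p^f - 1`. -/
theorem Exponents.IsGeneric.abs_shifted_sub_lt [hf : NeZero f] (ha : a.IsGeneric p) (j : ZMod f) :
    |a.shifted p 0 j - a.shifted p 1 j| < (p : ℤ) ^ f - 1 := by
  have h5 := ha.five_le
  have h1 : |a.shifted p 0 j - a.shifted p 1 j| ≤
      ((p : ℤ) - 3) * ∑ i ∈ Finset.range f, (p : ℤ) ^ i := by
    rw [Exponents.shifted, Exponents.shifted, ← Finset.sum_sub_distrib, Finset.mul_sum]
    refine (Finset.abs_sum_le_sum_abs _ _).trans (Finset.sum_le_sum fun i _ => ?_)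
    rw [← sub_mul, abs_mul, abs_of_nonneg (by positivity : (0 : ℤ) ≤ (p : ℤ) ^ i)]
    exact mul_le_mul_of_nonneg_right (ha _).2 (by positivity)
  have h2 := mul_geom_sum (p : ℤ) f
  have h3 : (0 : ℤ) < ∑ i ∈ Finset.range f, (p : ℤ) ^ i :=
    Finset.sum_pos (fun i _ => by positivity) ⟨0, Finset.mem_range.mpr (Nat.pos_of_ne_zero hf.out)⟩
  linarith

/-- The smallest degree of a monomial in the coefficient at `f_{s_j(m)}` of a vector on which `Δ`
acts as on `f_{s_j(l)}`. -/
def Exponents.lowDegree (a : Exponents f) (p : ℕ) (s : ZMod f → Equiv.Perm (Fin 2))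
    (j : ZMod f) (m l : Fin 2) : ℕ :=
  if m = l then 0 else if m = 0 then a.gap p s j 0 else p ^ f - 1 - a.gap p s j 0

theorem Exponents.IsOrientation.coe_gap (hs : a.IsOrientation p s) (j : ZMod f) (l : Fin 2) :
    (a.gap p s j l : ℤ) = a.shifted p (s j l) j - a.shifted p (s j 1) j := by
  have := hs j
  rw [Exponents.gap, Int.toNat_of_nonneg]
  fin_cases l
  · simpa using this.le
  · simp

theorem Exponents.IsOrientation.gap_one (hs : a.IsOrientation p s) (j : ZMod f) :
    a.gap p s j 1 = 0 := by
  zify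
  rw [hs.coe_gap, sub_self]

theorem Exponents.IsOrientation.gap_pos (hs : a.IsOrientation p s) (j : ZMod f) :
    0 < a.gap p s j 0 := by
  zify
  rw [hs.coe_gap]
  exact sub_pos.mpr (hs j)

variable [hp : Fact p.Prime] [hf : NeZero f]

theorem Exponents.gap_lt (ha : a.IsGeneric p) (hs : a.IsOrientation p s) (j : ZMod f) (l : Fin 2) :
    a.gap p s j l < p ^ f - 1 := by
  have h := ha.abs_shifted_sub_lt j
  have h1 := (one_lt_card : 1 < p ^ f)
  zify [h1.le]
  rw [hs.coe_gap]
  refine lt_of_le_of_lt (le_abs_self _) ?_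
  generalize s j l = x
  generalize s j 1 = y
  fin_cases x <;> fin_cases y
  · simpa using (by exact_mod_cast h1 : (1 : ℤ) < (p : ℤ) ^ f)
  · exact h
  · rw [abs_sub_comm]; exact h
  · simpa using (by exact_mod_cast h1 : (1 : ℤ) < (p : ℤ) ^ f)

theorem Exponents.coe_lowDegree (ha : a.IsGeneric p) (hs : a.IsOrientation p s) (j : ZMod f)
    (m l : Fin 2) : (a.lowDegree p s j m l : ℤ) = a.shifted p (s j m) j - a.shifted p (s j l) j +
      ((p : ℤ) ^ f - 1) * if m = 1 ∧ l = 0 then 1 else 0 := by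
  have h0 := Exponents.gap_lt ha hs j 0
  have h1 := hs.coe_gap j 0
  have h2 : ((p ^ f - 1 - a.gap p s j 0 : ℕ) : ℤ) = (p : ℤ) ^ f - 1 - a.gap p s j 0 := by
    have h1 := (one_lt_card : 1 < p ^ f)
    push_cast [h0.le, h1.le]
    rfl
  rw [Exponents.lowDegree]
  fin_cases m <;> fin_cases l
  · simp
  · simpa using h1
  · simp only [Fin.mk_one, Fin.zero_eta, one_ne_zero, if_false, and_self, if_true, h2, h1]
    ring
  · simp

theorem Exponents.lowDegree_lt (ha : a.IsGeneric p) (hs : a.IsOrientation p s) (j : ZMod f)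
    (m l : Fin 2) : a.lowDegree p s j m l < p ^ f - 1 := by
  have h0 := Exponents.gap_lt ha hs j 0
  have h1 := hs.gap_pos j
  rw [Exponents.lowDegree]
  split_ifs <;> omega

theorem Exponents.lowDegree_add_gap (ha : a.IsGeneric p) (hs : a.IsOrientation p s) (j : ZMod f)
    (m l : Fin 2) : a.lowDegree p s j m l + a.gap p s j l =
      a.gap p s j m + (p ^ f - 1) * if m = 1 ∧ l = 0 then 1 else 0 := by
  have h1 := (one_lt_card : 1 < p ^ f)
  zify [h1.le]
  rw [Exponents.coe_lowDegree ha hs, hs.coe_gap, hs.coe_gap]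
  ring

theorem Exponents.exists_isGenericTwist (ha : a.IsGeneric p) (hs : a.IsOrientation p s)
    (i : ZMod f) : ∃ e, IsGenericTwist ((s i)⁻¹ * s (i + 1)) e ∧ ∀ m l,
      a.gap p s (i + 1) m + (p ^ f - 1) * e m l = a.gap p s (i + 1) l +
        p * a.lowDegree p s i (((s i)⁻¹ * s (i + 1)) m) (((s i)⁻¹ * s (i + 1)) l) := by
  set τ := (s i)⁻¹ * s (i + 1) with hτ
  have hsτ : ∀ m, s i (τ m) = s (i + 1) m := fun m => by simp [hτ]
  have hq1 := (one_lt_card : 1 < p ^ f)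
  have hq : (0 : ℤ) < (p : ℤ) ^ f - 1 := by
    have : ((1 : ℕ) : ℤ) < ((p ^ f : ℕ) : ℤ) := by exact_mod_cast hq1
    push_cast at this
    linarith
  have hp5 := ha.five_le
  -- `δ` is the difference of the digits that wrap around between `i` and `i + 1`.
  obtain ⟨δ, hδ⟩ : ∃ δ : ℤ, δ = a (s i 0) (-(i + 1)) - a (s i 1) (-(i + 1)) := ⟨_, rfl⟩
  have hδ' : 2 ≤ |δ| ∧ |δ| ≤ (p : ℤ) - 3 := by
    have h1 := ha (-(i + 1))
    have hne : s i 0 ≠ s i 1 := fun h => absurd ((s i).injective h) (by simp)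
    rw [hδ]
    generalize s i 0 = x at *
    generalize s i 1 = y at *
    fin_cases x <;> fin_cases y <;> simp at hne
    · exact h1
    · rw [abs_sub_comm]; exact h1
  -- The orientation fixes the sign of `δ`: `p` times the positive gap at `i` is `(q - 1) δ` plus a
  -- number less than `q - 1`, so `δ > -1`. Genericity improves `0 ≤ δ` to `2 ≤ δ`.
  have hδ2 : 2 ≤ δ := by
    have h1 := Exponents.mul_shifted a p (s i 0) i
    have h2 := Exponents.mul_shifted a p (s i 1) i
    have h3 := mul_pos (show (0 : ℤ) < p by omega) (sub_pos.mpr (hs i))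
    have h4 : a.shifted p (s i 0) (i + 1) - a.shifted p (s i 1) (i + 1) < (p : ℤ) ^ f - 1 := by
      have h := ha.abs_shifted_sub_lt (i + 1)
      refine lt_of_le_of_lt (le_abs_self _) ?_
      generalize s i 0 = x
      generalize s i 1 = y
      fin_cases x <;> fin_cases y
      · simpa using hq
      · exact h
      · rw [abs_sub_comm]; exact h
      · simpa using hq
    have h5 : 0 < ((p : ℤ) ^ f - 1) * (δ + 1) := by
      rw [hδ]
      linarith
    have h6 := (mul_pos_iff_of_pos_left hq).mp h5
    have h7 : 0 ≤ δ := by omega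
    rw [abs_of_nonneg h7] at hδ'
    exact hδ'.1
  have hδ3 : δ ≤ p - 3 := (le_abs_self _).trans hδ'.2
  -- The bounds `2 ≤ δ ≤ p - 3` of genericity give exactly `δ ≥ 2` for upper entries and `p - δ ≥ 3`
  -- for lower ones.
  let e : Fin 2 → Fin 2 → ℕ := fun m l => if m = l then 0 else
    if τ m = 0 then δ.toNat else (p - δ).toNat
  have he : ∀ m l, (e m l : ℤ) = a (s (i + 1) m) (-(i + 1)) - a (s (i + 1) l) (-(i + 1)) +
      p * if τ m = 1 ∧ τ l = 0 then 1 else 0 := by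
    intro m l
    by_cases hml : m = l
    · subst hml
      have : ¬(τ m = 1 ∧ τ m = 0) := fun h => by
        rw [h.1] at h
        simp at h
      simp [e, this]
    · have hne : τ m ≠ τ l := fun h => hml (τ.injective h)
      simp only [e, if_neg hml, ← hsτ]
      generalize -(i + 1) = k at hδ ⊢
      generalize τ m = x at *
      generalize τ l = y at *
      fin_cases x <;> fin_cases y <;> simp at hne ⊢ <;> omega
  refine ⟨e, ⟨fun m => by simp [e], fun m l h0 h1 => ?_, fun m l h1 h0 => ?_⟩, fun m l => ?_⟩
  · have hml : m ≠ l := fun h => by rw [h, h1] at h0; simp at h0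
    simp only [e, if_neg hml, h0, if_true]
    omega
  · have hml : m ≠ l := fun h => by rw [h, h0] at h1; simp at h1
    simp only [e, if_neg hml, h1, one_ne_zero, if_false]
    omega
  · zify [hq1.le]
    rw [he, Exponents.coe_lowDegree ha hs, hs.coe_gap, hs.coe_gap, hsτ, hsτ]
    have h1 := Exponents.mul_shifted a p (s (i + 1) m) i
    have h2 := Exponents.mul_shifted a p (s (i + 1) l) i
    linear_combination h2 - h1

end Exponents

/-! ## Eigenvectors for the descent datum -/

section Eigen

variable {p : ℕ} [hp : Fact p.Prime] {f : ℕ} [hf : NeZero f] {R : Type*} [CommRing R]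

theorem coeff_vToU (n : ℕ) (g : R⟦X⟧) : coeff n (vToU p f R g) =
    if p ^ f - 1 ∣ n then coeff (n / (p ^ f - 1)) g else 0 :=
  coeff_expand _ _ _

theorem vToU_X : vToU p f R X = X ^ (p ^ f - 1) := expand_X _ _

theorem vToU_C (r : R) : vToU p f R (C r) = C r := expand_C _ _ r

theorem map_vToU {S : Type*} [CommRing S] (g : R →+* S) (h : R⟦X⟧) :
    PowerSeries.map g (vToU p f R h) = vToU p f S (PowerSeries.map g h) :=
  map_expand _ _ g h

theorem vToU_injective : Function.Injective (vToU p f R) := by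
  have hq : 0 < p ^ f - 1 := by have := (one_lt_card : 1 < p ^ f); omega
  intro g h e
  ext n
  have := congrArg (coeff ((p ^ f - 1) * n)) e
  simpa [coeff_vToU, Nat.mul_div_cancel_left _ hq] using this

theorem exists_eq_X_pow_mul_vToU {r : ℕ} (hr : r < p ^ f - 1) {g : R⟦X⟧}
    (h : ∀ n, coeff n g ≠ 0 → (((p ^ f - 1 : ℕ) : ℤ)) ∣ (n : ℤ) - r) :
    ∃ g', g = X ^ r * vToU p f R g' := by
  have hq : 0 < p ^ f - 1 := by omega
  refine ⟨PowerSeries.mk fun k => coeff (r + (p ^ f - 1) * k) g, ?_⟩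
  ext n
  rw [coeff_X_pow_mul']
  split_ifs with hrn
  · rw [coeff_vToU]
    obtain ⟨k, rfl⟩ := Nat.exists_eq_add_of_le hrn
    rw [Nat.add_sub_cancel_left]
    split_ifs with hd
    · obtain ⟨m, rfl⟩ := hd
      rw [Nat.mul_div_cancel_left _ hq, coeff_mk]
    · by_contra hne
      have := h _ hne
      push_cast at this
      rw [add_sub_cancel_left] at this
      exact hd (by exact_mod_cast this)
  · by_contra hne
    have h1 := h n hne
    have h2 : (n : ℤ) - r = 0 := Int.eq_zero_of_abs_lt_dvd h1 (by
      rw [abs_lt]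
      constructor <;> omega)
    omega

variable [Algebra (WittFq p f) R]

theorem omega_pow_card (j : ZMod f) (g : (GaloisField p f)ˣ) :
    omega p f R j g ^ (p ^ f - 1) = 1 := by
  have : g ^ (p ^ f - 1) = 1 := by
    have h : Nat.card (GaloisField p f)ˣ = p ^ f - 1 := by
      rw [Nat.card_units, GaloisField.card p f hf.out]
    rw [← h, pow_card_eq_one']
  rw [← map_pow, this, map_one]

theorem omega_zpow_shifted (a : Exponents f) (κ : Fin 2) (j : ZMod f) (g : (GaloisField p f)ˣ) :
    omega p f R j g ^ a.shifted p κ j = omega p f R 0 g ^ a.shifted p κ 0 := by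
  have hstep : ∀ j : ZMod f, omega p f R (j + 1) g ^ a.shifted p κ (j + 1) =
      omega p f R j g ^ a.shifted p κ j := by
    intro j
    have h1 : ((omega p f R (j + 1) g) ^ ((p : ℤ) ^ f - 1)) = 1 := by
      have h2 := omega_pow_card (R := R) (j + 1) g
      have h3 : ((p ^ f - 1 : ℕ) : ℤ) = (p : ℤ) ^ f - 1 := by
        push_cast [(one_lt_card : 1 < p ^ f).le]
        rfl
      rw [← h3, zpow_natCast, h2]
    rw [← omega_succ_pow p R j g, ← zpow_natCast, ← zpow_mul, Exponents.mul_shifted, zpow_add,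
      zpow_mul, h1, one_zpow, mul_one]
  have : ∀ n : ℕ, omega p f R (n : ZMod f) g ^ a.shifted p κ n =
      omega p f R 0 g ^ a.shifted p κ 0 := by
    intro n
    induction n with
    | zero => rw [Nat.cast_zero]
    | succ n ih => rw [Nat.cast_succ, hstep, ih]
  have h := this j.val
  rwa [ZMod.natCast_zmod_val] at h

theorem eta_eq (a : Exponents f) (κ : Fin 2) (j : ZMod f) (g : (GaloisField p f)ˣ) :
    a.eta p R κ g = omega p f R j g ^ (-(a.shifted p κ j)) := by
  rw [Exponents.eta, zpow_neg, zpow_neg, omega_zpow_shifted a κ j]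

/-- Test on a generator of `𝔽_qˣ`. A Teichmüller element other than `1` differs from `1` by a unit,
so `r ≠ 0` can be exploited although `R` may have zero divisors. The twist by a power of Frobenius
is harmless because `p` is prime to `q - 1`. -/
theorem dvd_of_omega_zpow_mul_eq {j : ZMod f} {n : ℤ} {r : R} (hr : r ≠ 0)
    (h : ∀ g, ((omega p f R j g ^ n : Rˣ) : R) * r = r) : ((p ^ f - 1 : ℕ) : ℤ) ∣ n := by
  obtain ⟨g, hg⟩ := IsCyclic.exists_generator (α := (GaloisField p f)ˣ)
  have hcard : orderOf g = p ^ f - 1 := by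
    rw [orderOf_eq_card_of_forall_mem_zpowers hg, Nat.card_units, GaloisField.card p f hf.out]
  set k := p ^ (-j).val with hk
  have hone : (g ^ k) ^ n = 1 := by
    by_contra hne
    have hu : IsUnit (WittVector.teichmuller p (((g ^ k) ^ n : (GaloisField p f)ˣ) : GaloisField p f)
        - 1) := by
      refine WittVector.isUnit_of_coeff_zero_ne_zero _ ?_
      rw [← WittVector.constantCoeff_apply, map_sub, map_one, sub_ne_zero,
        WittVector.constantCoeff_apply, WittVector.teichmuller_coeff_zero]
      exact fun h => hne (Units.val_eq_one.mp h)
    have h1 := h g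
    have h2 : ((omega p f R j g ^ n : Rˣ) : R) = algebraMap (WittFq p f) R
        (WittVector.teichmuller p (((g ^ k) ^ n : (GaloisField p f)ˣ) : GaloisField p f)) := by
      simp only [omega, MonoidHom.comp_apply, powMonoidHom_apply]
      rw [← map_zpow]
      rfl
    rw [h2, ← sub_eq_zero, ← sub_one_mul, ← map_one (algebraMap (WittFq p f) R), ← map_sub] at h1
    exact hr ((hu.map (algebraMap (WittFq p f) R)).mul_right_eq_zero.mp h1)
  rw [← zpow_natCast, ← zpow_mul, ← orderOf_dvd_iff_zpow_eq_one, hcard] at hone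
  refine IsCoprime.dvd_of_dvd_mul_left ?_ hone
  rw [Nat.isCoprime_iff_coprime, hk]
  refine Nat.Coprime.pow_right _ ?_
  have h1 : Nat.Coprime (p ^ f - 1) (p ^ f) := by
    have h2 := (one_lt_card : 1 < p ^ f)
    have h3 : p ^ f = p ^ f - 1 + 1 := by omega
    nth_rw 2 [h3]
    exact (Nat.coprime_self_add_right).mpr (Nat.coprime_one_right _)
  exact Nat.Coprime.coprime_dvd_right (dvd_pow_self p hf.out) h1

/-- The eigenvector condition allows only degrees congruent to `𝐚_{s_j(m)} - 𝐚_{s_j(l)}` modulo `q -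
1`, and `lowDegree` is the least such degree. -/
theorem exists_eq_X_pow_lowDegree_mul {a : Exponents f} (ha : a.IsGeneric p)
    {s : ZMod f → Equiv.Perm (Fin 2)} (hs : a.IsOrientation p s) {j : ZMod f} {m l : Fin 2}
    {g : R⟦X⟧} (h : ∀ γ, rescale (omega p f R j γ : R) g * C (a.eta p R (s j m) γ : R) =
      C (a.eta p R (s j l) γ : R) * g) :
    ∃ g', g = X ^ a.lowDegree p s j m l * vToU p f R g' := by
  refine exists_eq_X_pow_mul_vToU (Exponents.lowDegree_lt ha hs j m l) fun n hn => ?_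
  have h1 : ((p ^ f - 1 : ℕ) : ℤ) ∣ n - a.shifted p (s j m) j + a.shifted p (s j l) j := by
    refine dvd_of_omega_zpow_mul_eq (j := j) hn fun γ => ?_
    have h2 := congrArg (coeff n) (h γ)
    rw [coeff_mul_C, coeff_rescale, coeff_C_mul, eta_eq a _ j, eta_eq a _ j] at h2
    generalize omega p f R j γ = u at *
    have h3 : u ^ ((n : ℤ) - a.shifted p (s j m) j + a.shifted p (s j l) j) =
        u ^ (a.shifted p (s j l) j) * (u ^ n * u ^ (-(a.shifted p (s j m) j))) := by
      rw [← zpow_natCast, ← zpow_add, ← zpow_add]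
      congr 1
      ring
    have h4 : u ^ (a.shifted p (s j l) j) * u ^ (-(a.shifted p (s j l) j)) = 1 := by
      rw [← zpow_add, add_neg_cancel, zpow_zero]
    have h5 := congrArg Units.val h4
    rw [h3]
    push_cast at h2 h5 ⊢
    linear_combination ((u ^ (a.shifted p (s j l) j) : Rˣ) : R) * h2 + coeff n g * h5
  rw [Exponents.coe_lowDegree ha hs]
  have h6 : ((p ^ f - 1 : ℕ) : ℤ) = (p : ℤ) ^ f - 1 := by
    push_cast [(one_lt_card : 1 < p ^ f).le]
    rfl
  rw [h6] at h1 ⊢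
  rw [← sub_sub, sub_sub_eq_add_sub, add_sub_right_comm]
  exact dvd_sub h1 (Dvd.intro _ rfl)

end Eigen

end KisinGL2

end

noncomputable section

namespace KisinGL2

/-! ## Eigenbases and their matrices -/

section Eigenbases

theorem _root_.Module.Basis.sum_smul_injective {A N ι : Type*} [CommRing A] [AddCommGroup N]
    [Module A N] [Fintype ι] (b : Module.Basis ι A N) {x y : ι → A}
    (h : ∑ m, x m • b m = ∑ m, y m • b m) : x = y := by
  rw [← b.equivFun_symm_apply, ← b.equivFun_symm_apply] at h
  exact b.equivFun.symm.injective h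

variable {p : ℕ} [hp : Fact p.Prime] {f : ℕ} {R : Type*} [CommRing R]

section Frobenius

variable [NeZero f]

theorem frob_vToU (g : R⟦X⟧) : frob p R (vToU p f R g) = vToU p f R (frob p R g) := by
  change expand p _ (expand (p ^ f - 1) _ g) = expand (p ^ f - 1) _ (expand p _ g)
  have h0 : p ^ f - 1 ≠ 0 := Nat.sub_ne_zero_of_lt one_lt_card
  rw [← expand_mul _ hp.out.ne_zero _ h0, ← expand_mul _ h0 _ hp.out.ne_zero]
  congr 2
  exact mul_comm _ _

/-- The exponents of `u` satisfy `lowDegree m l + gap l = gap m`, plus `q - 1` for the lower left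
entry only. That surplus is the extra factor `v` in `iwahori`. -/
theorem sum_iwahori_smul {N : Type*} [AddCommGroup N] [Module R⟦X⟧ N] {a : Exponents f}
    {s : ZMod f → Equiv.Perm (Fin 2)} (ha : a.IsGeneric p) (hs : a.IsOrientation p s) (j : ZMod f)
    (K : Matrix (Fin 2) (Fin 2) R⟦X⟧) (b : Fin 2 → N) (l : Fin 2) :
    (X : R⟦X⟧) ^ a.gap p s j l • ∑ m, (X ^ a.lowDegree p s j m l * vToU p f R (K m l)) • b m =
      ∑ m, vToU p f R (iwahori K m l) • ((X : R⟦X⟧) ^ a.gap p s j m • b m) := by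
  rw [Finset.smul_sum]
  refine Finset.sum_congr rfl fun m _ => ?_
  rw [smul_smul, smul_smul, ← mul_assoc, ← pow_add, add_comm,
    Exponents.lowDegree_add_gap ha hs, pow_add, pow_mul, ← vToU_X, ← map_pow, mul_assoc, ← map_mul,
    mul_comm]
  congr 3
  fin_cases m <;> fin_cases l <;> simp [iwahori]

end Frobenius

variable [Algebra (WittFq p f) R]
  {M : ZMod f → Type*} [∀ j, AddCommGroup (M j)] [∀ j, Module R⟦X⟧ (M j)]
  {𝔐 : KisinModule p f R M} {a : Exponents f} {s : ZMod f → Equiv.Perm (Fin 2)}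

/-- The basis `(f_{s_j(1)}, f_{s_j(2)})` of `𝔐^{(j)}`. -/
def Eigenbasis.oriented (β : Eigenbasis 𝔐 a) (s : ZMod f → Equiv.Perm (Fin 2)) (j : ZMod f) :
    Module.Basis (Fin 2) R⟦X⟧ (M j) :=
  (β.basis j).reindex (s j).symm

theorem Eigenbasis.oriented_apply (β : Eigenbasis 𝔐 a) (j : ZMod f) (m : Fin 2) :
    β.oriented s j m = β.basis j (s j m) := by
  simp [Eigenbasis.oriented]

variable [hf : NeZero f]

theorem Eigenbasis.sum_vToU_smul_injective (β : Eigenbasis 𝔐 a) (j : ZMod f)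
    {x y : Fin 2 → R⟦X⟧}
    (h : ∑ m, vToU p f R (x m) • ((X : R⟦X⟧) ^ a.gap p s j m • β.basis j (s j m)) =
      ∑ m, vToU p f R (y m) • ((X : R⟦X⟧) ^ a.gap p s j m • β.basis j (s j m))) : x = y := by
  simp only [smul_smul, ← β.oriented_apply] at h
  have := (β.oriented s j).sum_smul_injective h
  funext m
  have h1 := congrFun this m
  rw [X_pow_mul.symm, X_pow_mul.symm] at h1
  exact vToU_injective (X_pow_mul_cancel h1)

/-- The eigenbasis `β'` is obtained from `β` by a change of basis with the matrix `K`, in terms of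
the variable `v`. -/
def Eigenbasis.IsChange (β β' : Eigenbasis 𝔐 a) (s : ZMod f → Equiv.Perm (Fin 2)) (j : ZMod f)
    (K : Matrix (Fin 2) (Fin 2) R⟦X⟧) : Prop :=
  ∀ l, β'.basis j (s j l) =
    ∑ m, (X ^ a.lowDegree p s j m l * vToU p f R (K m l)) • β.basis j (s j m)

theorem Eigenbasis.exists_coeff_of_eigenvector (β : Eigenbasis 𝔐 a) (ha : a.IsGeneric p)
    (hs : a.IsOrientation p s) {j : ZMod f} {l : Fin 2} {x : M j}
    (hx : ∀ g, 𝔐.act j g x = C (a.eta p R (s j l) g : R) • x) :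
    ∃ k : Fin 2 → R⟦X⟧,
      x = ∑ m, (X ^ a.lowDegree p s j m l * vToU p f R (k m)) • β.basis j (s j m) := by
  set b := β.oriented s j with hb
  have hrepr := b.sum_equivFun x
  set y := b.equivFun x with hy
  have hex : ∀ m, ∃ k, y m = X ^ a.lowDegree p s j m l * vToU p f R k := by
    intro m
    refine exists_eq_X_pow_lowDegree_mul ha hs fun g => ?_
    have h1 := hx g
    rw [← hrepr, map_sum, Finset.smul_sum] at h1
    simp only [LinearMap.map_smulₛₗ, hb, β.oriented_apply, β.eigen, smul_smul] at h1
    simp only [← β.oriented_apply (s := s)] at h1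
    exact congrFun ((β.oriented s j).sum_smul_injective h1) m
  choose k hk using hex
  refine ⟨k, ?_⟩
  rw [← hrepr]
  refine Finset.sum_congr rfl fun m _ => ?_
  rw [hk, hb, β.oriented_apply]

theorem Eigenbasis.exists_isChange (β β' : Eigenbasis 𝔐 a) (ha : a.IsGeneric p)
    (hs : a.IsOrientation p s) (j : ZMod f) : ∃ K, β.IsChange β' s j K := by
  have := fun l => β.exists_coeff_of_eigenvector ha hs fun g => β'.eigen j (s j l) g
  choose K hK using this
  exact ⟨Matrix.of fun m l => K l m, hK⟩

/-- Frobenius commutes with `Δ`, so it sends `f_κ` to an eigenvector for `η_κ`, whose coefficients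
have the shape governed by `lowDegree`; this also makes the matrix upper triangular modulo `v`. -/
theorem Eigenbasis.exists_hasMatrix (β : Eigenbasis 𝔐 a) (ha : a.IsGeneric p)
    (hs : a.IsOrientation p s) (i : ZMod f) : ∃ B, X ∣ B 1 0 ∧ β.HasMatrix s i B := by
  have := fun l => β.exists_coeff_of_eigenvector (l := l) (x := 𝔐.phi i (β.basis i (s (i + 1) l)))
    ha hs fun g => by
      rw [← 𝔐.phi_act, β.eigen, LinearMap.map_smulₛₗ, frob_C]
  choose K hK using this
  refine ⟨iwahori (Matrix.of fun m l => K l m), by simp [iwahori], fun l => ?_⟩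
  rw [hK, ← sum_iwahori_smul ha hs]
  rfl

theorem Eigenbasis.hasMatrix_iff (ha : a.IsGeneric p) (hs : a.IsOrientation p s)
    {β β' : Eigenbasis 𝔐 a} {i : ZMod f} {e : Fin 2 → Fin 2 → ℕ}
    (he : ∀ m l, a.gap p s (i + 1) m + (p ^ f - 1) * e m l = a.gap p s (i + 1) l +
      p * a.lowDegree p s i (((s i)⁻¹ * s (i + 1)) m) (((s i)⁻¹ * s (i + 1)) l))
    {K K' B N : Matrix (Fin 2) (Fin 2) R⟦X⟧} (hK : β.IsChange β' s i K)
    (hK' : β.IsChange β' s (i + 1) K') (hB : β.HasMatrix s i B) :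
    β'.HasMatrix s i N ↔
      iwahori K' * N = B * twistedFrob p ((s i)⁻¹ * s (i + 1)) e K := by
  set τ := (s i)⁻¹ * s (i + 1) with hτ
  have hsτ : ∀ m, s (i + 1) m = s i (τ m) := fun m => by simp [hτ]
  have hleft : ∀ l, (X : R⟦X⟧) ^ a.gap p s (i + 1) l • 𝔐.phi i (β'.basis i (s (i + 1) l)) =
      ∑ n, vToU p f R ((B * twistedFrob p τ e K) n l) •
        ((X : R⟦X⟧) ^ a.gap p s (i + 1) n • β.basis (i + 1) (s (i + 1) n)) := by
    intro l
    -- The Frobenius matrix orders the basis of `𝔐^{(i)}` by `s_{i+1}`, the change of basis by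
    -- `s_i`; reindexing along `τ` reconciles them.
    have h1 : β'.basis i (s (i + 1) l) = ∑ m, (X ^ a.lowDegree p s i (τ m) (τ l) *
        vToU p f R (K (τ m) (τ l))) • β.basis i (s (i + 1) m) := by
      rw [hsτ l, hK (τ l), ← Equiv.sum_comp τ]
      simp only [hsτ]
    have h2 : ∀ m, (X : R⟦X⟧) ^ a.gap p s (i + 1) l • 𝔐.phi i ((X ^ a.lowDegree p s i (τ m) (τ l) *
        vToU p f R (K (τ m) (τ l))) • β.basis i (s (i + 1) m)) =
        ∑ n, vToU p f R (B n m * twistedFrob p τ e K m l) •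
        ((X : R⟦X⟧) ^ a.gap p s (i + 1) n • β.basis (i + 1) (s (i + 1) n)) := by
      intro m
      have h3 : (X : R⟦X⟧) ^ a.gap p s (i + 1) l * (frob p R) (X ^ a.lowDegree p s i (τ m) (τ l) *
          vToU p f R (K (τ m) (τ l))) =
          vToU p f R (twistedFrob p τ e K m l) * X ^ a.gap p s (i + 1) m := by
        rw [map_mul, map_pow, frob_X, frob_vToU, ← mul_assoc, ← pow_mul, ← pow_add, ← he]
        simp only [twistedFrob, Matrix.of_apply]
        rw [map_mul, map_pow, vToU_X, ← pow_mul, pow_add]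
        ring
      rw [LinearMap.map_smulₛₗ, smul_smul, h3, ← smul_smul, hB m, Finset.smul_sum]
      refine Finset.sum_congr rfl fun n _ => ?_
      rw [smul_smul, ← map_mul, mul_comm]
    rw [h1, map_sum, Finset.smul_sum]
    simp only [h2]
    rw [Finset.sum_comm]
    refine Finset.sum_congr rfl fun n _ => ?_
    rw [← Finset.sum_smul, Matrix.mul_apply, map_sum]
  have hright : ∀ l, ∑ m, vToU p f R (N m l) •
      ((X : R⟦X⟧) ^ a.gap p s (i + 1) m • β'.basis (i + 1) (s (i + 1) m)) =
      ∑ n, vToU p f R ((iwahori K' * N) n l) •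
        ((X : R⟦X⟧) ^ a.gap p s (i + 1) n • β.basis (i + 1) (s (i + 1) n)) := by
    intro l
    have h1 : ∀ m, vToU p f R (N m l) •
        ((X : R⟦X⟧) ^ a.gap p s (i + 1) m • β'.basis (i + 1) (s (i + 1) m)) =
        ∑ n, vToU p f R (iwahori K' n m * N m l) •
        ((X : R⟦X⟧) ^ a.gap p s (i + 1) n • β.basis (i + 1) (s (i + 1) n)) := by
      intro m
      rw [hK' m, sum_iwahori_smul ha hs, Finset.smul_sum]
      refine Finset.sum_congr rfl fun n _ => ?_
      rw [smul_smul, ← map_mul, mul_comm]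
    simp only [h1]
    rw [Finset.sum_comm]
    refine Finset.sum_congr rfl fun n _ => ?_
    rw [← Finset.sum_smul, Matrix.mul_apply, map_sum]
  constructor
  · intro h
    refine Matrix.ext fun m l => ?_
    have h1 := h l
    rw [hleft, hright] at h1
    exact (congrFun (β.sum_vToU_smul_injective (i + 1) h1) m).symm
  · intro h l
    rw [hleft, hright, h]

/-- The two off-diagonal exponents of `u` add up to `q - 1`, so the determinant over `R⟦u⟧` is that
of `iwahori (K j)` at `v = u^{q-1}`. -/
theorem Eigenbasis.exists_change (β : Eigenbasis 𝔐 a) (ha : a.IsGeneric p)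
    (hs : a.IsOrientation p s) {K : ZMod f → Matrix (Fin 2) (Fin 2) R⟦X⟧}
    (hK : ∀ j, IsUnit (iwahori (K j)).det) :
    ∃ β' : Eigenbasis 𝔐 a, ∀ j, β.IsChange β' s j (K j) := by
  let P : ZMod f → Matrix (Fin 2) (Fin 2) R⟦X⟧ := fun j =>
    Matrix.of fun m l => X ^ a.lowDegree p s j m l * vToU p f R (K j m l)
  have hP : ∀ j, IsUnit (P j).det := fun j => by
    have hlow : (X : R⟦X⟧) ^ a.lowDegree p s j 0 1 * X ^ a.lowDegree p s j 1 0 =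
        vToU p f R X := by
      rw [vToU_X, ← pow_add]
      congr 1
      have h1 := Exponents.lowDegree_add_gap ha hs j 0 1
      have h2 := Exponents.lowDegree_add_gap ha hs j 1 0
      simp only [hs.gap_one] at h1 h2
      simp at h1 h2
      omega
    have h0 : ∀ m, a.lowDegree p s j m m = 0 := fun m => by simp [Exponents.lowDegree]
    have : (P j).det = vToU p f R (iwahori (K j)).det := by
      rw [Matrix.det_fin_two, Matrix.det_fin_two]
      simp only [P, iwahori, Matrix.of_apply, Matrix.cons_val', Matrix.cons_val_zero,
        Matrix.cons_val_one, Matrix.cons_val_fin_one, map_sub, map_mul, h0]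
      linear_combination (-(vToU p f R (K j 0 1)) * vToU p f R (K j 1 0)) * hlow
    rw [this]
    exact (hK j).map _
  let b : ∀ j, Module.Basis (Fin 2) R⟦X⟧ (M j) := fun j =>
    ((β.oriented s j).map (Matrix.toLinearEquiv (β.oriented s j) (P j) (hP j))).reindex (s j)
  have hb : ∀ j l, b j (s j l) = ∑ m, P j m l • β.basis j (s j m) := fun j l => by
    simp only [b, Module.Basis.reindex_apply, Equiv.symm_apply_apply, Module.Basis.map_apply]
    change Matrix.toLin _ _ _ _ = _
    rw [Matrix.toLin_self]
    simp only [β.oriented_apply]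
  refine ⟨⟨b, fun j κ g => ?_⟩, fun j l => hb j l⟩
  obtain ⟨l, rfl⟩ := (s j).surjective κ
  rw [hb, map_sum, Finset.smul_sum]
  refine Finset.sum_congr rfl fun m _ => ?_
  rw [LinearMap.map_smulₛₗ, β.eigen, smul_smul, smul_smul]
  congr 1
  set ω := omega p f R j g with hω
  have hV : ∀ h : R⟦X⟧, rescale (ω : R) (vToU p f R h) = vToU p f R h := by
    intro h
    ext n
    rw [coeff_rescale, coeff_vToU]
    split_ifs with hd
    · obtain ⟨k, rfl⟩ := hd
      have := congrArg Units.val (omega_pow_card (R := R) j g)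
      rw [Units.val_pow_eq_pow_val, Units.val_one] at this
      rw [pow_mul, this, one_pow, one_mul]
    · simp
  have hη : (ω : R) ^ a.lowDegree p s j m l * (a.eta p R (s j m) g : R) = a.eta p R (s j l) g := by
    rw [eta_eq a _ j, eta_eq a _ j, ← Units.val_pow_eq_pow_val, ← Units.val_mul, ← zpow_natCast,
      ← zpow_add, Exponents.coe_lowDegree ha hs]
    have h1 : ((p ^ f - 1 : ℕ) : ℤ) = (p : ℤ) ^ f - 1 := by
      push_cast [(one_lt_card : 1 < p ^ f).le]
      rfl
    have h2 : ∀ A B D : ℤ, A - B + D + -A = D + -B := fun A B D => by ring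
    rw [← h1, h2, zpow_add, zpow_mul, zpow_natCast, hω, omega_pow_card, one_zpow, one_mul]
  change rescale (ω : R) (X ^ a.lowDegree p s j m l * vToU p f R (K j m l)) * _ =
    _ * (X ^ a.lowDegree p s j m l * vToU p f R (K j m l))
  rw [map_mul, map_pow, rescale_X, hV, ← hη, map_mul, mul_pow, ← map_pow]
  ring

end Eigenbases

end KisinGL2

end

noncomputable section

namespace KisinGL2

/-! ## Reduction of eigenbases -/

section Reduction

variable {p : ℕ} [hp : Fact p.Prime] {f : ℕ} [hf : NeZero f]
  {R : Type*} [CommRing R] [Algebra (WittFq p f) R]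
  {M : ZMod f → Type*} [∀ j, AddCommGroup (M j)] [∀ j, Module R⟦X⟧ (M j)]
  {𝔐 : KisinModule p f R M} {a : Exponents f} {s : ZMod f → Equiv.Perm (Fin 2)}

theorem Eigenbasis.HasMatrix.eq {β : Eigenbasis 𝔐 a} {i : ZMod f}
    {A B : Matrix (Fin 2) (Fin 2) R⟦X⟧} (hA : β.HasMatrix s i A) (hB : β.HasMatrix s i B) :
    A = B :=
  Matrix.ext fun m l =>
    congrFun (β.sum_vToU_smul_injective (i + 1) ((hA l).symm.trans (hB l))) m

variable {R' : Type*} [CommRing R'] [Algebra (WittFq p f) R'] [Algebra R R']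
  [IsScalarTower (WittFq p f) R R']

theorem one_tmul_smul {N : Type*} [AddCommGroup N] [Module R⟦X⟧ N] (r : R⟦X⟧) (m : N) :
    (1 : R'⟦X⟧) ⊗ₜ[R⟦X⟧] (r • m) =
      PowerSeries.map (algebraMap R R') r • ((1 : R'⟦X⟧) ⊗ₜ[R⟦X⟧] m) := by
  rw [TensorProduct.tmul_smul, ← algebraMap_smul R'⟦X⟧ r]
  rfl

theorem baseChange_phi_tmul (j : ZMod f) (c : R'⟦X⟧) (m : M j) :
    (𝔐.baseChange R').phi j (c ⊗ₜ m) = frob p R' c ⊗ₜ 𝔐.phi j m := rfl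

theorem baseChange_act_tmul (j : ZMod f) (g : (GaloisField p f)ˣ) (c : R'⟦X⟧) (m : M j) :
    (𝔐.baseChange R').act j g (c ⊗ₜ m) =
      rescale (omega p f R' j g : R') c ⊗ₜ 𝔐.act j g m := rfl

theorem Eigenbasis.HasMatrix.baseChange {β : Eigenbasis 𝔐 a}
    {β' : Eigenbasis (𝔐.baseChange R') a} (h : β.Lifts β') {i : ZMod f}
    {B : Matrix (Fin 2) (Fin 2) R⟦X⟧} (hB : β.HasMatrix s i B) :
    β'.HasMatrix s i (B.map (PowerSeries.map (algebraMap R R'))) := by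
  intro l
  have h1 := congrArg (fun x => (1 : R'⟦X⟧) ⊗ₜ[R⟦X⟧] x) (hB l)
  simp only [TensorProduct.tmul_sum, one_tmul_smul, map_pow, map_X, map_vToU, h _ _] at h1
  rw [← h i (s (i + 1) l), baseChange_phi_tmul, map_one]
  exact h1

theorem Eigenbasis.IsChange.lifts_iff {β β' : Eigenbasis 𝔐 a}
    {β₀ : Eigenbasis (𝔐.baseChange R') a} (h : β.Lifts β₀)
    {K : ZMod f → Matrix (Fin 2) (Fin 2) R⟦X⟧} (hK : ∀ j, β.IsChange β' s j (K j)) :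
    β'.Lifts β₀ ↔ ∀ j, (K j).map (PowerSeries.map (algebraMap R R')) = 1 := by
  have h1 : ∀ j l, (1 : R'⟦X⟧) ⊗ₜ[R⟦X⟧] β'.basis j (s j l) = ∑ m, (X ^ a.lowDegree p s j m l *
      vToU p f R' (PowerSeries.map (algebraMap R R') (K j m l))) • β₀.oriented s j m := by
    intro j l
    rw [hK j l, TensorProduct.tmul_sum]
    refine Finset.sum_congr rfl fun m _ => ?_
    rw [one_tmul_smul, map_mul, map_pow, map_X, map_vToU, h, Eigenbasis.oriented_apply]
  have h2 : ∀ j l, β₀.basis j (s j l) = ∑ m, (if m = l then 1 else 0 : R'⟦X⟧) •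
      β₀.oriented s j m := by
    intro j l
    simp [Eigenbasis.oriented_apply]
  constructor
  · intro h' j
    refine Matrix.ext fun m l => ?_
    have h3 := congrFun ((β₀.oriented s j).sum_smul_injective
      ((h1 j l).symm.trans ((h' j (s j l)).trans (h2 j l)))) m
    rw [Matrix.map_apply, Matrix.one_apply]
    refine vToU_injective (p := p) (f := f) ?_
    by_cases hml : m = l
    · simpa [hml, Exponents.lowDegree] using h3
    · rw [if_neg hml] at h3 ⊢
      rw [map_zero]
      exact X_pow_mul_cancel (h3.trans (mul_zero _).symm)
  · intro h' j κ
    obtain ⟨l, rfl⟩ := (s j).surjective κ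
    rw [h1, h2]
    refine Finset.sum_congr rfl fun m _ => ?_
    have h3 := congrFun (congrFun (h' j) m) l
    rw [Matrix.map_apply, Matrix.one_apply] at h3
    rw [h3]
    by_cases hml : m = l
    · simp [hml, Exponents.lowDegree]
    · simp [hml]

end Reduction

/-! ## Determinants -/

section Determinant

variable {p : ℕ} [hp : Fact p.Prime] {f : ℕ} [hf : NeZero f] {R : Type*} [CommRing R]

/-- The quotient may be replaced by its part in degrees divisible by `q - 1`: the other degrees
cannot contribute to a product that is a series in `v`. -/
theorem dvd_of_vToU_dvd {g h : R⟦X⟧} (hd : vToU p f R g ∣ vToU p f R h) : g ∣ h := by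
  obtain ⟨k, hk⟩ := hd
  have hq : 0 < p ^ f - 1 := by have := (one_lt_card : 1 < p ^ f); omega
  set q := p ^ f - 1 with hqdef
  refine ⟨PowerSeries.mk fun n => coeff (q * n) k, ?_⟩
  ext n
  have h1 := congrArg (coeff (q * n)) hk
  rw [coeff_vToU, if_pos (dvd_mul_right _ _), ← hqdef, Nat.mul_div_cancel_left _ hq, coeff_mul] at h1
  rw [h1, coeff_mul]
  symm
  refine Finset.sum_of_injOn (fun x => (q * x.1, q * x.2)) ?_ ?_ ?_ ?_
  · intro x _ y _ hxy
    simp only [Prod.mk.injEq, Nat.mul_left_cancel_iff hq] at hxy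
    exact Prod.ext hxy.1 hxy.2
  · intro x hx
    simp only [Finset.mem_coe, Finset.HasAntidiagonal.mem_antidiagonal] at hx ⊢
    rw [← mul_add, hx]
  · intro x hx hx'
    rw [coeff_vToU, ← hqdef]
    split_ifs with hd
    · exfalso
      refine hx' ?_
      rw [Finset.HasAntidiagonal.mem_antidiagonal] at hx
      obtain ⟨c, hc⟩ := hd
      obtain ⟨d, hd⟩ : q ∣ x.2 := (Nat.dvd_add_right ⟨c, hc⟩).mp (hx ▸ dvd_mul_right q n)
      refine ⟨(c, d), ?_, Prod.ext hc.symm hd.symm⟩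
      simp only [Finset.mem_coe, Finset.HasAntidiagonal.mem_antidiagonal]
      rw [hc, hd, ← mul_add] at hx
      exact Nat.eq_of_mul_eq_mul_left hq hx
    · simp
  · intro x _
    simp only [coeff_mk]
    rw [coeff_vToU, ← hqdef, if_pos (dvd_mul_right _ _), Nat.mul_div_cancel_left _ hq]

variable [Algebra (WittFq p f) R]
  {M : ZMod f → Type*} [∀ j, AddCommGroup (M j)] [∀ j, Module R⟦X⟧ (M j)]
  {𝔐 : KisinModule p f R M} {a : Exponents f} {s : ZMod f → Equiv.Perm (Fin 2)}

theorem Eigenbasis.HasMatrix.det_dvd (hs : a.IsOrientation p s) (h𝔐 : 𝔐.MemY a)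
    {β : Eigenbasis 𝔐 a} {i : ZMod f} {B : Matrix (Fin 2) (Fin 2) R⟦X⟧}
    (hB : β.HasMatrix s i B) : B.det ∣ X + C (p : R) := by
  set b : Module.Basis (Fin 2) R⟦X⟧ (M i) := (β.basis i).reindex (s (i + 1)).symm with hb
  set b' := β.oriented s (i + 1) with hb'
  have hbl : ∀ l, b l = β.basis i (s (i + 1) l) := fun l => by simp [hb]
  set P : Matrix (Fin 2) (Fin 2) R⟦X⟧ := b'.toMatrix fun l => 𝔐.phi i (b l) with hP
  have hPsum : ∀ l, 𝔐.phi i (b l) = ∑ m, P m l • b' m := fun l =>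
    (b'.sum_toMatrix_smul_self (fun l => 𝔐.phi i (b l)) l).symm
  have hPB : ∀ m l, X ^ a.gap p s (i + 1) l * P m l =
      vToU p f R (B m l) * X ^ a.gap p s (i + 1) m := by
    intro m l
    have h1 := hB l
    simp only [← hbl l, hPsum, Finset.smul_sum, smul_smul, ← β.oriented_apply] at h1
    exact congrFun (b'.sum_smul_injective h1) m
  -- `P` and `B` are conjugate by `diag(u^d, 1)`, up to the substitution `v = u^{q-1}`.
  have hdet : P.det = vToU p f R B.det := by
    have e00 := hPB 0 0
    have e01 := hPB 0 1
    have e10 := hPB 1 0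
    have e11 := hPB 1 1
    simp only [hs.gap_one, pow_zero, one_mul, mul_one] at e00 e01 e10 e11
    have e00' := X_pow_mul_cancel (e00.trans X_pow_mul.symm)
    rw [Matrix.det_fin_two, Matrix.det_fin_two, map_sub, map_mul, map_mul, e00', e01, e11]
    linear_combination (-(vToU p f R (B 0 1))) * e10
  refine dvd_of_vToU_dvd (p := p) (f := f) ?_
  rw [← hdet]
  have hE : vToU p f R (X + C (p : R)) = eisenstein p f R := by
    rw [map_add, vToU_X, vToU_C, eisenstein]
  rw [hE, ← Ideal.mem_span_singleton]
  -- The determinant form of `b'` sends the generator of `⋀²` to `1` and the image of Frobenius into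
  -- the ideal generated by `det P`, so the cokernel condition says that `det P` divides `E(u)`.
  set L := exteriorPower.alternatingMapLinearEquiv (R := R⟦X⟧) (n := 2) b'.det with hL
  have hmem := h𝔐.coker_det i (exteriorPower.ιMulti R⟦X⟧ 2 b')
  have hle : Submodule.span R⟦X⟧ (Set.range fun xy : M i × M i =>
      exteriorPower.ιMulti R⟦X⟧ 2 ![𝔐.phi i xy.1, 𝔐.phi i xy.2]) ≤
      Submodule.comap L (Ideal.span {P.det}) := by
    rw [Submodule.span_le]
    rintro _ ⟨xy, rfl⟩
    change L _ ∈ Ideal.span {P.det}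
    rw [hL, exteriorPower.alternatingMapLinearEquiv_apply_ιMulti, Module.Basis.det_apply]
    set z : Fin 2 → M i := ![xy.1, xy.2] with hz
    have h1 : b'.toMatrix ![𝔐.phi i xy.1, 𝔐.phi i xy.2] =
        P * Matrix.of fun l k => frob p R (b.repr (z k) l) := by
      refine Matrix.ext fun m k => ?_
      have h2 : (![𝔐.phi i xy.1, 𝔐.phi i xy.2] : Fin 2 → M (i + 1)) k = 𝔐.phi i (z k) := by
        fin_cases k <;> rfl
      rw [Module.Basis.toMatrix_apply, h2]
      conv_lhs => rw [← b.sum_repr (z k)]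
      simp only [map_sum, LinearMap.map_smulₛₗ, Matrix.mul_apply, Matrix.of_apply, map_smul,
        Finsupp.coe_finsetSum, Finset.sum_apply, Finsupp.smul_apply, smul_eq_mul]
      refine Finset.sum_congr rfl fun l _ => ?_
      rw [mul_comm, hP, Module.Basis.toMatrix_apply]
    rw [h1, Matrix.det_mul]
    exact Ideal.mul_mem_right _ _ (Ideal.mem_span_singleton_self _)
  have h1 := hle hmem
  change L _ ∈ Ideal.span {P.det} at h1
  rw [map_smul, hL, exteriorPower.alternatingMapLinearEquiv_apply_ιMulti, Module.Basis.det_self,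
    smul_eq_mul, mul_one] at h1
  exact h1

end Determinant

/-! ## Lifting eigenbases -/

section Lifting

variable {p : ℕ} [hp : Fact p.Prime] {f : ℕ} [hf : NeZero f]
  {R : Type*} [CommRing R] [IsLocalRing R] [Algebra (WittFq p f) R]
  {M : ZMod f → Type*} [∀ j, AddCommGroup (M j)] [∀ j, Module R⟦X⟧ (M j)]
  {𝔐 : KisinModule p f R M} {a : Exponents f}

/-- Any lift is projected to the `η_κ`-eigenspace by averaging over `Δ`, whose order `q - 1` is
invertible in `R`. The projection fixes the given eigenvector modulo the maximal ideal. -/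
theorem exists_eigenvector_lift (hpm : (p : R) ∈ maximalIdeal R) {j : ZMod f} {κ : Fin 2}
    {x : (ResidueField R)⟦X⟧ ⊗[R⟦X⟧] M j}
    (hx : ∀ g, (𝔐.baseChange (ResidueField R)).act j g x =
      C (a.eta p (ResidueField R) κ g : ResidueField R) • x) :
    ∃ y : M j, (1 : (ResidueField R)⟦X⟧) ⊗ₜ[R⟦X⟧] y = x ∧
      ∀ g, 𝔐.act j g y = C (a.eta p R κ g : R) • y := by
  have hC : ∀ (ω r : R), rescale ω (C r) = C r := by
    intro ω r
    ext n
    rw [coeff_rescale, coeff_C]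
    split_ifs with h <;> simp [h]
  have := Fintype.ofFinite (GaloisField p f)ˣ
  obtain ⟨y, rfl⟩ := TensorProduct.mk_surjective R⟦X⟧ (M j) (ResidueField R)⟦X⟧
    (PowerSeries.map_surjective (residue R) residue_surjective) x
  rw [TensorProduct.mk_apply] at hx
  have hcard : IsUnit (Fintype.card (GaloisField p f)ˣ : R) := by
    rw [← residue_ne_zero_iff_isUnit, ← Nat.card_eq_fintype_card, Nat.card_units,
      GaloisField.card p f hf.out, Nat.cast_sub (one_lt_card : 1 < p ^ f).le, map_sub, Nat.cast_pow,
      map_pow, (residue_eq_zero_iff _).mpr hpm, zero_pow hf.out]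
    simp
  obtain ⟨u, hu⟩ := hcard.exists_left_inv
  have hmul : ∀ g h, a.eta p R κ (g * h) = a.eta p R κ g * a.eta p R κ h := fun g h => by
    simp only [Exponents.eta]
    rw [map_mul, mul_zpow]
  refine ⟨C u • ∑ g, C (((a.eta p R κ g)⁻¹ : Rˣ) : R) • 𝔐.act j g y, ?_, fun h => ?_⟩
  · have hη : ∀ g, algebraMap R (ResidueField R) (((a.eta p R κ g)⁻¹ : Rˣ) : R) *
        (a.eta p (ResidueField R) κ g : ResidueField R) = 1 := by
      intro g
      have : Units.map (algebraMap R (ResidueField R) : R →* ResidueField R) (a.eta p R κ g) =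
          a.eta p (ResidueField R) κ g := by
        simp only [Exponents.eta]
        rw [map_zpow]
        congr 1
      rw [← this]
      change algebraMap R (ResidueField R) _ * algebraMap R (ResidueField R) _ = 1
      rw [← map_mul, Units.inv_mul, map_one]
    have h1 : ∀ g, (1 : (ResidueField R)⟦X⟧) ⊗ₜ[R⟦X⟧]
        (C (((a.eta p R κ g)⁻¹ : Rˣ) : R) • 𝔐.act j g y) = 1 ⊗ₜ[R⟦X⟧] y := by
      intro g
      have h2 := hx g
      rw [baseChange_act_tmul, map_one] at h2
      rw [one_tmul_smul, h2, smul_smul, map_C, ← map_mul, hη, map_one, one_smul]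
    rw [one_tmul_smul, TensorProduct.tmul_sum, Finset.sum_congr rfl fun g _ => h1 g,
      Finset.sum_const, Finset.card_univ, ← Nat.cast_smul_eq_nsmul (ResidueField R)⟦X⟧, smul_smul,
      map_C]
    have h3 := congrArg (algebraMap R (ResidueField R)) hu
    rw [map_mul, map_natCast, map_one] at h3
    have h4 := congrArg (C (R := ResidueField R)) h3
    rw [map_mul, map_natCast, map_one] at h4
    rw [h4, one_smul, TensorProduct.mk_apply]
  · rw [LinearMap.map_smulₛₗ, hC, smul_comm (C (a.eta p R κ h : R)) (C u), map_sum,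
      Finset.smul_sum (r := C (a.eta p R κ h : R))]
    congr 1
    refine Fintype.sum_equiv (Equiv.mulLeft h) _ _ fun g => ?_
    rw [LinearMap.map_smulₛₗ, hC, ← 𝔐.act_mul, Equiv.coe_mulLeft, smul_smul, ← map_mul,
      ← Units.val_mul, hmul, mul_inv, mul_inv_cancel_left]

theorem exists_eigenbasis_lift (hpm : (p : R) ∈ maximalIdeal R)
    (β₀ : Eigenbasis (𝔐.baseChange (ResidueField R)) a) : ∃ β : Eigenbasis 𝔐 a, β.Lifts β₀ := by
  have := fun j κ => exists_eigenvector_lift hpm (β₀.eigen j κ)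
  choose v hv hv' using this
  -- `M j` is free over a local ring, of rank seen after base change, and two vectors form a basis
  -- once their determinant is a unit in the reduction.
  have hunit : ∀ j, ∃ b : Module.Basis (Fin 2) R⟦X⟧ (M j), ⇑b = v j := by
    intro j
    have := 𝔐.finite j
    have := 𝔐.projective j
    have hfree : Module.Free R⟦X⟧ (M j) := Module.free_of_flat_of_isLocalRing
    have hrank : Module.finrank R⟦X⟧ (M j) = 2 := by
      rw [← Module.finrank_baseChange (R := (ResidueField R)⟦X⟧),
        Module.finrank_eq_card_basis (β₀.basis j), Fintype.card_fin]
    let b := Module.finBasisOfFinrankEq R⟦X⟧ (M j) hrank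
    have hdet : PowerSeries.map (residue R) (b.det (v j)) =
        (b.baseChange (ResidueField R)⟦X⟧).det (β₀.basis j) := by
      rw [Module.Basis.det_apply, Module.Basis.det_apply, RingHom.map_det]
      congr 1
      refine Matrix.ext fun m l => ?_
      rw [RingHom.mapMatrix_apply, Matrix.map_apply, Module.Basis.toMatrix_apply,
        Module.Basis.toMatrix_apply, ← hv, Module.Basis.baseChange_repr_tmul, Algebra.smul_def,
        mul_one]
      rfl
    have hu : IsUnit (b.det (v j)) := by
      have := (b.baseChange (ResidueField R)⟦X⟧).isUnit_det (β₀.basis j)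
      rw [← hdet, isUnit_iff_constantCoeff, constantCoeff_map] at this
      rw [isUnit_iff_constantCoeff]
      exact isUnit_of_map_unit (residue R) _ this
    obtain ⟨h1, h2⟩ := b.is_basis_iff_det.mpr hu
    exact ⟨Module.Basis.mk h1 h2.ge, Module.Basis.coe_mk _ _⟩
  choose b hb using hunit
  exact ⟨⟨b, fun j κ g => by rw [hb]; exact hv' j κ g⟩, fun j κ => by
    change _ ⊗ₜ b j κ = _
    rw [hb, hv]⟩

end Lifting

/-! ## The residue field -/

section ResidueField

/-- A finite injective extension reflects units, and `p` is not a unit in `W(𝔽_q)`. -/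
theorem natCast_mem_maximalIdeal (p : ℕ) [hp : Fact p.Prime] (f : ℕ) (𝒪 : Type*) [CommRing 𝒪] [IsLocalRing 𝒪]
    [Algebra (WittFq p f) 𝒪] [Module.Finite (WittFq p f) 𝒪] [FaithfulSMul (WittFq p f) 𝒪] :
    (p : 𝒪) ∈ maximalIdeal 𝒪 := by
  rw [mem_maximalIdeal, mem_nonunits_iff]
  intro h
  have h1 : IsUnit (p : WittFq p f) := by
    refine isUnit_of_map_unit (algebraMap (WittFq p f) 𝒪) _ ?_
    rwa [map_natCast]
  have h2 := h1.map (WittVector.constantCoeff (p := p) (R := GaloisField p f))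
  rw [map_natCast, CharP.cast_eq_zero] at h2
  exact not_isUnit_zero h2

/-- Finitely many elements span the residue field over `W(𝔽_q)`, and `p` vanishes there, so
Teichmüller coefficients suffice; there are finitely many of them. -/
theorem finite_residueField (p : ℕ) [hp : Fact p.Prime] (f : ℕ) (𝒪 : Type*) [CommRing 𝒪] [IsLocalRing 𝒪]
    [Algebra (WittFq p f) 𝒪] [Module.Finite (WittFq p f) 𝒪] [FaithfulSMul (WittFq p f) 𝒪] :
    Finite (ResidueField 𝒪) := by
  have hfin : Module.Finite (WittFq p f) (ResidueField 𝒪) :=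
    Module.Finite.of_surjective (IsScalarTower.toAlgHom (WittFq p f) 𝒪 (ResidueField 𝒪)).toLinearMap
      residue_surjective
  obtain ⟨n, F, hF⟩ := Module.Finite.exists_fin' (WittFq p f) (ResidueField 𝒪)
  have : Finite (Fin n → GaloisField p f) := inferInstance
  refine Finite.of_surjective
    (fun y : Fin n → GaloisField p f => F fun i => WittVector.teichmuller p (y i)) fun x => ?_
  obtain ⟨w, rfl⟩ := hF x
  refine ⟨fun i => (w i).coeff 0, ?_⟩
  have hdiv : ∀ i, ∃ z, w i - WittVector.teichmuller p ((w i).coeff 0) = (p : WittFq p f) * z := by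
    intro i
    have : w i - WittVector.teichmuller p ((w i).coeff 0) ∈
        RingHom.ker (WittVector.constantCoeff (p := p) (R := GaloisField p f)) := by
      rw [RingHom.mem_ker, map_sub, WittVector.constantCoeff_apply, WittVector.constantCoeff_apply,
        WittVector.teichmuller_coeff_zero, sub_self]
    rw [WittVector.ker_constantCoeff] at this
    exact Ideal.mem_span_singleton.mp this
  choose z hz using hdiv
  have h1 : w - (fun i => WittVector.teichmuller p ((w i).coeff 0)) = (p : WittFq p f) • z :=
    funext fun i => hz i
  have h2 := congrArg F h1
  rw [map_sub, map_smul, Algebra.smul_def, map_natCast] at h2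
  have h3 : (p : ResidueField 𝒪) = 0 := by
    rw [← map_natCast (residue 𝒪), residue_eq_zero_iff]
    exact natCast_mem_maximalIdeal p f 𝒪
  rw [h3, zero_mul, sub_eq_zero] at h2
  exact h2.symm

end ResidueField

end KisinGL2

end

namespace KisinGL2

/-! ## The main theorem -/

theorem X_dvd_det_residual {F : Type*} [CommRing F] (σ : Shape) (c : F) :
    X ∣ (σ.residual c).det := by
  cases σ <;> simp [Shape.residual, Matrix.det_fin_two_of]

/-- Modulo the maximal ideal both sides are divisible by `X`; cancelling it exhibits an inverse of
the reduction of `h`. -/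
theorem isUnit_of_det_mul_eq {R : Type*} [CommRing R] [IsLocalRing R] {w : R}
    (hw : w ∈ maximalIdeal R) {f : ℕ} {i : ZMod f} {B : Matrix (Fin 2) (Fin 2) R⟦X⟧} {h : R⟦X⟧}
    {σ : Shape} {c α α' : ResidueField R}
    (hB : B.map (PowerSeries.map (residue R)) = twist i (σ.residual c) α α')
    (hdet : B.det * h = X + C w) : IsUnit h := by
  have h1 : X ∣ (twist i (σ.residual c) α α').det := by
    rw [twist]
    split_ifs
    · rw [Matrix.det_mul]
      exact (X_dvd_det_residual σ c).mul_right _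
    · exact X_dvd_det_residual σ c
  obtain ⟨g, hg⟩ := h1
  have h2 := congrArg (PowerSeries.map (residue R)) hdet
  rw [map_mul, RingHom.map_det, RingHom.mapMatrix_apply, hB, hg, map_add, map_X, map_C,
    (residue_eq_zero_iff w).mpr hw, map_zero, add_zero, mul_assoc] at h2
  have h3 : g * PowerSeries.map (residue R) h = 1 := X_mul_cancel (h2.trans (mul_one X).symm)
  have h4 : IsUnit (PowerSeries.map (residue R) h) :=
    IsUnit.of_mul_eq_one g ((mul_comm _ _).trans h3)
  rw [isUnit_iff_constantCoeff, constantCoeff_map] at h4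
  rw [isUnit_iff_constantCoeff]
  exact isUnit_of_map_unit (residue R) _ h4

end KisinGL2

open KisinGL2 in
theorem mainTheorem6 (p : ℕ) [Fact p.Prime] (f : ℕ) [NeZero f]
    -- the coefficient ring `𝒪`, the ring of integers of a finite extension of `K = W(𝔽_q)[1/p]`
    (𝒪 : Type*) [CommRing 𝒪] [IsDomain 𝒪] [IsDiscreteValuationRing 𝒪]
    [Algebra (KisinGL2.WittFq p f) 𝒪] [Module.Finite (KisinGL2.WittFq p f) 𝒪]
    [FaithfulSMul (KisinGL2.WittFq p f) 𝒪]
    -- a complete local Noetherian `𝒪`-algebra `R` with the same residue field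
    (R : Type*) [CommRing R] [IsLocalRing R] [IsNoetherianRing R]
    [IsAdicComplete (IsLocalRing.maximalIdeal R) R]
    [Algebra 𝒪 R] [IsLocalHom (algebraMap 𝒪 R)]
    (hres : Function.Bijective (IsLocalRing.ResidueField.map (algebraMap 𝒪 R)))
    [Algebra (KisinGL2.WittFq p f) R] [IsScalarTower (KisinGL2.WittFq p f) 𝒪 R]
    -- a generic tame principal series type and its orientation
    (a : KisinGL2.Exponents f) (ha : a.IsGeneric p)
    (s : ZMod f → Equiv.Perm (Fin 2)) (hs : a.IsOrientation p s)
    -- an element of `Y^{(0,1),τ}(R)`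
    (M : ZMod f → Type*) [∀ j, AddCommGroup (M j)] [∀ j, Module (PowerSeries R) (M j)]
    (𝔐 : KisinGL2.KisinModule p f R M) (h𝔐 : 𝔐.MemY a)
    -- the residual eigenbasis and its matrices
    (σ : ZMod f → KisinGL2.Shape) (c : ZMod f → IsLocalRing.ResidueField R)
    (hc : ∀ i, σ i = KisinGL2.Shape.three → c i ≠ 0)
    (α α' : (IsLocalRing.ResidueField R)ˣ)
    (βbar : KisinGL2.Eigenbasis (𝔐.baseChange (IsLocalRing.ResidueField R)) a)
    (hβbar : ∀ i, βbar.HasMatrix s i (KisinGL2.twist i ((σ i).residual (c i)) ↑α ↑α')) :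
    (∃ β : KisinGL2.Eigenbasis 𝔐 a, β.Lifts βbar ∧ β.HasNormalForm s σ c α α') ∧
    ∀ β β' : KisinGL2.Eigenbasis 𝔐 a,
      β.Lifts βbar → β.HasNormalForm s σ c α α' →
      β'.Lifts βbar → β'.HasNormalForm s σ c α α' →
      ∃ t : ZMod f → Fin 2 → Rˣ, ∀ j κ,
        β'.basis j κ = PowerSeries.C (t j κ : R) • β.basis j κ := by
  have hpm : (p : R) ∈ maximalIdeal R := by
    rw [mem_maximalIdeal, mem_nonunits_iff, ← map_natCast (algebraMap 𝒪 R)]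
    exact fun h => natCast_mem_maximalIdeal p f 𝒪 (isUnit_of_map_unit (algebraMap 𝒪 R) _ h)
  have hfin : Finite (ResidueField R) :=
    have := finite_residueField p f 𝒪
    Finite.of_surjective _ hres.2
  have hteich : ∀ x : ResidueField R, residue R (teich x) = x := fun x => (teich_spec x).1.1
  have hp3 : 3 ≤ p := by have := ha.five_le; omega
  choose e hT he using Exponents.exists_isGenericTwist ha hs
  constructor
  · obtain ⟨β₁, hβ₁⟩ := exists_eigenbasis_lift hpm βbar
    choose B hBX hB using fun i => β₁.exists_hasMatrix ha hs i
    have hBres : ∀ i, (B i).map (PowerSeries.map (residue R)) =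
        twist i ((σ i).residual (c i)) α α' := fun i => ((hB i).baseChange hβ₁).eq (hβbar i)
    choose h hh using fun i => (hB i).det_dvd hs h𝔐
    obtain ⟨K, x, y, z, hK, hx, hy, hz, hxy, hKN⟩ := exists_normalForm_twisted_conj (σ := σ)
      (b := fun i => teich (c i)) (c := c) (a := ![teich (α : ResidueField R), teich ↑α'])
      (α := ![(α : ResidueField R), ↑α']) hT hp3 hpm hBX
      (fun i => isUnit_of_det_mul_eq hpm (hBres i) (hh i).symm) (fun i => (hh i).symm)
      (fun i => hteich _) hc (Fin.forall_fin_two.mpr ⟨hteich _, hteich _⟩)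
      (Fin.forall_fin_two.mpr ⟨α.ne_zero, α'.ne_zero⟩) hBres
    obtain ⟨β, hβ⟩ := β₁.exists_change ha hs fun j =>
      isUnit_det_of_map_eq_one (map_iwahori_eq_one (hK j))
    exact ⟨β, (Eigenbasis.IsChange.lifts_iff hβ₁ hβ).mpr hK, x, y, z 0, z 1, hx, hy, hz 0, hz 1,
      hxy,
      fun i => (Eigenbasis.hasMatrix_iff ha hs (he i) (hβ i) (hβ _) (hB i)).mpr (hKN i)⟩
  · rintro β β' hβ ⟨x, y, z, z', hx, -, hz, hz', hxy, hB⟩ hβ'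
      ⟨x', y', t, t', hx', -, ht, ht', hxy', hB'⟩
    choose K hK using fun j => β.exists_isChange β' ha hs j
    have hunit : ∀ (α : (ResidueField R)ˣ) (z : R), z ∈ maximalIdeal R →
        IsUnit (teich (α : ResidueField R) + z) := fun α z hz => by
      rw [← residue_ne_zero_iff_isUnit, map_add, hteich, (residue_eq_zero_iff z).mpr hz, add_zero]
      exact α.ne_zero
    -- Both bases lift `βbar`, so the change of basis reduces to the identity and conjugates one
    -- normal form into the other.
    obtain ⟨r, hr⟩ := eq_diagonal_of_twisted_conj hT hp3 hpm
      (isNormal_twist_lifted (fun i => hteich (c i)) hc hx hxy (hunit α z hz) (hunit α' z' hz'))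
      (isNormal_twist_lifted (fun i => hteich (c i)) hc hx' hxy' (hunit α t ht) (hunit α' t' ht'))
      ((Eigenbasis.IsChange.lifts_iff hβ hK).mp hβ')
      fun i => (Eigenbasis.hasMatrix_iff ha hs (he i) (hK i) (hK _) (hB i)).mp (hB' i)
    refine ⟨fun j κ => r j ((s j).symm κ), fun j κ => ?_⟩
    obtain ⟨l, rfl⟩ := (s j).surjective κ
    rw [hK j l, hr j, Finset.sum_eq_single l]
    · simp [Exponents.lowDegree, vToU_C]
    · intro m _ hml
      simp [hml]
    · simp
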